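/- Notation. Let $n\ge 1$, let $B_s(x)$ be the open balls of $\mathbb R^n$, $e_1,\dots,e_n$ the standard basis, $e_0:=0$, and $\omega_k$ the volume of the unit ball of $\mathbb R^k$. Let $F\in C^\infty(\mathbb R^n\times\mathbb R^n;\mathbb R^n)$ be quadratic in its second variable, i.e. $F(x,v_1+v_2)+F(x,v_1-v_2)=2F(x,v_1)+2F(x,v_2)$. Put $F^q(x)(v_1\otimes v_2\otimes v_3)=\tfrac12 v_3\cdot\big(F(x,v_1+v_2)-F(x,v_1)-F(x,v_2)\big)$; for $a\in\mathbb R^n$ let $a\cdot F^q(x)$ be the symmetric matrix with entries $F^q(x)(e_i\otimes e_j\otimes a)$. For $r>0$ put $F_{r,x}(z,v)=rF(x+rz,v)$, $F^q_{r,x}(z)=rF^q(x+rz)$, and let $e(a)=\frac12(\nabla a+\nabla a^{\top})$. Rigid interpolation (RI). For $z\in B_1(0)$ let $S_z$ be the closed simplex with vertices $z+e_0,\dots,z+e_n$. Fix $0<\rho(n)\le 1$ such that $Q(n)=\{z\in B_1(0): B_{\rho(n)}(0)\subset \mathring S_z\subset S_z\subset B_1(0)\}$ has positive Lebesgue measure.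 For $i<j$ and $r$ small, let $\ell_{ij}$ be the short solution of $\ddot\gamma=F_{r,x}(\gamma,\dot\gamma)$ with $\gamma(0)=z+e_i$, $\gamma(t_{ij})=z+e_j$, $|\dot\gamma(0)|=1$, $0<t_{ij}<4$ (it exists and is unique for $r$ small), and let $\xi_{ij}=\dot\ell_{ij}(0)$, $\xi_{ji}=\dot\ell_{ij}(t_{ij})$, $E_{r,z}(w)=\sum_{0\le i<j\le n}|w^j\cdot\xi_{ji}-w^i\cdot\xi_{ij}|$ for $w=(w^0,\dots,w^n)\in(\mathbb R^n)^{n+1}$. $F$ satisfies (RI) with the dimensional constant $C(n)>0$ if for every $x\in\mathbb R^n$ there is $r_x>0$ such that for all $z\in Q(n)$, all $w$ and all $0<r\le r_x$ there is a smooth $a:B_1(0)\to\mathbb R^n$ with $a(z+e_i)=w^i$ for $0\le i\le n$ and $\|e(a)+a\cdot F^q_{r,x}\|_{L^\infty(S_z)}\le C(n)E_{r,z}(w)$. The space $GBD_F(\Omega)$. For $U\subset\mathbb R^n$ open and $|\xi|=1$, a smooth Lipschitz map $P:U\to\xi^\perp$ is a curvilinear projection parametrized by $\varphi$ if, for some $\rho,\tau>0$,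 $\varphi:D=\{y+t\xi: y\in\xi^\perp,|y|<\rho,|t|<\tau\}\to\mathbb R^n$ is smooth and Lipschitz, $U\subset\varphi(D)$, $\varphi$ has over $U$ a smooth Lipschitz inverse, $P(\varphi(y+t\xi))=y$ whenever $\varphi(y+t\xi)\in U$, and $\ddot\varphi=F(\varphi,\dot\varphi)$ on $D$, where dots are derivatives in $t$. For $B\subset U$ put $B^\xi_y=\{t:\varphi(y+t\xi)\in B\}$ and $\hat u^\xi_y(t)=u(\varphi(y+t\xi))\cdot\dot\varphi(y+t\xi)$. Let $\Omega\subset\mathbb R^n$ be open. A measurable $u:\Omega\to\mathbb R^n$ belongs to $GBD_F(\Omega)$, with associated measure $\lambda$, if $\lambda$ is a finite positive Borel measure and, for every open $U\subset\Omega$, every unit vector $\xi$ and every curvilinear projection $P:U\to\xi^\perp$ parametrized by $\varphi$, one has $\hat u^\xi_y\in BV_{loc}(U^\xi_y)$ for a.e. $y\in\xi^\perp$ and, for every Borel $B\subset U$, $$\int_{\xi^\perp}\Big(|D\hat u^\xi_y|(B^\xi_y\setminus J^1)+\mathcal H^0(B^\xi_y\cap J^1)\Big)\,d\mathcal H^{n-1}(y)\le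 \max\{1,\|\dot\varphi\|_{L^\infty}^2\}\,\mathrm{Lip}(P;U)^{n-1}\lambda(B),$$ where $J^1$ is the set of jump points of $\hat u^\xi_y$ with jump larger than $1$ in absolute value. Theorem. There is a constant $c(n)>0$, depending only on $n$ (through the fixed dimensional constants $\rho(n)$, $C(n)$), such that the following holds. Let $F$ be as above and satisfy (RI), let $\Omega\subset\mathbb R^n$ be open, let $u\in GBD_F(\Omega)$ with associated measure $\lambda$, and let $x\in\Omega$ satisfy $\Theta^{*n-1}(\lambda,x)=\limsup_{r\to0^+}\frac{\lambda(B_r(x))}{\omega_{n-1}r^{n-1}}=0$. Then there is $r_x>0$ with $B_{r_x}(x)\subset\Omega$ such that for every $0<r\le r_x$ there is a smooth map $a_r:B_1(0)\to\mathbb R^n$ with $$\|e(a_r)+a_r\cdot F^q_{r,x}\|_{L^\infty(B_{\rho(n)/2}(0))}\le c(n)\,r^{1-n}\lambda_r(B_1(0)),\qquad \int_{B_{\rho(n)/2}(0)}|u_{r,x}-a_r|\wedge1\,dz\le c(n)\,r^{1-n}\lambda_r(B_1(0)),$$ where $u_{r,x}(z)=u(x+rz)$ and $\lambda_r$ is the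 push-forward of $\lambda\llcorner B_r(x)$ under $y\mapsto (y-x)/r$. -/

import Mathlib

open MeasureTheory Set Filter Topology Metric
open scoped ENNReal NNReal ContDiff RealInnerProductSpace

noncomputable section

/-- Euclidean space `ℝⁿ`. -/
abbrev Euc (n : ℕ) : Type := EuclideanSpace ℝ (Fin n)

/-! ### Functions of one real variable -/

/-- Total variation of the distributional derivative of `f` on an open set `A ⊆ ℝ`:
the supremum of `∫ f ψ'` over test functions `ψ` supported in `A` with `|ψ| ≤ 1`. -/
def openVariation (f : ℝ → ℝ) (A : Set ℝ) : ℝ≥0∞ :=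
  ⨆ (ψ : ℝ → ℝ) (_ : ContDiff ℝ ∞ ψ) (_ : HasCompactSupport ψ) (_ : tsupport ψ ⊆ A)
    (_ : ∀ t, |ψ t| ≤ 1), ENNReal.ofReal (∫ t, f t * deriv ψ t)

/-- `f ∈ BV_loc(V)` for an open set `V ⊆ ℝ`. -/
structure IsBVLoc (f : ℝ → ℝ) (V : Set ℝ) : Prop where
  locallyIntegrable : LocallyIntegrableOn f V volume
  variation_lt_top : ∀ A : Set ℝ, IsOpen A → IsCompact (closure A) → closure A ⊆ V →
    openVariation f A < ⊤

/-- The value `|D f|(B)` of the total variation measure of `f ∈ BV_loc(V)` on `B ⊆ V`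
(outer regularity: infimum of the variation over the open sets between `B` and `V`). -/
def variationMeasure (f : ℝ → ℝ) (V B : Set ℝ) : ℝ≥0∞ :=
  ⨅ (A : Set ℝ) (_ : IsOpen A) (_ : B ⊆ A) (_ : A ⊆ V), openVariation f A

/-- `ℓ` is the approximate limit of `f` at `t` from the right. -/
def IsApproxLimRight (f : ℝ → ℝ) (t ℓ : ℝ) : Prop :=
  ∀ ε > 0, Tendsto
    (fun δ : ℝ => volume {s | s ∈ Ioo t (t + δ) ∧ ε < |f s - ℓ|} / ENNReal.ofReal δ)
    (𝓝[>] 0) (𝓝 0)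

/-- `ℓ` is the approximate limit of `f` at `t` from the left. -/
def IsApproxLimLeft (f : ℝ → ℝ) (t ℓ : ℝ) : Prop :=
  ∀ ε > 0, Tendsto
    (fun δ : ℝ => volume {s | s ∈ Ioo (t - δ) t ∧ ε < |f s - ℓ|} / ENNReal.ofReal δ)
    (𝓝[>] 0) (𝓝 0)

/-- The set `J¹_f` of the jump points of `f` in the open set `V` at which the jump is larger
than `1` in absolute value. -/
def largeJumpSet (f : ℝ → ℝ) (V : Set ℝ) : Set ℝ :=
  {t | t ∈ V ∧ ∃ a b : ℝ, IsApproxLimRight f t a ∧ IsApproxLimLeft f t b ∧ 1 < |a - b|}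

/-- The truncated variation `|D f|(B \ J¹_f) + ℋ⁰(B ∩ J¹_f)` of `f ∈ BV_loc(V)`. -/
def truncatedVariation (f : ℝ → ℝ) (V B : Set ℝ) : ℝ≥0∞ :=
  variationMeasure f V (B \ largeJumpSet f V) + ((B ∩ largeJumpSet f V).encard : ℝ≥0∞)

/-! ### Curvilinear projections -/

/-- The open cylinder `{y + t ξ : y ∈ ξ^⊥, |y| < ρ, |t| < τ}`. -/
def cylinder {n : ℕ} (ξ : Euc n) (ρ τ : ℝ) : Set (Euc n) :=
  {p | ∃ y : (ℝ ∙ ξ)ᗮ, ‖y‖ < ρ ∧ ∃ t : ℝ, |t| < τ ∧ p = (y : Euc n) + t • ξ}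

/-- The velocity `∂φ/∂t` of the curves `t ↦ φ (y + t ξ)`, at the point `p = y + t ξ`. -/
def velocity {n : ℕ} (φ : Euc n → Euc n) (ξ p : Euc n) : Euc n :=
  lineDeriv ℝ φ p ξ

/-- `P : U → ξ^⊥` is a curvilinear projection on `U` with respect to the field `F`, parametrized
by `φ` on the cylinder of radius `ρ` and half-height `τ`. -/
structure IsCurvilinearProjection {n : ℕ} (F : Euc n → Euc n → Euc n) (U : Set (Euc n))
    (ξ : Euc n) (P : Euc n → (ℝ ∙ ξ)ᗮ) (ρ τ : ℝ) (φ : Euc n → Euc n) : Prop where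
  radius_pos : 0 < ρ
  height_pos : 0 < τ
  proj_smooth : ContDiffOn ℝ ∞ P U
  proj_lipschitz : ∃ K : ℝ≥0, LipschitzOnWith K P U
  param_smooth : ContDiffOn ℝ ∞ φ (cylinder ξ ρ τ)
  param_lipschitz : ∃ K : ℝ≥0, LipschitzOnWith K φ (cylinder ξ ρ τ)
  covers : U ⊆ φ '' cylinder ξ ρ τ
  /-- over `U`, the map `φ` has an inverse, which is smooth and Lipschitz -/
  inverse : ∃ ψ : Euc n → Euc n,
    (∀ p ∈ cylinder ξ ρ τ, φ p ∈ U → ψ (φ p) = p) ∧ ContDiffOn ℝ ∞ ψ U ∧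
      ∃ K : ℝ≥0, LipschitzOnWith K ψ U
  proj_param : ∀ y : (ℝ ∙ ξ)ᗮ, ‖y‖ < ρ → ∀ t : ℝ, |t| < τ →
    φ ((y : Euc n) + t • ξ) ∈ U → P (φ ((y : Euc n) + t • ξ)) = y
  ode : ∀ p ∈ cylinder ξ ρ τ, velocity (velocity φ ξ) ξ p = F (φ p) (velocity φ ξ p)

/-- The least Lipschitz constant `Lip(P; U)`. -/
def lipConst {X Y : Type*} [PseudoEMetricSpace X] [PseudoEMetricSpace Y] (P : X → Y)
    (U : Set X) : ℝ≥0 :=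
  sInf {K : ℝ≥0 | LipschitzOnWith K P U}

/-- The slice `B^ξ_y = {t : φ (y + t ξ) ∈ B}` (empty if `y` is outside the base of the cylinder
on which `φ` is defined). -/
def sliceSet {n : ℕ} (φ : Euc n → Euc n) (ξ : Euc n) (ρ τ : ℝ) (B : Set (Euc n))
    (y : (ℝ ∙ ξ)ᗮ) : Set ℝ :=
  {t | ‖y‖ < ρ ∧ |t| < τ ∧ φ ((y : Euc n) + t • ξ) ∈ B}

/-- The slice `û^ξ_y (t) = u (φ (y + t ξ)) · φ̇ (y + t ξ)`. -/
def sliceFun {n : ℕ} (φ : Euc n → Euc n) (ξ : Euc n) (u : Euc n → Euc n)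
    (y : (ℝ ∙ ξ)ᗮ) (t : ℝ) : ℝ :=
  ⟪u (φ ((y : Euc n) + t • ξ)), velocity φ ξ ((y : Euc n) + t • ξ)⟫

/-! ### The space `GBD_F` -/

/-- `u ∈ GBD_F(Ω)`, with `lam` as a measure in the definition of this space: `u` is (Lebesgue)
measurable on `Ω` and, for every parametrized curvilinear projection on an open subset `U` of `Ω`,
almost every slice of `u` is in `BV_loc`, and the truncated variations of the slices are
controlled by `lam`. The space `GBD_F(Ω)` consists of the `u` for which there is a finite such
measure. The hyperplane `ξ^⊥` carries its Lebesgue measure, which is `ℋ^{n-1}` on it.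
The factor is `max 1 ‖φ̇‖²`: with `‖φ̇‖²` alone, replacing `φ (y + t ξ)` by `φ (y + c t ξ)` and
letting `c → 0` would force all the slices to be constant. As `‖φ̇‖² ≤ max 1 ‖φ̇‖²`, every `u`
that satisfies the bound with `‖φ̇‖²` satisfies this one with the same `lam`. -/
structure IsGBDMeasure {n : ℕ} (F : Euc n → Euc n → Euc n) (Ω : Set (Euc n))
    (u : Euc n → Euc n) (lam : Measure (Euc n)) : Prop where
  measurable : AEMeasurable u (volume.restrict Ω)
  slice_bv : ∀ U : Set (Euc n), IsOpen U → U ⊆ Ω → ∀ ξ : Euc n, ‖ξ‖ = 1 →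
    ∀ (P : Euc n → (ℝ ∙ ξ)ᗮ) (ρ τ : ℝ) (φ : Euc n → Euc n),
    IsCurvilinearProjection F U ξ P ρ τ φ →
    ∀ᵐ y : (ℝ ∙ ξ)ᗮ, IsBVLoc (sliceFun φ ξ u y) (sliceSet φ ξ ρ τ U y)
  slice_le : ∀ U : Set (Euc n), IsOpen U → U ⊆ Ω → ∀ ξ : Euc n, ‖ξ‖ = 1 →
    ∀ (P : Euc n → (ℝ ∙ ξ)ᗮ) (ρ τ : ℝ) (φ : Euc n → Euc n),
    IsCurvilinearProjection F U ξ P ρ τ φ →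
    ∀ B : Set (Euc n), MeasurableSet B → B ⊆ U →
    ∫⁻ y : (ℝ ∙ ξ)ᗮ,
        truncatedVariation (sliceFun φ ξ u y) (sliceSet φ ξ ρ τ U y) (sliceSet φ ξ ρ τ B y) ≤
      max 1 (eLpNorm (velocity φ ξ) ∞ (volume.restrict (cylinder ξ ρ τ)) ^ 2) *
        (lipConst P U : ℝ≥0∞) ^ (n - 1) * lam B

/-- The upper density `Θ^{*n-1}(lam, x) = limsup_{r → 0+} lam(B_r(x)) / (ω_{n-1} r^{n-1})`. -/
def upperDensity {n : ℕ} (lam : Measure (Euc n)) (x : Euc n) : ℝ≥0∞ :=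
  limsup (fun r : ℝ => lam (ball x r) /
    (volume (ball (0 : Euc (n - 1)) 1) * ENNReal.ofReal (r ^ (n - 1)))) (𝓝[>] 0)

/-! ### The field, its rescalings and the curvilinear symmetric gradient -/

/-- `F` is a quadratic form in its second variable. -/
def IsQuadraticField {n : ℕ} (F : Euc n → Euc n → Euc n) : Prop :=
  ∀ x v₁ v₂, F x (v₁ + v₂) + F x (v₁ - v₂) = (2 : ℝ) • F x v₁ + (2 : ℝ) • F x v₂

/-- The trilinear form `F^q(x)(v₁ ⊗ v₂ ⊗ v₃)` associated with `F`. -/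
def quadPolar {n : ℕ} (F : Euc n → Euc n → Euc n) (x v₁ v₂ v₃ : Euc n) : ℝ :=
  ⟪(1 / 2 : ℝ) • v₃, F x (v₁ + v₂) - F x v₁ - F x v₂⟫

/-- The rescaled field `F_{r,x}(z, v) = r F(x + r z, v)`. -/
def rescaledField {n : ℕ} (F : Euc n → Euc n → Euc n) (r : ℝ) (x : Euc n) :
    Euc n → Euc n → Euc n :=
  fun z v => r • F (x + r • z) v

/-- The standard basis vector `e_i`. -/
def stdVec {n : ℕ} (i : Fin n) : Euc n := EuclideanSpace.single i 1

/-- The Euclidean symmetric gradient `(∇a + ∇aᵀ) / 2` of a vector field `a`. -/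
def symGrad {n : ℕ} (a : Euc n → Euc n) (h : Euc n) : Matrix (Fin n) (Fin n) ℝ :=
  Matrix.of fun i j => (fderiv ℝ a h (stdVec i) j + fderiv ℝ a h (stdVec j) i) / 2

/-- The symmetric matrix `a(h) · G^q(h)`. -/
def fieldTerm {n : ℕ} (G : Euc n → Euc n → Euc n) (a : Euc n → Euc n) (h : Euc n) :
    Matrix (Fin n) (Fin n) ℝ :=
  Matrix.of fun i j => quadPolar G h (stdVec i) (stdVec j) (a h)

/-- The curvilinear symmetric gradient of `a` for the field `G`. The sign is the one for which
`d/dt (a(γ) · γ') = (curvSymGrad G a γ) γ' · γ'` along the solutions of `γ'' = G(γ, γ')`. For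
`G^k(h, v) = - ∑ Γ^k_{ij}(h) v_i v_j` its entries are `(∂_i a_j + ∂_j a_i) / 2 - ∑ Γ^k_{ij} a_k`. -/
def curvSymGrad {n : ℕ} (G : Euc n → Euc n → Euc n) (a : Euc n → Euc n) (h : Euc n) :
    Matrix (Fin n) (Fin n) ℝ :=
  symGrad a h + fieldTerm G a h

/-- The Euclidean (Frobenius) norm of a matrix. -/
def frobNorm {n : ℕ} (M : Matrix (Fin n) (Fin n) ℝ) : ℝ :=
  √(∑ i, ∑ j, M i j ^ 2)

/-! ### The rigid interpolation condition -/

/-- The vertices `z + e_0, …, z + e_n` of the simplex based at `z`, where `e_0 = 0`. -/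
def simplexVertex {n : ℕ} (z : Euc n) (i : Fin (n + 1)) : Euc n :=
  z + (Fin.cases 0 stdVec i : Euc n)

/-- The closed simplex with vertices `z + e_0, …, z + e_n`. -/
def simplexHull {n : ℕ} (z : Euc n) : Set (Euc n) :=
  convexHull ℝ (range (simplexVertex z))

/-- The set `Q(n)` of the base points `z ∈ B_1(0)` whose simplex is contained in `B_1(0)` and
contains `B_ρ(0)` in its interior. -/
def goodBase (n : ℕ) (ρ : ℝ) : Set (Euc n) :=
  {z | z ∈ ball (0 : Euc n) 1 ∧ ball 0 ρ ⊆ interior (simplexHull z) ∧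
    simplexHull z ⊆ ball 0 1}

/-- There is a solution `γ` on `[0, T]` of `γ'' = G(γ, γ')` that connects `p` to `q` and has
initial velocity `ξ` with `|ξ| = 1` and final velocity `η`. Only curves with `T < 4` are
considered. Since `q = exp_p (T ξ)`, for `G = F_{r,x}` with `r` small there is exactly one such
curve for any two distinct points `p, q ∈ B_1(0)` at distance at most `√2`. -/
def IsConnection {n : ℕ} (G : Euc n → Euc n → Euc n) (p q ξ η : Euc n) : Prop :=
  ∃ (T : ℝ) (γ γ' : ℝ → Euc n), 0 < T ∧ T < 4 ∧
    (∀ t ∈ Icc 0 T, HasDerivWithinAt γ (γ' t) (Icc 0 T) t) ∧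
    (∀ t ∈ Icc 0 T, HasDerivWithinAt γ' (G (γ t) (γ' t)) (Icc 0 T) t) ∧
    γ 0 = p ∧ γ T = q ∧ γ' 0 = ξ ∧ γ' T = η ∧ ‖ξ‖ = 1

/-- The semi-norm `E(w) = ∑_{i<j} |w^j · ξ_{ji} - w^i · ξ_{ij}|`. -/
def edgeSeminorm {n : ℕ} (ξ : Fin (n + 1) → Fin (n + 1) → Euc n)
    (w : Fin (n + 1) → Euc n) : ℝ :=
  ∑ i, ∑ j, if i < j then |⟪w j, ξ j i⟫ - ⟪w i, ξ i j⟫| else 0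

/-- The rigid interpolation condition (RI) for `F`, with the constants `ρ` (in the definition of
the set of base points) and `C` (in the estimate). Here `ξ i j` and `ξ j i`, for `i < j`, are the
initial and the final velocity of the curve from `z + e_i` to `z + e_j` driven by `F_{r,x}`, which
exists and is unique for small `r`. -/
def RigidInterpolation {n : ℕ} (ρ C : ℝ) (F : Euc n → Euc n → Euc n) : Prop :=
  ∀ x : Euc n, ∃ rx : ℝ, 0 < rx ∧ ∀ z ∈ goodBase n ρ, ∀ w : Fin (n + 1) → Euc n,
    ∀ r : ℝ, 0 < r → r ≤ rx → ∀ ξ : Fin (n + 1) → Fin (n + 1) → Euc n,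
    (∀ i j, i < j → IsConnection (rescaledField F r x) (simplexVertex z i) (simplexVertex z j)
      (ξ i j) (ξ j i)) →
    ∃ a : Euc n → Euc n, ContDiffOn ℝ ∞ a (ball 0 1) ∧
      (∀ i, a (simplexVertex z i) = w i) ∧
      eLpNorm (fun h => frobNorm (curvSymGrad (rescaledField F r x) a h)) ∞
        (volume.restrict (simplexHull z)) ≤ ENNReal.ofReal (C * edgeSeminorm ξ w)

/-- The push-forward `lam_r` of the restriction of `lam` to `B_r(x)` under `y ↦ (y - x) / r`. -/
def rescaledMeasure {n : ℕ} (lam : Measure (Euc n)) (r : ℝ) (x : Euc n) : Measure (Euc n) :=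
  (lam.restrict (ball x r)).map fun y => r⁻¹ • (y - x)

end

/-! At a small scale the solutions of `γ'' = F(γ, γ')` are almost straight, and `u(γ) · γ'` plays
along them the role of the one-dimensional slices of a function of bounded deformation. The plan is
to turn the bound on the slices into a bound on the increments of `u(γ) · γ'` between the ends of
most curves, and then to interpolate `u` at the vertices of a well chosen simplex.

Curves. The inverse function theorem in a space of accelerations yields a smooth exponential map
(`exists_expMap`), and inverting it in the end point yields a logarithm (`exists_isGeodesicChart`).
For a fixed displacement `D`, the curves from `q` to `q + D`, with `q` in a hyperplane orthogonal to
`D`, are a small perturbation of parallel segments. They therefore form a curvilinear projection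
with speed and Lipschitz constant at most `2` (`exists_isCurvilinearProjection`).

Increments. On one curve, the truncated increment between almost all pairs of times is at most the
truncated variation. Fixing the displacement rather than an end point lets the starting point fill a
set of full dimension, so Fubini over parallel hyperplanes bounds the integral over `q`. The end
times themselves are negligible, hence the increments are first averaged over times close to both
ends; continuity in measure then gives `∫ |u(q + D) · γ'(|D|) - u(q) · γ'(0)| ∧ 1 dq ≤ c r
λ(B_r(x))`, uniformly in `D` (`lintegral_increment_le`).

Simplex. After rescaling to the unit ball, the edges of the simplex based at `z` have displacements
that do not depend on `z`. Averaging over `z` therefore selects a base point for which the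
increments along the edges, together with the mean increments from the vertices to the points of
`B_{ρ/2}(0)`, cost at most `c r^{1-n} λ(B_r(x))` (`exists_baseCost_le`). Zero density makes this
cost smaller than `1` for small `r`, so no edge increment is truncated, and (RI) supplies a field
`a` that equals `u` at the vertices and whose curvilinear symmetric gradient is bounded by the cost.

Comparison. Along the curve from a vertex to `q`, the increment of `a` is controlled by that
gradient (`abs_increment_le`) and that of `u` by the cost. Since `a = u` at the vertices, the
components of `u - a` at `q` along the `n + 1` arriving velocities are controlled. These velocities
are close to the vectors from the vertices to `q`, and `q` lies well inside the simplex, so they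
control `|u - a|` (`norm_le_sum_inner`, `exists_field_of_baseCost_lt_one`). -/

/-! ### Quadratic maps -/

section Quadratic

variable {E G : Type*} [NormedAddCommGroup E] [NormedAddCommGroup G] [NormedSpace ℝ G]

/-- The polar form of a map satisfying the parallelogram law is additive in the second variable. -/
theorem polar_add_of_parallelogram {f : E → G}
    (hf : ∀ v w, f (v + w) + f (v - w) = (2 : ℝ) • f v + (2 : ℝ) • f w) (x y z : E) :
    f (x + (y + z)) - f x - f (y + z) = (f (x + y) - f x - f y) + (f (x + z) - f x - f z) := by
  -- The combination `h1 - h2 + h3` isolates `2 f(x + y + z)`, and `h4` removes the remaining term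
  -- `f(y - z)`.
  have h1 := hf (x + y) z
  have h2 := hf x (y - z)
  have h3 := hf (x + z) y
  have h4 := hf y z
  have e1 : x + y - z = x + (y - z) := by abel
  have e2 : x - (y - z) = x + z - y := by abel
  have e3 : x + z + y = x + (y + z) := by abel
  have e4 : x + y + z = x + (y + z) := by abel
  rw [e1, e4] at h1
  rw [e2] at h2
  rw [e3] at h3
  have key : (2 : ℝ) • (f (x + (y + z)) - f x - f (y + z)) =
      (2 : ℝ) • ((f (x + y) - f x - f y) + (f (x + z) - f x - f z)) := by
    have : (2 : ℝ) • f (x + (y + z)) = (f (x + (y + z)) + f (x + (y - z)))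
        - (f (x + (y - z)) + f (x + z - y)) + (f (x + (y + z)) + f (x + z - y)) := by
      rw [two_smul]; abel
    rw [smul_sub, smul_sub, this, h1, h2, h3]
    have h5 : f (y - z) = (2 : ℝ) • f y + (2 : ℝ) • f z - f (y + z) := by
      rw [← h4]; abel
    rw [h5]
    module
  exact smul_right_injective G (two_ne_zero' ℝ) key

theorem map_zero_of_parallelogram {f : E → G}
    (hf : ∀ v w, f (v + w) + f (v - w) = (2 : ℝ) • f v + (2 : ℝ) • f w) : f 0 = 0 := by
  have h := hf 0 0
  simp only [add_zero, sub_zero] at h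
  have h2 : (2 : ℝ) • f 0 = 0 := by
    have : (2 : ℝ) • f 0 = ((2 : ℝ) • f 0 + (2 : ℝ) • f 0) - (f 0 + f 0) := by
      rw [two_smul]; abel
    rw [this, h, sub_self]
  exact (smul_eq_zero.1 h2).resolve_left two_ne_zero

theorem map_add_self_of_parallelogram {f : E → G}
    (hf : ∀ v w, f (v + w) + f (v - w) = (2 : ℝ) • f v + (2 : ℝ) • f w) (v : E) :
    f (v + v) = (4 : ℝ) • f v := by
  have h := hf v v
  rw [sub_self, map_zero_of_parallelogram hf, add_zero] at h
  rw [h]; module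

variable [NormedSpace ℝ E]

/-- The polar form of a continuous map satisfying the parallelogram law is linear in the second
variable. -/
theorem polar_smul_of_parallelogram {f : E → G} (hc : Continuous f)
    (hf : ∀ v w, f (v + w) + f (v - w) = (2 : ℝ) • f v + (2 : ℝ) • f w) (c : ℝ) (x y : E) :
    f (x + c • y) - f x - f (c • y) = c • (f (x + y) - f x - f y) := by
  let g : E →+ G := AddMonoidHom.mk' (fun y => f (x + y) - f x - f y)
    (fun y z => polar_add_of_parallelogram hf x y z)
  have hg : Continuous g := by
    change Continuous fun y => f (x + y) - f x - f y
    fun_prop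
  exact map_real_smul g hg c y

/-- With `B` the polar form, `B(cv, cv) = c B(cv, v) = c² B(v, v)` by symmetry and linearity in the
second variable, while `B(v, v) = 2 f(v)`. -/
theorem map_smul_of_parallelogram {f : E → G} (hc : Continuous f)
    (hf : ∀ v w, f (v + w) + f (v - w) = (2 : ℝ) • f v + (2 : ℝ) • f w) (c : ℝ) (v : E) :
    f (c • v) = c ^ 2 • f v := by
  have h1 := polar_smul_of_parallelogram hc hf c (c • v) v
  have h2 := polar_smul_of_parallelogram hc hf c v v
  have h3 := map_add_self_of_parallelogram hf (c • v)
  have h4 := map_add_self_of_parallelogram hf v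
  have e : f (c • v + v) - f (c • v) - f v = f (v + c • v) - f v - f (c • v) := by
    rw [add_comm]; abel
  rw [e, h2, h3, h4] at h1
  have h5 : (2 : ℝ) • f (c • v) = (2 : ℝ) • (c ^ 2 • f v) := by
    calc (2 : ℝ) • f (c • v) = (4 : ℝ) • f (c • v) - f (c • v) - f (c • v) := by module
      _ = c • c • ((4 : ℝ) • f v - f v - f v) := h1
      _ = _ := by module
  exact smul_right_injective G (two_ne_zero' ℝ) h5

end Quadratic

/-! ### Composition operators on spaces of continuous maps -/

section Nemytskii

/-- The evaluation pairing `C(K, E →L G) → C(K, E) → C(K, G)`. -/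
noncomputable def ContinuousMap.clmApplyL (K : Type*) [TopologicalSpace K] [CompactSpace K] (E G : Type*)
    [NormedAddCommGroup E] [NormedSpace ℝ E] [NormedAddCommGroup G] [NormedSpace ℝ G] :
    C(K, E →L[ℝ] G) →L[ℝ] C(K, E) →L[ℝ] C(K, G) :=
  LinearMap.mkContinuous₂
    (LinearMap.mk₂ ℝ (fun (A : C(K, E →L[ℝ] G)) (h : C(K, E)) =>
        (⟨fun x => A x (h x), by fun_prop⟩ : C(K, G)))
      (fun A B h => by ext x; simp) (fun c A h => by ext x; simp)
      (fun A h k => by ext x; simp) (fun c A h => by ext x; simp)) 1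
    (fun A h => by
      rw [one_mul]
      refine (ContinuousMap.norm_le _ (by positivity)).2 fun x => ?_
      exact ((A x).le_opNorm (h x)).trans
        (mul_le_mul (A.norm_coe_le_norm x) (h.norm_coe_le_norm x) (by positivity) (by positivity)))

theorem ContinuousMap.clmApplyL_apply {K : Type*} [TopologicalSpace K] [CompactSpace K]
    {E G : Type*} [NormedAddCommGroup E] [NormedSpace ℝ E] [NormedAddCommGroup G] [NormedSpace ℝ G]
    (A : C(K, E →L[ℝ] G)) (h : C(K, E)) (x : K) :
    ContinuousMap.clmApplyL K E G A h x = A x (h x) := rfl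

/-- The mean value inequality is applied at each point of `K`; the error is uniform because `g ↦ f'
∘ g` is continuous for the uniform norm, `K` being compact. -/
theorem hasFDerivAt_continuousMap_comp {K : Type*} [TopologicalSpace K] [CompactSpace K]
    {E G : Type*} [NormedAddCommGroup E] [NormedSpace ℝ E] [NormedAddCommGroup G] [NormedSpace ℝ G]
    (f : C(E, G)) (f' : C(E, E →L[ℝ] G)) (hf : ∀ x, HasFDerivAt f (f' x) x) (g : C(K, E)) :
    HasFDerivAt (fun g : C(K, E) => f.comp g) (ContinuousMap.clmApplyL K E G (f'.comp g)) g := by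
  rw [hasFDerivAt_iff_isLittleO_nhds_zero, Asymptotics.isLittleO_iff]
  intro c hc
  have hcont : Continuous fun h : C(K, E) => f'.comp (g + h) :=
    (ContinuousMap.continuous_postcomp f').comp (by fun_prop)
  obtain ⟨δ, hδ, h0⟩ := Metric.eventually_nhds_iff.1 (Metric.tendstoUniformly_iff.1
    (ContinuousMap.tendsto_iff_tendstoUniformly.1 (hcont.tendsto (0 : C(K, E)))) c hc)
  filter_upwards [Metric.ball_mem_nhds (0 : C(K, E)) hδ] with h hh
  refine (ContinuousMap.norm_le _ (by positivity)).2 fun x => ?_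
  have hseg : ∀ y ∈ segment ℝ (g x) (g x + h x), ‖f' y - f' (g x)‖ ≤ c := by
    intro y hy
    rw [segment_eq_image'] at hy
    obtain ⟨θ, hθ, rfl⟩ := hy
    have h1 : dist (θ • h) 0 < δ := by
      rw [dist_zero_right, norm_smul, Real.norm_of_nonneg hθ.1]
      rw [mem_ball_zero_iff] at hh
      exact (mul_le_of_le_one_left (norm_nonneg _) hθ.2).trans_lt hh
    have h2 := h0 h1 x
    rw [dist_comm, dist_eq_norm] at h2
    simpa using h2.le
  have := Convex.norm_image_sub_le_of_norm_hasFDerivWithin_le' (𝕜 := ℝ) (f := f) (f' := f')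
    (C := c) (φ := f' (g x)) (fun y _ => (hf y).hasFDerivWithinAt) hseg (convex_segment _ _)
    (left_mem_segment ℝ (g x) (g x + h x)) (right_mem_segment ℝ (g x) (g x + h x))
  have hx : ‖h x‖ ≤ ‖h‖ := h.norm_coe_le_norm x
  simp only [ContinuousMap.coe_sub, Pi.sub_apply, ContinuousMap.comp_apply,
    ContinuousMap.add_apply, ContinuousMap.clmApplyL_apply]
  rw [add_sub_cancel_left] at this
  exact this.trans (by gcongr)

universe u v

/-- The derivative of the composition operator of `f` is that of `f'` followed by a continuous
linear map, which gives an induction on the order. The target space changes at each step, so it is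
quantified inside; `E` and `G` share a universe so that `E →L[ℝ] G` stays in it. -/
theorem contDiff_nat_continuousMap_comp {K : Type v} [TopologicalSpace K] [CompactSpace K] (n : ℕ) :
    ∀ {E G : Type u} [NormedAddCommGroup E] [NormedSpace ℝ E] [NormedAddCommGroup G]
    [NormedSpace ℝ G] (f : C(E, G)), ContDiff ℝ ∞ f →
      ContDiff ℝ n (fun g : C(K, E) => f.comp g) := by
  induction n with
  | zero =>
    intro E G _ _ _ _ f hf
    exact contDiff_zero.2 (ContinuousMap.continuous_postcomp f)
  | succ n ih =>
    intro E G _ _ _ _ f hf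
    have hf' : ContDiff ℝ ∞ (fderiv ℝ f) := hf.fderiv_right (m := ∞) (by simp)
    push_cast
    refine contDiff_succ_iff_hasFDerivAt.2 ⟨fun g =>
      ContinuousMap.clmApplyL K E G ((⟨fderiv ℝ f, hf'.continuous⟩ : C(E, E →L[ℝ] G)).comp g),
      ?_, fun g => ?_⟩
    · exact (ContinuousLinearMap.contDiff _).comp (ih (⟨fderiv ℝ f, hf'.continuous⟩ : C(E, E →L[ℝ] G)) hf')
    · exact hasFDerivAt_continuousMap_comp f ⟨fderiv ℝ f, hf'.continuous⟩
        (fun x => (hf.differentiable (by simp) x).hasFDerivAt) g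

/-- Composition with a smooth map is a smooth operator on spaces of continuous maps. -/
theorem contDiff_continuousMap_comp {K : Type v} [TopologicalSpace K] [CompactSpace K]
    {E G : Type u} [NormedAddCommGroup E] [NormedSpace ℝ E] [NormedAddCommGroup G]
    [NormedSpace ℝ G] (f : C(E, G)) (hf : ContDiff ℝ ∞ f) :
    ContDiff ℝ ∞ (fun g : C(K, E) => f.comp g) :=
  contDiff_infty.2 fun n => contDiff_nat_continuousMap_comp n f hf

end Nemytskii

/-! ### Smooth local inverses -/

/-- The inverse function theorem alone gives smoothness at the image of `a`. Restricting the local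
inverse to the open set where the derivative stays invertible makes it smooth on its whole target.
-/
theorem exists_smooth_openPartialHomeomorph {E G : Type*} [NormedAddCommGroup E] [NormedSpace ℝ E]
    [NormedAddCommGroup G] [NormedSpace ℝ G] [CompleteSpace E] {f : E → G} {s : Set E} {a : E}
    (hs : IsOpen s) (ha : a ∈ s) (hf : ContDiffOn ℝ ∞ f s) (f' : E ≃L[ℝ] G)
    (hf' : HasFDerivAt f (f' : E →L[ℝ] G) a) :
    ∃ Φ : OpenPartialHomeomorph E G, a ∈ Φ.source ∧ Φ.source ⊆ s ∧ (∀ x, Φ x = f x) ∧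
      ContDiffOn ℝ ∞ Φ.symm Φ.target := by
  have hfa : ContDiffAt ℝ ∞ f a := hf.contDiffAt (hs.mem_nhds ha)
  let Φ₀ := hfa.toOpenPartialHomeomorph f hf' (by simp)
  have hcont : ContinuousOn (fderiv ℝ f) s := hf.continuousOn_fderiv_of_isOpen hs (by simp)
  have hW : IsOpen (s ∩ fderiv ℝ f ⁻¹' range ((↑) : (E ≃L[ℝ] G) → (E →L[ℝ] G))) :=
    hcont.isOpen_inter_preimage hs ContinuousLinearEquiv.isOpen
  set W := s ∩ fderiv ℝ f ⁻¹' range ((↑) : (E ≃L[ℝ] G) → (E →L[ℝ] G)) with hWdef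
  have haW : a ∈ W := ⟨ha, by rw [mem_preimage, hf'.fderiv]; exact mem_range_self _⟩
  refine ⟨Φ₀.restrOpen W hW, ⟨hfa.mem_toOpenPartialHomeomorph_source hf' (by simp), haW⟩,
    fun x hx => hx.2.1, fun x => rfl, ?_⟩
  intro b hb
  have hb' := (Φ₀.restrOpen W hW).map_target hb
  obtain ⟨-, hbs, g', hg'⟩ := hb'
  refine ((Φ₀.restrOpen W hW).contDiffAt_symm (f₀' := g') hb ?_ ?_).contDiffWithinAt
  · change HasFDerivAt f _ _
    rw [hg']
    exact ((hf.contDiffAt (hs.mem_nhds hbs)).differentiableAt (by simp)).hasFDerivAt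
  · exact hf.contDiffAt (hs.mem_nhds hbs)

/-! ### The exponential map of a quadratic second order field -/

section ExpMap

universe u
variable {E : Type u} [NormedAddCommGroup E]

/-- The constant extension of a curve on `[-1, 1]`. -/
noncomputable def extendCurve (w : C(Icc (-1 : ℝ) 1, E)) (s : ℝ) : E :=
  w (projIcc (-1) 1 (by norm_num) s)

theorem continuous_extendCurve (w : C(Icc (-1 : ℝ) 1, E)) : Continuous (extendCurve w) :=
  w.continuous.comp continuous_projIcc

theorem extendCurve_of_mem (w : C(Icc (-1 : ℝ) 1, E)) {s : ℝ} (hs : s ∈ Icc (-1 : ℝ) 1) :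
    extendCurve w s = w ⟨s, hs⟩ := by
  rw [extendCurve, projIcc_of_mem _ hs]

variable [NormedSpace ℝ E]

/-- The constant curves on `[-1, 1]`. -/
noncomputable def constCurve (E : Type u) [NormedAddCommGroup E] [NormedSpace ℝ E] :
    E →L[ℝ] C(Icc (-1 : ℝ) 1, E) :=
  LinearMap.mkContinuous
    { toFun := ContinuousMap.const _, map_add' := fun _ _ => rfl, map_smul' := fun _ _ => rfl } 1
    (fun v => by
      rw [one_mul]
      exact (ContinuousMap.norm_le _ (norm_nonneg _)).2 fun _ => le_rfl)

theorem continuous_primitive {f : ℝ → E} (hf : Continuous f) :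
    Continuous fun t => ∫ s in (0 : ℝ)..t, f s :=
  intervalIntegral.continuous_primitive (fun a b => hf.intervalIntegrable a b) 0

/-- The primitive vanishing at `0` of a curve on `[-1, 1]`. -/
noncomputable def primCurve (E : Type u) [NormedAddCommGroup E] [NormedSpace ℝ E] :
    C(Icc (-1 : ℝ) 1, E) →L[ℝ] C(Icc (-1 : ℝ) 1, E) :=
  LinearMap.mkContinuous
    { toFun := fun w => ⟨fun t => ∫ s in (0 : ℝ)..t, extendCurve w s,
        (continuous_primitive (continuous_extendCurve w)).comp continuous_subtype_val⟩
      map_add' := fun w w' => by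
        ext t
        exact intervalIntegral.integral_add ((continuous_extendCurve w).intervalIntegrable _ _)
          ((continuous_extendCurve w').intervalIntegrable _ _)
      map_smul' := fun c w => by
        ext t
        exact intervalIntegral.integral_smul c (extendCurve w) } 1
    (fun w => by
      rw [one_mul]
      refine (ContinuousMap.norm_le _ (norm_nonneg _)).2 fun t => ?_
      refine (intervalIntegral.norm_integral_le_of_norm_le_const
        (C := ‖w‖) fun s _ => w.norm_coe_le_norm _).trans ?_
      have : |(t : ℝ) - 0| ≤ 1 := by rw [sub_zero, abs_le]; exact t.2
      exact mul_le_of_le_one_right (norm_nonneg _) this)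

/-- The velocity with acceleration `w` and initial value `v`. -/
noncomputable def velCurve (v : E) (w : C(Icc (-1 : ℝ) 1, E)) (t : ℝ) : E :=
  v + ∫ s in (0 : ℝ)..t, extendCurve w s

/-- The position with acceleration `w` and initial data `q`, `v`. -/
noncomputable def posCurve (q v : E) (w : C(Icc (-1 : ℝ) 1, E)) (t : ℝ) : E :=
  q + ∫ s in (0 : ℝ)..t, velCurve v w s

theorem continuous_velCurve (v : E) (w : C(Icc (-1 : ℝ) 1, E)) : Continuous (velCurve v w) :=
  continuous_const.add (continuous_primitive (continuous_extendCurve w))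

theorem hasDerivAt_velCurve [CompleteSpace E] (v : E) (w : C(Icc (-1 : ℝ) 1, E)) (t : ℝ) :
    HasDerivAt (velCurve v w) (extendCurve w t) t :=
  ((continuous_extendCurve w).integral_hasStrictDerivAt 0 t).hasDerivAt.const_add v

theorem hasDerivAt_posCurve [CompleteSpace E] (q v : E) (w : C(Icc (-1 : ℝ) 1, E)) (t : ℝ) :
    HasDerivAt (posCurve q v w) (velCurve v w t) t :=
  ((continuous_velCurve v w).integral_hasStrictDerivAt 0 t).hasDerivAt.const_add q

/-- The phase curve `(position, velocity)` as a linear function of the data. -/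
noncomputable def phaseCurve (E : Type u) [NormedAddCommGroup E] [NormedSpace ℝ E] :
    ((E × E) × C(Icc (-1 : ℝ) 1, E)) →L[ℝ] C(Icc (-1 : ℝ) 1, E × E) :=
  let velL : ((E × E) × C(Icc (-1 : ℝ) 1, E)) →L[ℝ] C(Icc (-1 : ℝ) 1, E) :=
    constCurve E ∘L ContinuousLinearMap.snd ℝ E E ∘L ContinuousLinearMap.fst ℝ (E × E) _ +
      primCurve E ∘L ContinuousLinearMap.snd ℝ (E × E) _
  (ContinuousLinearMap.inl ℝ E E).compLeftContinuous ℝ _ ∘L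
      (constCurve E ∘L ContinuousLinearMap.fst ℝ E E ∘L ContinuousLinearMap.fst ℝ (E × E) _ +
        primCurve E ∘L velL) +
    (ContinuousLinearMap.inr ℝ E E).compLeftContinuous ℝ _ ∘L velL

theorem phaseCurve_apply (q v : E) (w : C(Icc (-1 : ℝ) 1, E)) (t : Icc (-1 : ℝ) 1) :
    phaseCurve E ((q, v), w) t = (posCurve q v w t, velCurve v w t) := by
  have h1 : ∀ s : Icc (-1 : ℝ) 1, (constCurve E v + primCurve E w) s = velCurve v w s :=
    fun s => rfl
  have h2 : (constCurve E q + primCurve E (constCurve E v + primCurve E w)) t =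
      posCurve q v w t := by
    change q + ∫ s in (0 : ℝ)..t, extendCurve (constCurve E v + primCurve E w) s = _
    rw [posCurve]
    congr 1
    refine intervalIntegral.integral_congr fun s hs => ?_
    have hs' : s ∈ Icc (-1 : ℝ) 1 :=
      (uIcc_subset_Icc (a₁ := 0) (by constructor <;> norm_num) t.2) hs
    rw [extendCurve_of_mem _ hs']
    exact h1 _
  ext1
  · change ((constCurve E q + primCurve E (constCurve E v + primCurve E w)) t) + 0 = _
    rw [add_zero]; exact h2
  · change 0 + (constCurve E v + primCurve E w) t = _
    rw [zero_add]; exact h1 t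

/-- The curve `s ↦ τ² w(τ s)`. -/
noncomputable def scaleCurve (τ : ℝ) (w : C(Icc (-1 : ℝ) 1, E)) : C(Icc (-1 : ℝ) 1, E) :=
  ⟨fun s => τ ^ 2 • extendCurve w (τ * s), by
    have := continuous_extendCurve w
    fun_prop⟩

theorem norm_scaleCurve_le {τ : ℝ} (hτ : |τ| ≤ 1) (w : C(Icc (-1 : ℝ) 1, E)) :
    ‖scaleCurve τ w‖ ≤ ‖w‖ := by
  refine (ContinuousMap.norm_le _ (norm_nonneg _)).2 fun s => ?_
  change ‖τ ^ 2 • extendCurve w (τ * s)‖ ≤ _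
  rw [norm_smul, norm_pow, Real.norm_eq_abs]
  exact (mul_le_of_le_one_left (norm_nonneg _) (pow_le_one₀ (abs_nonneg _) hτ)).trans
    (w.norm_coe_le_norm _)

/-- Slowing a curve down by `τ` multiplies velocities by `τ` and accelerations by `τ²`. The
restriction on `s` excludes the region where the constant extension of `scaleCurve τ w` takes over.
-/
theorem velCurve_scaleCurve (τ : ℝ) (v : E) (w : C(Icc (-1 : ℝ) 1, E)) {s : ℝ}
    (hs : s ∈ Icc (-1 : ℝ) 1) :
    velCurve (τ • v) (scaleCurve τ w) s = τ • velCurve v w (τ * s) := by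
  have h : ∫ σ in (0 : ℝ)..s, extendCurve (scaleCurve τ w) σ =
      ∫ σ in (0 : ℝ)..s, τ ^ 2 • extendCurve w (τ * σ) := by
    refine intervalIntegral.integral_congr fun σ hσ => ?_
    have hσ' : σ ∈ Icc (-1 : ℝ) 1 :=
      (uIcc_subset_Icc (a₁ := 0) (by constructor <;> norm_num) hs) hσ
    rw [extendCurve_of_mem _ hσ']
    rfl
  rw [velCurve, velCurve, h, intervalIntegral.integral_smul, sq, mul_smul,
    intervalIntegral.smul_integral_comp_mul_left (extendCurve w) τ, mul_zero, smul_add]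

theorem posCurve_scaleCurve (τ : ℝ) (q v : E) (w : C(Icc (-1 : ℝ) 1, E)) {s : ℝ}
    (hs : s ∈ Icc (-1 : ℝ) 1) :
    posCurve q (τ • v) (scaleCurve τ w) s = posCurve q v w (τ * s) := by
  have h : ∫ σ in (0 : ℝ)..s, velCurve (τ • v) (scaleCurve τ w) σ =
      ∫ σ in (0 : ℝ)..s, τ • velCurve v w (τ * σ) := by
    refine intervalIntegral.integral_congr fun σ hσ => ?_
    exact velCurve_scaleCurve τ v w
      ((uIcc_subset_Icc (a₁ := 0) (by constructor <;> norm_num) hs) hσ)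
  rw [posCurve, posCurve, h, intervalIntegral.integral_smul,
    intervalIntegral.smul_integral_comp_mul_left (velCurve v w) τ, mul_zero]

/-- The derivative at a zero of the second variable of a smooth field that is quadratic in this
variable vanishes. -/
theorem hasFDerivAt_zero_of_parallelogram {F : E × E → E} (hF : ContDiff ℝ ∞ F)
    (hpar : ∀ x v w, F (x, v + w) + F (x, v - w) = (2 : ℝ) • F (x, v) + (2 : ℝ) • F (x, w))
    (x : E) : HasFDerivAt F (0 : E × E →L[ℝ] E) (x, 0) := by
  have hd := (hF.differentiable (by simp) (x, 0)).hasFDerivAt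
  suffices h : fderiv ℝ F (x, 0) = 0 by rwa [h] at hd
  refine ContinuousLinearMap.ext fun p => ?_
  obtain ⟨a, b⟩ := p
  have hline : HasDerivAt (fun t : ℝ => (x, (0 : E)) + t • (a, b)) (a, b) 0 := by
    simpa using ((hasDerivAt_id (0 : ℝ)).smul_const (a, b)).const_add (x, (0 : E))
  have hd' : HasFDerivAt F (fderiv ℝ F (x, 0)) ((fun t : ℝ => (x, (0 : E)) + t • (a, b)) 0) := by
    simpa using hd
  have h1 := hd'.comp_hasDerivAt (0 : ℝ) hline
  -- By homogeneity this is `F` along the line through `(x, 0)` with direction `(a, b)`; the factor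
  -- `t²` kills its derivative at `0`.
  have h2 : HasDerivAt (fun t : ℝ => t ^ 2 • F (x + t • a, b)) 0 0 := by
    have hF1 : DifferentiableAt ℝ (fun t : ℝ => F (x + t • a, b)) 0 := by
      have := hF.differentiable (by simp)
      fun_prop
    have := (hasDerivAt_pow 2 (0 : ℝ)).smul hF1.hasDerivAt
    simp only [Nat.cast_ofNat, ne_eq, OfNat.ofNat_ne_zero, not_false_eq_true, zero_pow, zero_smul,
      Nat.add_one_sub_one, pow_one, mul_zero, add_zero] at this
    exact this
  have h3 : F ∘ (fun t : ℝ => (x, (0 : E)) + t • (a, b)) = fun t : ℝ => t ^ 2 • F (x + t • a, b) := by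
    funext t
    have := map_smul_of_parallelogram (f := fun v => F (x + t • a, v))
      (hF.continuous.comp (by fun_prop)) (hpar _) t b
    simpa using this
  rw [h3] at h1
  exact h1.unique h2

/-- Smooth exponential map: for a smooth field `F` which is quadratic in the velocity, the curves
`t ↦ e (q, t v)` solve `γ'' = F (γ, γ')`. -/
theorem exists_expMap [CompleteSpace E] {F : E × E → E} (hF : ContDiff ℝ ∞ F)
    (hpar : ∀ x v w, F (x, v + w) + F (x, v - w) = (2 : ℝ) • F (x, v) + (2 : ℝ) • F (x, w))
    (x : E) : ∃ (η : ℝ) (e : E × E → E), 0 < η ∧ ContDiffOn ℝ ∞ e (ball (x, 0) η) ∧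
      (∀ q, (q, (0 : E)) ∈ ball (x, (0 : E)) η → e (q, 0) = q) ∧
      (∀ q v, (q, (0 : E)) ∈ ball (x, (0 : E)) η → HasDerivAt (fun t : ℝ => e (q, t • v)) v 0) ∧
      ∀ q v (t : ℝ), (q, t • v) ∈ ball (x, (0 : E)) η →
        HasDerivAt (fun t : ℝ => e (q, t • v)) (deriv (fun t : ℝ => e (q, t • v)) t) t ∧
        HasDerivAt (deriv fun t : ℝ => e (q, t • v))
          (F (e (q, t • v), deriv (fun t : ℝ => e (q, t • v)) t)) t := by
  have hsm : ∀ y v (c : ℝ), F (y, c • v) = c ^ 2 • F (y, v) := fun y v c =>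
    map_smul_of_parallelogram (f := fun v => F (y, v)) (hF.continuous.comp (by fun_prop))
      (hpar y) c v
  have hzero : ∀ y, F (y, 0) = 0 := fun y => map_zero_of_parallelogram (f := fun v => F (y, v)) (hpar y)
  let X := C(Icc (-1 : ℝ) 1, E)
  let Fc : C(E × E, E) := ⟨F, hF.continuous⟩
  let N : C(Icc (-1 : ℝ) 1, E × E) → X := fun g => Fc.comp g
  have hN : ContDiff ℝ ∞ N := contDiff_continuousMap_comp Fc hF
  -- The unknown is the acceleration on `[-1, 1]`: the curve with initial data `p.1` and
  -- acceleration `p.2` solves the equation there exactly when the second component of `Ψ p`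
  -- vanishes. As `F` has zero derivative at `(x, 0)`, the derivative of `Ψ` at `a₀` is the
  -- identity.
  let Ψ : (E × E) × X → (E × E) × X := fun p => (p.1, p.2 - N (phaseCurve E p))
  have hΨ : ContDiff ℝ ∞ Ψ := by
    refine contDiff_fst.prodMk (contDiff_snd.sub (hN.comp (phaseCurve E).contDiff))
  let a₀ : (E × E) × X := ((x, 0), 0)
  have hphase : ∀ t, phaseCurve E a₀ t = (x, 0) := by
    intro t
    have hv : ∀ s, velCurve (0 : E) (0 : X) s = 0 := by
      intro s; simp [velCurve, extendCurve]
    rw [phaseCurve_apply]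
    simp [posCurve, hv]
  have hN' : HasFDerivAt (fun p => N (phaseCurve E p)) (0 : (E × E) × X →L[ℝ] X) a₀ := by
    have hF' : ContDiff ℝ ∞ (fderiv ℝ F) := hF.fderiv_right (m := ∞) (by simp)
    have h := hasFDerivAt_continuousMap_comp Fc ⟨fderiv ℝ F, hF'.continuous⟩
        (fun x => (hF.differentiable (by simp) x).hasFDerivAt) (phaseCurve E a₀)
    have h0 : (⟨fderiv ℝ F, hF'.continuous⟩ : C(E × E, E × E →L[ℝ] E)).comp (phaseCurve E a₀)
        = 0 := by
      refine ContinuousMap.ext fun t => ?_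
      change fderiv ℝ F (phaseCurve E a₀ t) = 0
      rw [hphase]
      exact (hasFDerivAt_zero_of_parallelogram hF hpar x).fderiv
    rw [h0, map_zero] at h
    have := h.comp a₀ (phaseCurve E).hasFDerivAt
    rwa [ContinuousLinearMap.zero_comp] at this
  have hΨ' : HasFDerivAt Ψ ((ContinuousLinearEquiv.refl ℝ ((E × E) × X) :
      ((E × E) × X) ≃L[ℝ] ((E × E) × X)) : (E × E) × X →L[ℝ] (E × E) × X) a₀ := by
    have := (hasFDerivAt_fst (𝕜 := ℝ) (p := a₀)).prodMk
      ((hasFDerivAt_snd (𝕜 := ℝ) (p := a₀)).sub hN')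
    refine this.congr_fderiv ?_
    ext1 <;> simp
  have hΨa : Ψ a₀ = a₀ := by
    refine Prod.ext rfl ?_
    refine ContinuousMap.ext fun t => ?_
    change (0 : E) - F (phaseCurve E a₀ t) = 0
    rw [hphase, hzero, sub_zero]
  obtain ⟨Φ, haΦ, -, hΦ, hΦs⟩ := exists_smooth_openPartialHomeomorph isOpen_univ (mem_univ a₀)
    hΨ.contDiffOn _ hΨ'
  obtain ⟨δ, hδ, hδs⟩ := Metric.isOpen_iff.1 Φ.open_source a₀ haΦ
  have hat : a₀ ∈ Φ.target := by
    have := Φ.map_source haΦ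
    rwa [hΦ, hΨa] at this
  have hsa : Φ.symm a₀ = a₀ := by
    have := Φ.left_inv haΦ
    rwa [hΦ, hΨa] at this
  have hev : ∀ᶠ p : E × E in 𝓝 (x, 0), (p, (0 : X)) ∈ Φ.target ∧
      Φ.symm (p, 0) ∈ ball a₀ δ := by
    have hj : Tendsto (fun p : E × E => (p, (0 : X))) (𝓝 (x, 0)) (𝓝 a₀) := by
      have : Continuous (fun p : E × E => (p, (0 : X))) := by fun_prop
      exact this.tendsto _
    refine (hj.eventually (Φ.open_target.mem_nhds hat)).and ?_
    have hc : Tendsto Φ.symm (𝓝 a₀) (𝓝 a₀) := by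
      have := (Φ.continuousAt_symm hat).tendsto
      rwa [hsa] at this
    exact (hc.comp hj).eventually (ball_mem_nhds a₀ hδ)
  obtain ⟨η₀, hη₀, hη₀s⟩ := Metric.eventually_nhds_iff_ball.1 hev
  obtain ⟨η, hη, hηη₀, hηδ⟩ : ∃ η, 0 < η ∧ η ≤ η₀ ∧ η ≤ δ :=
    ⟨min η₀ δ, lt_min hη₀ hδ, min_le_left _ _, min_le_right _ _⟩
  let w : E × E → X := fun p => (Φ.symm (p, 0)).2
  have hw1 : ∀ p ∈ ball (x, (0 : E)) η, Φ.symm (p, 0) = (p, w p) := by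
    intro p hp
    have h1 := (hη₀s p (ball_subset_ball hηη₀ hp)).1
    have h2 := Φ.right_inv h1
    rw [hΦ] at h2
    exact Prod.ext (show (Φ.symm (p, 0)).1 = p from congrArg Prod.fst h2) rfl
  have hw2 : ∀ p ∈ ball (x, (0 : E)) η, w p = N (phaseCurve E (p, w p)) := by
    intro p hp
    have h1 := (hη₀s p (ball_subset_ball hηη₀ hp)).1
    have h2 := Φ.right_inv h1
    rw [hΦ, hw1 p hp] at h2
    exact sub_eq_zero.1 (congrArg Prod.snd h2)
  have hw3 : ∀ p ∈ ball (x, (0 : E)) η, ‖w p‖ < δ := by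
    intro p hp
    have h1 := (hη₀s p (ball_subset_ball hηη₀ hp)).2
    rw [mem_ball, Prod.dist_eq, max_lt_iff] at h1
    simpa [a₀] using h1.2
  -- Uniqueness of small accelerations, from the injectivity of `Ψ` on the source of the local
  -- inverse.
  have hw4 : ∀ p ∈ ball (x, (0 : E)) η, ∀ w' : X, ‖w'‖ < δ → w' = N (phaseCurve E (p, w')) →
      w p = w' := by
    intro p hp w' hw' h
    have hmem : (p, w') ∈ Φ.source := by
      refine hδs ?_
      rw [mem_ball, Prod.dist_eq, max_lt_iff]
      exact ⟨(mem_ball.1 hp).trans_le hηδ, by simpa [a₀] using hw'⟩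
    have h1 : Φ (p, w') = (p, 0) := by
      rw [hΦ]
      exact Prod.ext rfl (sub_eq_zero.2 h)
    have h2 := Φ.left_inv hmem
    rw [h1] at h2
    exact congrArg Prod.snd h2
  have hball : ∀ q v (τ : ℝ), |τ| ≤ 1 → (q, v) ∈ ball (x, (0 : E)) η →
      (q, τ • v) ∈ ball (x, (0 : E)) η := by
    intro q v τ hτ h
    rw [mem_ball, Prod.dist_eq, max_lt_iff] at h ⊢
    refine ⟨h.1, ?_⟩
    have h2 := h.2
    simp only [dist_zero_right] at h2 ⊢
    rw [norm_smul, Real.norm_eq_abs]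
    exact (mul_le_of_le_one_left (norm_nonneg _) hτ).trans_lt h2
  have hpoint : ∀ p ∈ ball (x, (0 : E)) η, ∀ t ∈ Icc (-1 : ℝ) 1,
      extendCurve (w p) t = F (posCurve p.1 p.2 (w p) t, velCurve p.2 (w p) t) := by
    intro p hp t ht
    rw [extendCurve_of_mem _ ht]
    have := congrArg (fun g : X => g ⟨t, ht⟩) (hw2 p hp)
    refine this.trans ?_
    change F (phaseCurve E (p, w p) ⟨t, ht⟩) = _
    rw [show (p, w p) = ((p.1, p.2), w p) from rfl, phaseCurve_apply]
  -- The slowed-down acceleration is no larger and, `F` being quadratic in the velocity, solves the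
  -- fixed point equation with data `(q, τ v)`; uniqueness identifies it with `w (q, τ v)`. Hence
  -- the time-one map `e` recovers the whole curve by scaling the velocity.
  have hscale : ∀ q v (τ : ℝ), |τ| ≤ 1 → (q, v) ∈ ball (x, (0 : E)) η →
      w (q, τ • v) = scaleCurve τ (w (q, v)) := by
    intro q v τ hτ h
    refine hw4 _ (hball q v τ hτ h) _ ((norm_scaleCurve_le hτ _).trans_lt (hw3 _ h)) ?_
    refine ContinuousMap.ext fun s => ?_
    change τ ^ 2 • extendCurve (w (q, v)) (τ * s) = F (phaseCurve E ((q, τ • v), _) s)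
    have hs : τ * s ∈ Icc (-1 : ℝ) 1 := by
      rw [mem_Icc, ← abs_le, abs_mul]
      exact mul_le_one₀ hτ (abs_nonneg _) (abs_le.2 s.2)
    rw [phaseCurve_apply, posCurve_scaleCurve _ _ _ _ s.2, velCurve_scaleCurve _ _ _ s.2, hsm,
      hpoint _ h _ hs]
  let e : E × E → E := fun p => posCurve p.1 p.2 (w p) 1
  have hcurve : ∀ q v, (q, v) ∈ ball (x, (0 : E)) η → ∀ τ : ℝ, |τ| ≤ 1 →
      e (q, τ • v) = posCurve q v (w (q, v)) τ := by
    intro q v h τ hτ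
    change posCurve q (τ • v) (w (q, τ • v)) 1 = _
    rw [hscale q v τ hτ h, posCurve_scaleCurve _ _ _ _ (by norm_num), mul_one]
  have hball0 : ∀ q v, (q, (0 : E)) ∈ ball (x, (0 : E)) η → ∀ t : ℝ, ‖t • v‖ < η → (q, t • v) ∈ ball (x, (0 : E)) η := by
    intro q v hq t ht
    rw [mem_ball, Prod.dist_eq, max_lt_iff] at hq ⊢
    exact ⟨hq.1, by simpa using ht⟩
  -- A time `T` strictly beyond `|t|` places `t / T` inside `(-1, 1)`, so that the integral formula
  -- for the curve holds on a neighbourhood of `t`.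
  have hmain : ∀ q v (t : ℝ), (q, t • v) ∈ ball (x, (0 : E)) η →
      ∃ T : ℝ, |t| < T ∧ (q, T • v) ∈ ball (x, (0 : E)) η := by
    intro q v t h
    have hc : Continuous fun T : ℝ => (q, T • v) := by fun_prop
    have h' : (q, |t| • v) ∈ ball (x, (0 : E)) η := by
      rw [mem_ball, Prod.dist_eq, max_lt_iff] at h ⊢
      simpa [norm_smul] using h
    have hev : ∀ᶠ T in 𝓝[>] |t|, (q, T • v) ∈ ball (x, (0 : E)) η :=
      (hc.tendsto |t|).mono_left nhdsWithin_le_nhds (isOpen_ball.mem_nhds h')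
    obtain ⟨T, hT1, hT2⟩ := (hev.and self_mem_nhdsWithin).exists
    exact ⟨T, hT2, hT1⟩
  have hformula : ∀ q v (T : ℝ), 0 < T → (q, T • v) ∈ ball (x, (0 : E)) η → ∀ t : ℝ, |t| < T →
      HasDerivAt (fun t : ℝ => e (q, t • v))
        (T⁻¹ • velCurve (T • v) (w (q, T • v)) (T⁻¹ * t)) t := by
    intro q v T hT h t ht
    have h1 : (fun t : ℝ => e (q, t • v)) =ᶠ[𝓝 t]
        fun t => posCurve q (T • v) (w (q, T • v)) (T⁻¹ * t) := by
      have : ∀ᶠ s in 𝓝 t, |s| < T := continuous_abs.continuousAt.eventually_lt_const ht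
      filter_upwards [this] with s hs
      rw [← hcurve q (T • v) h (T⁻¹ * s), smul_smul]
      · congr 3; field_simp
      · rw [abs_mul, abs_inv, abs_of_pos hT, inv_mul_le_one₀ hT]; exact hs.le
    refine HasDerivAt.congr_of_eventuallyEq ?_ h1
    have h2 := hasDerivAt_posCurve q (T • v) (w (q, T • v)) (T⁻¹ * t)
    have h3 : HasDerivAt (fun t : ℝ => T⁻¹ * t) T⁻¹ t := by
      simpa using (hasDerivAt_id t).const_mul T⁻¹
    exact h2.scomp t h3
  refine ⟨η, e, hη, ?_, ?_, ?_, ?_⟩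
  · have hwc : ContDiffOn ℝ ∞ w (ball (x, (0 : E)) η) := by
      refine contDiff_snd.comp_contDiffOn (hΦs.comp (t := Φ.target) (f := fun p : E × E => (p, (0 : X))) ?_ ?_)
      · exact (contDiff_id.prodMk contDiff_const).contDiffOn
      · intro p hp
        exact (hη₀s p (ball_subset_ball hηη₀ hp)).1
    let one' : Icc (-1 : ℝ) 1 := ⟨1, by norm_num⟩
    have he : e = fun p => (phaseCurve E (p, w p) one').1 := by
      funext p
      rw [show (p, w p) = ((p.1, p.2), w p) from rfl, phaseCurve_apply]
    rw [he]
    have hev : ContDiff ℝ ∞ (fun g : C(Icc (-1 : ℝ) 1, E × E) => g one') :=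
      (ContinuousMap.evalCLM ℝ one' : C(Icc (-1 : ℝ) 1, E × E) →L[ℝ] E × E).contDiff
    exact contDiff_fst.comp_contDiffOn (hev.comp_contDiffOn
      ((phaseCurve E).contDiff.comp_contDiffOn (contDiffOn_id.prodMk hwc)))
  · intro q hq
    have := hcurve q 0 hq 0 (by simp)
    rw [smul_zero] at this
    rw [this]; simp [posCurve]
  · intro q v hq
    obtain ⟨T, hT, h⟩ := hmain q v 0 (by simpa using hq)
    rw [abs_zero] at hT
    have := hformula q v T hT h 0 (by simpa using hT)
    simpa [velCurve, smul_smul, inv_mul_cancel₀ hT.ne'] using this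
  · intro q v t h
    obtain ⟨T, hT, hTm⟩ := hmain q v t h
    have hT0 : 0 < T := (abs_nonneg _).trans_lt hT
    have h1 := hformula q v T hT0 hTm t hT
    refine ⟨h1.differentiableAt.hasDerivAt, ?_⟩
    have h2 : (deriv fun t : ℝ => e (q, t • v)) =ᶠ[𝓝 t]
        fun t => T⁻¹ • velCurve (T • v) (w (q, T • v)) (T⁻¹ * t) := by
      have : ∀ᶠ s in 𝓝 t, |s| < T := continuous_abs.continuousAt.eventually_lt_const hT
      filter_upwards [this] with s hs
      exact (hformula q v T hT0 hTm s hs).deriv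
    refine HasDerivAt.congr_of_eventuallyEq ?_ h2
    have hle : |T⁻¹ * t| ≤ 1 := by
      rw [abs_mul, abs_inv, abs_of_pos hT0, inv_mul_le_one₀ hT0]; exact hT.le
    have h3 : HasDerivAt (fun t : ℝ => T⁻¹ * t) T⁻¹ t := by
      simpa using (hasDerivAt_id t).const_mul T⁻¹
    have h4 := ((hasDerivAt_velCurve (T • v) (w (q, T • v)) (T⁻¹ * t)).scomp t h3).const_smul T⁻¹
    refine h4.congr_deriv ?_
    have h5 : e (q, t • v) = posCurve q (T • v) (w (q, T • v)) (T⁻¹ * t) := by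
      rw [← hcurve q (T • v) hTm _ hle, smul_smul]
      congr 3; field_simp
    rw [h1.deriv, h5, hsm, hpoint _ hTm _ (abs_le.1 hle), smul_smul, sq]

end ExpMap

/-! ### Charts of geodesics -/

section Chart

theorem mem_ball_prod {E : Type*} [NormedAddCommGroup E] {p c : E × E} {R : ℝ} :
    p ∈ ball c R ↔ p.1 ∈ ball c.1 R ∧ p.2 ∈ ball c.2 R := by
  rw [← ball_prod_same, mem_prod]

variable {E : Type*} [NormedAddCommGroup E] [NormedSpace ℝ E]

/-- An exponential map `e` and a logarithm `V` for the field `F` near `x`, which are `ε`-close to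
the Euclidean ones. -/
structure IsGeodesicChart (F : E × E → E) (x : E) (R ε L : ℝ) (e V : E × E → E) : Prop where
  radius_pos : 0 < R
  exp_smooth : ContDiffOn ℝ ∞ e (ball (x, 0) R)
  log_smooth : ContDiffOn ℝ ∞ V (ball (x, x) R)
  exp_zero : ∀ q ∈ ball x R, e (q, 0) = q
  exp_deriv : ∀ q ∈ ball x R, ∀ v (t : ℝ), t • v ∈ ball (0 : E) R →
    HasDerivAt (fun t : ℝ => e (q, t • v)) (deriv (fun t : ℝ => e (q, t • v)) t) t
  exp_ode : ∀ q ∈ ball x R, ∀ v (t : ℝ), t • v ∈ ball (0 : E) R →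
    HasDerivAt (deriv fun t : ℝ => e (q, t • v))
      (F (e (q, t • v), deriv (fun t : ℝ => e (q, t • v)) t)) t
  exp_approx : ∀ q ∈ ball x R, ∀ q' ∈ ball x R, ∀ v ∈ ball (0 : E) R, ∀ v' ∈ ball (0 : E) R,
    ‖e (q, v) - e (q', v') - ((q - q') + (v - v'))‖ ≤ ε * (‖q - q'‖ + ‖v - v'‖)
  log_approx : ∀ q ∈ ball x R, ∀ q' ∈ ball x R, ‖V (q, q') - (q' - q)‖ ≤ ε * ‖q' - q‖
  log_lipschitz : ∀ q ∈ ball x R, ∀ q' ∈ ball x R, ∀ d, q + d ∈ ball x R → q' + d ∈ ball x R →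
    ‖V (q, q + d) - V (q', q' + d)‖ ≤ L * ‖d‖ * ‖q - q'‖
  exp_log : ∀ q ∈ ball x R, ∀ q' ∈ ball x R, e (q, V (q, q')) = q'

/-- The linear change of variables `(q, v) ↦ (q, q + v)`. -/
noncomputable def shearEquiv (E : Type*) [NormedAddCommGroup E] [NormedSpace ℝ E] :
    (E × E) ≃L[ℝ] (E × E) :=
  ContinuousLinearEquiv.equivOfInverse
    ((ContinuousLinearMap.fst ℝ E E).prod
      (ContinuousLinearMap.fst ℝ E E + ContinuousLinearMap.snd ℝ E E))
    ((ContinuousLinearMap.fst ℝ E E).prod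
      (ContinuousLinearMap.snd ℝ E E - ContinuousLinearMap.fst ℝ E E))
    (fun p => by simp) (fun p => by simp)

/-- As `V` vanishes on the diagonal, `V(q, q + d)` is the integral of the derivative of `V` along `s
↦ (q, q + s d)`, and that derivative is Lipschitz. The factor `‖d‖` is essential: after division by
`‖d‖` the dependence on `q` is Lipschitz uniformly in the displacement. -/
theorem exists_ball_lipschitz_fderiv {G : Type*} [NormedAddCommGroup G] [NormedSpace ℝ G]
    {V : E × E → G} {x : E} {s : Set (E × E)} (hs : s ∈ 𝓝 (x, x)) (hso : IsOpen s)
    (hV : ContDiffOn ℝ ∞ V s) (hdiag : ∀ q, (q, q) ∈ s → V (q, q) = 0) :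
    ∃ R L : ℝ, 0 < R ∧ 0 ≤ L ∧ ∀ q ∈ ball x R, ∀ q' ∈ ball x R, ∀ d, q + d ∈ ball x R →
      q' + d ∈ ball x R → ‖V (q, q + d) - V (q', q' + d)‖ ≤ L * ‖d‖ * ‖q - q'‖ := by
  have hf : ContDiffAt ℝ 1 (fderiv ℝ V) (x, x) :=
    (hV.contDiffAt hs).fderiv_right (m := 1) (by
      exact WithTop.coe_le_coe.2 (le_top : ((2 : ℕ) : ℕ∞) ≤ ⊤))
  obtain ⟨K, t, ht, hK⟩ := hf.exists_lipschitzOnWith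
  obtain ⟨R, hR, hRs⟩ := Metric.mem_nhds_iff.1 (inter_mem hs ht)
  refine ⟨R, K, hR, K.2, fun q hq q' hq' d hd hd' => ?_⟩
  have hmem : ∀ q ∈ ball x R, q + d ∈ ball x R → ∀ s ∈ Icc (0 : ℝ) 1,
      (q, q + s • d) ∈ ball (x, x) R := by
    intro q hq hd s hs
    refine mem_ball_prod.2 ⟨hq, ?_⟩
    have := (convex_ball x R).add_smul_sub_mem hq hd hs
    simpa using this
  have hder : ∀ q ∈ ball x R, q + d ∈ ball x R → ∀ s ∈ Icc (0 : ℝ) 1,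
      HasDerivAt (fun s : ℝ => V (q, q + s • d)) (fderiv ℝ V (q, q + s • d) (0, d)) s := by
    intro q hq hd s hs
    have h1 : DifferentiableAt ℝ V (q, q + s • d) :=
      (hV.contDiffAt (hso.mem_nhds (hRs (hmem q hq hd s hs)).1)).differentiableAt (by simp)
    have h2 : HasDerivAt (fun s : ℝ => (q, q + s • d)) (0, d) s := by
      refine (hasDerivAt_const s q).prodMk ?_
      simpa using ((hasDerivAt_id s).smul_const d).const_add q
    exact h1.hasFDerivAt.comp_hasDerivAt s h2
  have hbound := norm_image_sub_le_of_norm_deriv_le_segment_01'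
    (f := fun s : ℝ => V (q, q + s • d) - V (q', q' + s • d)) (C := K * ‖d‖ * ‖q - q'‖)
    (fun s hs => ((hder q hq hd s hs).sub (hder q' hq' hd' s hs)).hasDerivWithinAt) ?_
  · simp only [one_smul, zero_smul, add_zero] at hbound
    have h0 := hmem q hq hd 0 (by simp)
    have h0' := hmem q' hq' hd' 0 (by simp)
    simp only [zero_smul, add_zero] at h0 h0'
    rwa [hdiag q (hRs h0).1, hdiag q' (hRs h0').1, sub_zero, sub_zero] at hbound
  · intro s hs
    have hs' : s ∈ Icc (0 : ℝ) 1 := ⟨hs.1, hs.2.le⟩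
    have h1 := hK.dist_le_mul _ (hRs (hmem q hq hd s hs')).2 _ (hRs (hmem q' hq' hd' s hs')).2
    rw [dist_eq_norm, dist_eq_norm] at h1
    have h2 : ‖((q, q + s • d) : E × E) - (q', q' + s • d)‖ = ‖q - q'‖ := by
      rw [Prod.mk_sub_mk, add_sub_add_right_eq_sub, Prod.norm_def, max_self]
    rw [h2] at h1
    rw [← sub_apply]
    refine (ContinuousLinearMap.le_opNorm _ _).trans ?_
    have h3 : ‖((0 : E), d)‖ = ‖d‖ := by simp [Prod.norm_def]
    rw [h3]
    calc _ ≤ (K * ‖q - q'‖) * ‖d‖ := by gcongr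
      _ = _ := by ring

theorem exists_ball_approx {G : Type*} [NormedAddCommGroup G] [NormedSpace ℝ G] {f : E × E → G}
    {f' : E × E →L[ℝ] G} {a b : E} (hf : HasStrictFDerivAt f f' (a, b)) {ε : ℝ} (hε : 0 < ε) :
    ∃ R : ℝ, 0 < R ∧ ∀ q ∈ ball a R, ∀ q' ∈ ball a R, ∀ v ∈ ball b R, ∀ v' ∈ ball b R,
      ‖f (q, v) - f (q', v') - f' (q - q', v - v')‖ ≤ ε * (‖q - q'‖ + ‖v - v'‖) := by
  have h := hf.isLittleO.def hε
  rw [nhds_prod_eq] at h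
  obtain ⟨s, hs, hs'⟩ := (eventually_prod_self_iff' (r := fun p => ‖f p.1 - f p.2 - f' (p.1 - p.2)‖ ≤ ε * ‖p.1 - p.2‖)).1 h
  obtain ⟨R, hR, hRs⟩ := Metric.mem_nhds_iff.1 hs
  refine ⟨R, hR, fun q hq q' hq' v hv v' hv' => ?_⟩
  refine (hs' (q, v) (hRs (mem_ball_prod.2 ⟨hq, hv⟩)) (q', v')
    (hRs (mem_ball_prod.2 ⟨hq', hv'⟩))).trans ?_
  rw [Prod.mk_sub_mk]
  gcongr
  exact (Prod.norm_def _).le.trans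
    (max_le (le_add_of_nonneg_right (norm_nonneg _)) (le_add_of_nonneg_left (norm_nonneg _)))

/-- From `e(q, 0) = q` and the initial velocity, the derivative of `e` at `(x, 0)` is `(q, v) ↦ q +
v`. So `(q, v) ↦ (q, e(q, v))` has an invertible derivative there, and the second component `V` of
its inverse has derivative `q' - q` at `(x, x)`. Strict differentiability gives the two
`ε`-approximations on small balls. -/
theorem exists_isGeodesicChart [CompleteSpace E] {F : E × E → E} (hF : ContDiff ℝ ∞ F)
    (hpar : ∀ x v w, F (x, v + w) + F (x, v - w) = (2 : ℝ) • F (x, v) + (2 : ℝ) • F (x, w))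
    (x : E) {ε : ℝ} (hε : 0 < ε) : ∃ (R L : ℝ) (e V : E × E → E), 0 ≤ L ∧
      IsGeodesicChart F x R ε L e V := by
  obtain ⟨η, e, hη, hes, he0, hei, heo⟩ := exists_expMap hF hpar x
  have hx0 : (x, (0 : E)) ∈ ball (x, (0 : E)) η := mem_ball_self hη
  have hea : ContDiffAt ℝ ∞ e (x, 0) := hes.contDiffAt (isOpen_ball.mem_nhds hx0)
  have hde := (hea.differentiableAt (by simp)).hasFDerivAt
  have hfd : fderiv ℝ e (x, 0) = ContinuousLinearMap.fst ℝ E E + ContinuousLinearMap.snd ℝ E E := by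
    refine ContinuousLinearMap.ext fun p => ?_
    have h1 : fderiv ℝ e (x, 0) (p.1, 0) = p.1 := by
      have hl : HasDerivAt (fun t : ℝ => (x + t • p.1, (0 : E))) (p.1, 0) 0 := by
        refine HasDerivAt.prodMk ?_ (hasDerivAt_const _ _)
        simpa using ((hasDerivAt_id (0 : ℝ)).smul_const p.1).const_add x
      have hde' : HasFDerivAt e (fderiv ℝ e (x, 0)) ((fun t : ℝ => (x + t • p.1, (0 : E))) 0) := by
        simpa using hde
      have h2 := hde'.comp_hasDerivAt (0 : ℝ) hl
      have h3 : HasDerivAt (fun t : ℝ => x + t • p.1) p.1 0 := by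
        simpa using ((hasDerivAt_id (0 : ℝ)).smul_const p.1).const_add x
      refine h2.unique (h3.congr_of_eventuallyEq ?_)
      have hc : Tendsto (fun t : ℝ => (x + t • p.1, (0 : E))) (𝓝 0) (𝓝 (x, 0)) := by
        have : Continuous (fun t : ℝ => (x + t • p.1, (0 : E))) := by fun_prop
        simpa using this.tendsto 0
      filter_upwards [hc (isOpen_ball.mem_nhds hx0)] with t ht
      exact he0 _ ht
    have h2 : fderiv ℝ e (x, 0) (0, p.2) = p.2 := by
      have hl : HasDerivAt (fun t : ℝ => (x, t • p.2)) (0, p.2) 0 := by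
        refine (hasDerivAt_const _ _).prodMk ?_
        simpa using (hasDerivAt_id (0 : ℝ)).smul_const p.2
      have hde' : HasFDerivAt e (fderiv ℝ e (x, 0)) ((fun t : ℝ => (x, t • p.2)) 0) := by
        simpa using hde
      exact (hde'.comp_hasDerivAt (0 : ℝ) hl).unique (hei x p.2 hx0)
    calc fderiv ℝ e (x, 0) p = fderiv ℝ e (x, 0) ((p.1, 0) + (0, p.2)) := by simp
      _ = _ := by rw [map_add, h1, h2]; rfl
  rw [hfd] at hde
  have hΨ : HasFDerivAt (fun p : E × E => (p.1, e p)) ((shearEquiv E : (E × E) ≃L[ℝ] (E × E)) :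
      E × E →L[ℝ] E × E) (x, 0) :=
    hasFDerivAt_fst.prodMk hde
  obtain ⟨Φ, haΦ, hΦη, hΦ, hΦs⟩ := exists_smooth_openPartialHomeomorph isOpen_ball hx0
    (contDiffOn_fst.prodMk hes) (shearEquiv E) hΨ
  have hxx : Φ (x, 0) = (x, x) := by rw [hΦ, he0 x hx0]
  have hxt : (x, x) ∈ Φ.target := hxx ▸ Φ.map_source haΦ
  have hxs : Φ.symm (x, x) = (x, 0) := by rw [← hxx, Φ.left_inv haΦ]
  let V : E × E → E := fun p => (Φ.symm p).2
  have hVs : ContDiffOn ℝ ∞ V Φ.target := contDiff_snd.comp_contDiffOn hΦs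
  have h1 : ∀ p ∈ Φ.target, Φ.symm p = (p.1, V p) ∧ e (p.1, V p) = p.2 := by
    intro p hp
    have h2 := Φ.right_inv hp
    rw [hΦ] at h2
    have h3 : (Φ.symm p).1 = p.1 := (Prod.ext_iff.1 h2).1
    have h4 : e (Φ.symm p) = p.2 := (Prod.ext_iff.1 h2).2
    have h5 : Φ.symm p = (p.1, V p) := Prod.ext h3 rfl
    exact ⟨h5, h5 ▸ h4⟩
  obtain ⟨R₁, hR₁, hR₁s⟩ := Metric.isOpen_iff.1 Φ.open_source _ haΦ
  obtain ⟨R₂, hR₂, hR₂s⟩ := Metric.isOpen_iff.1 Φ.open_target _ hxt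
  have hdiag : ∀ q ∈ ball x R₁, V (q, q) = 0 := by
    intro q hq
    have hm : (q, (0 : E)) ∈ Φ.source := hR₁s (mem_ball_prod.2 ⟨hq, mem_ball_self hR₁⟩)
    have h2 : Φ (q, 0) = (q, q) := by rw [hΦ, he0 q (hΦη hm)]
    change (Φ.symm (q, q)).2 = 0
    rw [← h2, Φ.left_inv hm]
  obtain ⟨R₃, L, hR₃, hL, hlip⟩ := exists_ball_lipschitz_fderiv (V := V) (x := x)
    (s := ball (x, x) (min R₁ R₂)) (ball_mem_nhds _ (lt_min hR₁ hR₂)) isOpen_ball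
    (hVs.mono ((ball_subset_ball (min_le_right _ _)).trans hR₂s))
    (fun q hq => hdiag q ((ball_subset_ball (min_le_left _ _)) (mem_ball_prod.1 hq).1))
  have hstrict_e : HasStrictFDerivAt e
      (ContinuousLinearMap.fst ℝ E E + ContinuousLinearMap.snd ℝ E E) (x, 0) :=
    hea.hasStrictFDerivAt' hde (by simp)
  obtain ⟨R₄, hR₄, happ_e⟩ := exists_ball_approx hstrict_e hε
  have hΨ' : HasFDerivAt Φ ((shearEquiv E : (E × E) ≃L[ℝ] (E × E)) : E × E →L[ℝ] E × E)
      (Φ.symm (x, x)) := by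
    rw [hxs]
    exact hΨ.congr_of_eventuallyEq (Eventually.of_forall hΦ)
  have hdV : HasFDerivAt V (ContinuousLinearMap.snd ℝ E E - ContinuousLinearMap.fst ℝ E E) (x, x) :=
    ((hasFDerivAt_snd (𝕜 := ℝ) (p := Φ.symm (x, x))).comp (x, x)
      (Φ.hasFDerivAt_symm hxt hΨ')).congr_fderiv rfl
  have hstrict_V : HasStrictFDerivAt V
      (ContinuousLinearMap.snd ℝ E E - ContinuousLinearMap.fst ℝ E E) (x, x) :=
    (hVs.contDiffAt (Φ.open_target.mem_nhds hxt)).hasStrictFDerivAt' hdV (by simp)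
  obtain ⟨R₅, hR₅, happ_V⟩ := exists_ball_approx hstrict_V hε
  obtain ⟨R, hR, hle⟩ : ∃ R, 0 < R ∧ R ≤ η ∧ R ≤ R₁ ∧ R ≤ R₂ ∧ R ≤ R₃ ∧ R ≤ R₄ ∧ R ≤ R₅ := by
    refine ⟨min η (min R₁ (min R₂ (min R₃ (min R₄ R₅)))), by positivity, ?_⟩
    simp
  obtain ⟨l0, l1, l2, l3, l4, l5⟩ := hle
  have hin : ∀ q ∈ ball x R, ∀ v ∈ ball (0 : E) R, (q, v) ∈ ball (x, (0 : E)) η :=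
    fun q hq v hv => mem_ball_prod.2 ⟨ball_subset_ball l0 hq, ball_subset_ball l0 hv⟩
  have hin2 : ∀ q ∈ ball x R, ∀ q' ∈ ball x R, (q, q') ∈ Φ.target :=
    fun q hq v hv => hR₂s (mem_ball_prod.2 ⟨ball_subset_ball l2 hq, ball_subset_ball l2 hv⟩)
  refine ⟨R, L, e, V, hL, hR, hes.mono (ball_subset_ball l0),
    hVs.mono ((ball_subset_ball l2).trans hR₂s), fun q hq => he0 q (hin q hq 0 (mem_ball_self hR)),
    fun q hq v t ht => (heo q v t (hin q hq _ ht)).1,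
    fun q hq v t ht => (heo q v t (hin q hq _ ht)).2, ?_, ?_, ?_, ?_⟩
  · intro q hq q' hq' v hv v' hv'
    exact happ_e q (ball_subset_ball l4 hq) q' (ball_subset_ball l4 hq') v (ball_subset_ball l4 hv)
      v' (ball_subset_ball l4 hv')
  · intro q hq q' hq'
    have := happ_V q (ball_subset_ball l5 hq) q (ball_subset_ball l5 hq) q'
      (ball_subset_ball l5 hq') q (ball_subset_ball l5 hq)
    rw [hdiag q (ball_subset_ball l1 hq)] at this
    simpa using this
  · intro q hq q' hq' d hd hd'
    exact hlip q (ball_subset_ball l3 hq) q' (ball_subset_ball l3 hq') d (ball_subset_ball l3 hd)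
      (ball_subset_ball l3 hd')
  · intro q hq q' hq'
    exact (h1 _ (hin2 q hq q' hq')).2

end Chart

/-! ### Increments of functions of bounded variation -/

section OneDimensional

/-- The primitive vanishing at `0` of a normalized bump function. -/
noncomputable def bumpPrimitive (φ : ContDiffBump (0 : ℝ)) (x : ℝ) : ℝ :=
  ∫ y in (0 : ℝ)..x, φ.normed volume y

/-- A smooth approximation of the indicator of `[s, t]`. -/
noncomputable def smoothIndicator (φ : ContDiffBump (0 : ℝ)) (s t x : ℝ) : ℝ :=
  bumpPrimitive φ (x - s) - bumpPrimitive φ (x - t)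

theorem hasDerivAt_bumpPrimitive (φ : ContDiffBump (0 : ℝ)) (x : ℝ) :
    HasDerivAt (bumpPrimitive φ) (φ.normed volume x) x :=
  (φ.continuous_normed.integral_hasStrictDerivAt 0 x).hasDerivAt

theorem contDiff_bumpPrimitive (φ : ContDiffBump (0 : ℝ)) : ContDiff ℝ ∞ (bumpPrimitive φ) := by
  refine contDiff_infty_iff_deriv.2
    ⟨fun x => (hasDerivAt_bumpPrimitive φ x).differentiableAt, ?_⟩
  rw [show deriv (bumpPrimitive φ) = φ.normed volume from
    funext fun x => (hasDerivAt_bumpPrimitive φ x).deriv]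
  exact φ.contDiff_normed

theorem contDiff_smoothIndicator (φ : ContDiffBump (0 : ℝ)) (s t : ℝ) :
    ContDiff ℝ ∞ (smoothIndicator φ s t) :=
  ((contDiff_bumpPrimitive φ).comp (contDiff_id.sub contDiff_const)).sub
    ((contDiff_bumpPrimitive φ).comp (contDiff_id.sub contDiff_const))

theorem deriv_smoothIndicator (φ : ContDiffBump (0 : ℝ)) (s t x : ℝ) :
    deriv (smoothIndicator φ s t) x = φ.normed volume (x - s) - φ.normed volume (x - t) :=
  (((hasDerivAt_bumpPrimitive φ (x - s)).comp_sub_const x s).sub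
    ((hasDerivAt_bumpPrimitive φ (x - t)).comp_sub_const x t)).deriv

theorem smoothIndicator_eq (φ : ContDiffBump (0 : ℝ)) (s t x : ℝ) :
    smoothIndicator φ s t x = ∫ y in (x - t)..(x - s), φ.normed volume y :=
  intervalIntegral.integral_interval_sub_left (φ.continuous_normed.intervalIntegrable _ _)
    (φ.continuous_normed.intervalIntegrable _ _)

theorem abs_smoothIndicator_le (φ : ContDiffBump (0 : ℝ)) {s t : ℝ} (hst : s ≤ t) (x : ℝ) :
    |smoothIndicator φ s t x| ≤ 1 := by
  rw [smoothIndicator_eq, intervalIntegral.integral_of_le (by linarith), abs_of_nonneg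
    (setIntegral_nonneg measurableSet_Ioc fun y _ => φ.nonneg_normed y)]
  refine (setIntegral_le_integral φ.integrable_normed
    (Eventually.of_forall fun y => φ.nonneg_normed y)).trans ?_
  rw [φ.integral_normed]

theorem tsupport_smoothIndicator_subset (φ : ContDiffBump (0 : ℝ)) {s t : ℝ} (hst : s ≤ t) :
    tsupport (smoothIndicator φ s t) ⊆ Icc (s - φ.rOut) (t + φ.rOut) := by
  refine closure_minimal (fun x hx => ?_) isClosed_Icc
  by_contra h
  refine hx ?_
  rw [smoothIndicator_eq]
  have hz : ∀ y ∈ uIcc (x - t) (x - s), φ.normed volume y = 0 := by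
    intro y hy
    rw [uIcc_of_le (by linarith)] at hy
    by_contra h0
    have hy' : y ∈ ball (0 : ℝ) φ.rOut := by
      rw [← φ.support_normed_eq (μ := volume)]; exact h0
    rw [mem_ball_zero_iff, Real.norm_eq_abs, abs_lt] at hy'
    exact h ⟨by linarith [hy.2], by linarith [hy.1]⟩
  rw [intervalIntegral.integral_congr (g := fun _ => 0) hz]
  simp

/-- The derivative of the smoothed indicator of `[s, t]` is a bump at `s` minus a bump at `t`.
Testing `f` with it thus compares mollifications at the two points, and only the values on `[a, b]`
enter. -/
theorem integral_mul_deriv_smoothIndicator (φ : ContDiffBump (0 : ℝ)) {f g : ℝ → ℝ} {a b s t : ℝ}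
    (hg : Integrable g) (hfg : ∀ x ∈ Icc a b, f x = g x)
    (hsa : a ≤ s - φ.rOut) (hsb : s + φ.rOut ≤ b) (hta : a ≤ t - φ.rOut) (htb : t + φ.rOut ≤ b) :
    ∫ x, f x * deriv (smoothIndicator φ s t) x =
      (convolution (φ.normed volume) g (ContinuousLinearMap.lsmul ℝ ℝ) volume s) -
      (convolution (φ.normed volume) g (ContinuousLinearMap.lsmul ℝ ℝ) volume t) := by
  rw [convolution_lsmul_swap, convolution_lsmul_swap]
  have hint : ∀ c : ℝ, Integrable fun x => φ.normed volume (c - x) • g x := by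
    intro c
    obtain ⟨C, hC⟩ := φ.hasCompactSupport_normed.exists_bound_of_continuous
      (φ.continuous_normed (μ := volume))
    exact hg.bdd_smul C
      (φ.continuous_normed.comp (continuous_const.sub continuous_id)).aestronglyMeasurable
      (Eventually.of_forall fun x => hC (c - x))
  rw [← integral_sub (hint s) (hint t)]
  refine integral_congr_ae (Eventually.of_forall fun x => ?_)
  have hz : ∀ c : ℝ, x ∉ Icc (c - φ.rOut) (c + φ.rOut) → φ.normed volume (x - c) = 0 := by
    intro c hx
    by_contra h0
    have hy' : x - c ∈ ball (0 : ℝ) φ.rOut := by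
      rw [← φ.support_normed_eq (μ := volume)]; exact h0
    rw [mem_ball_zero_iff, Real.norm_eq_abs, abs_lt] at hy'
    exact hx ⟨by linarith [hy'.1], by linarith [hy'.2]⟩
  have hs : ∀ c : ℝ, φ.normed volume (c - x) = φ.normed volume (x - c) := by
    intro c; rw [← neg_sub, φ.normed_neg]
  simp only [deriv_smoothIndicator, hs, smul_eq_mul]
  by_cases hx : x ∈ Icc a b
  · rw [hfg x hx]; ring
  · rw [hz s fun h => hx ⟨hsa.trans h.1, h.2.trans hsb⟩,
      hz t fun h => hx ⟨hta.trans h.1, h.2.trans htb⟩]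
    ring

theorem ofReal_integral_le_openVariation (f : ℝ → ℝ) {A : Set ℝ} {ψ : ℝ → ℝ}
    (h1 : ContDiff ℝ ∞ ψ) (h2 : HasCompactSupport ψ) (h3 : tsupport ψ ⊆ A) (h4 : ∀ t, |ψ t| ≤ 1) :
    ENNReal.ofReal (∫ t, f t * deriv ψ t) ≤ openVariation f A := by
  refine le_iSup_of_le ψ (le_iSup_of_le h1 (le_iSup_of_le h2 (le_iSup_of_le h3 ?_)))
  exact le_iSup_of_le h4 le_rfl

/-- At almost all pairs of points the increments of `f` are bounded by the variation. -/
theorem exists_ae_increment_le_openVariation {f : ℝ → ℝ} {V : Set ℝ} {a b : ℝ}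
    (hf : LocallyIntegrableOn f V volume) (hab : Icc a b ⊆ V) :
    ∃ G : Set ℝ, (∀ᵐ s, s ∈ G) ∧ ∀ s ∈ G, ∀ t ∈ G, a < s → s < t → t < b →
      ENNReal.ofReal |f t - f s| ≤ openVariation f V := by
  let g : ℝ → ℝ := (Icc a b).indicator f
  have hg : Integrable g :=
    ((hf.mono_set hab).integrableOn_isCompact isCompact_Icc).integrable_indicator
      measurableSet_Icc
  have hfg : ∀ x ∈ Icc a b, f x = g x := fun x hx => (indicator_of_mem hx f).symm
  let φ : ℕ → ContDiffBump (0 : ℝ) := fun k =>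
    ⟨1 / (2 * (k + 1)), 1 / (k + 1), by positivity, by
      apply one_div_lt_one_div_of_lt <;> nlinarith [k.cast_nonneg (α := ℝ)]⟩
  have hφ0 : Tendsto (fun k => (φ k).rOut) atTop (𝓝 0) := tendsto_one_div_add_atTop_nhds_zero_nat
  have hφ1 : ∀ k, (φ k).rOut ≤ 2 * (φ k).rIn := by
    intro k
    change (1 : ℝ) / (k + 1) ≤ 2 * (1 / (2 * (k + 1)))
    apply le_of_eq; field_simp
  -- The good points are those where the mollifications converge to `g`; almost every point is good
  -- because the supports shrink and the ratios of the two radii are bounded.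
  refine ⟨{s | Tendsto (fun k => convolution ((φ k).normed volume) g
    (ContinuousLinearMap.lsmul ℝ ℝ) volume s) atTop (𝓝 (g s))},
    ContDiffBump.ae_convolution_tendsto_right_of_locallyIntegrable hφ0
    (Eventually.of_forall hφ1) hg.locallyIntegrable, ?_⟩
  intro s hs t ht has hst htb
  have hlim := Tendsto.sub hs ht
  have hev : ∀ᶠ k in atTop, (φ k).rOut < s - a ∧ (φ k).rOut < b - t :=
    (hφ0.eventually_lt_const (by linarith)).and (hφ0.eventually_lt_const (by linarith))
  rw [← hfg s ⟨has.le, (hst.trans htb).le⟩, ← hfg t ⟨(has.trans hst).le, htb.le⟩] at hlim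
  have hsub : ∀ k, (φ k).rOut < s - a ∧ (φ k).rOut < b - t →
      tsupport (smoothIndicator (φ k) s t) ⊆ Icc a b := fun k hk =>
    (tsupport_smoothIndicator_subset (φ k) hst.le).trans
      (Icc_subset_Icc (by linarith [hk.1]) (by linarith [hk.2]))
  have hint : ∀ k, (φ k).rOut < s - a ∧ (φ k).rOut < b - t →
      ∫ x, f x * deriv (smoothIndicator (φ k) s t) x = _ := fun k hk =>
    integral_mul_deriv_smoothIndicator (φ k) hg hfg (by linarith [hk.1])
      (by linarith [hk.2]) (by linarith [hk.1]) (by linarith [hk.2])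
  have hcs : ∀ k, (φ k).rOut < s - a ∧ (φ k).rOut < b - t →
      HasCompactSupport (smoothIndicator (φ k) s t) := fun k hk =>
    isCompact_Icc.of_isClosed_subset (isClosed_tsupport _) (hsub k hk)
  -- The supremum defining the variation has no absolute value, so the sign of the test function
  -- follows the sign of the increment.
  rcases le_total (f s) (f t) with h | h
  · rw [abs_of_nonneg (by linarith)]
    refine le_of_tendsto ((ENNReal.continuous_ofReal.tendsto _).comp
      (by simpa using hlim.neg)) ?_
    filter_upwards [hev] with k hk
    have hle := ofReal_integral_le_openVariation f (A := V)
      (ψ := fun x => -smoothIndicator (φ k) s t x)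
      (contDiff_smoothIndicator (φ k) s t).neg (hcs k hk).neg
      (by
        have : tsupport (fun x => -smoothIndicator (φ k) s t x) =
          tsupport (smoothIndicator (φ k) s t) := tsupport_neg _
        rw [this]; exact (hsub k hk).trans hab)
      (fun x => by rw [abs_neg]; exact abs_smoothIndicator_le (φ k) hst.le x)
    simp only [deriv.fun_neg, mul_neg, integral_neg, hint k hk] at hle
    simpa using hle
  · rw [abs_of_nonpos (by linarith), neg_sub]
    refine le_of_tendsto ((ENNReal.continuous_ofReal.tendsto _).comp hlim) ?_
    filter_upwards [hev] with k hk
    have hle := ofReal_integral_le_openVariation f (A := V)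
      (contDiff_smoothIndicator (φ k) s t) (hcs k hk) ((hsub k hk).trans hab)
      (abs_smoothIndicator_le (φ k) hst.le)
    rw [hint k hk] at hle
    exact hle

/-- The truncated increments are bounded by the truncated variation: either there is a large jump,
which is counted, or there is none and the increment is bounded by the variation. -/
theorem exists_ae_increment_le_truncatedVariation {f : ℝ → ℝ} {V : Set ℝ} {a b : ℝ}
    (hf : LocallyIntegrableOn f V volume) (hab : Icc a b ⊆ V) :
    ∃ G : Set ℝ, (∀ᵐ s, s ∈ G) ∧ ∀ s ∈ G, ∀ t ∈ G, a < s → s < t → t < b →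
      ENNReal.ofReal (min |f t - f s| 1) ≤ truncatedVariation f V V := by
  obtain ⟨G, hG, h⟩ := exists_ae_increment_le_openVariation hf hab
  refine ⟨G, hG, fun s hs t ht has hst htb => ?_⟩
  rcases (largeJumpSet f V).eq_empty_or_nonempty with h0 | h0
  · refine (ENNReal.ofReal_le_ofReal (min_le_left _ _)).trans ((h s hs t ht has hst htb).trans ?_)
    refine le_trans ?_ le_self_add
    rw [h0, sdiff_empty]
    -- The only open set between `V` and `V` is `V`, so the outer variation is the plain one.
    refine le_iInf fun A => le_iInf fun _ => le_iInf fun hVA => le_iInf fun hAV => ?_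
    rw [hAV.antisymm hVA]
  · refine (ENNReal.ofReal_le_ofReal (min_le_right _ _)).trans ?_
    rw [ENNReal.ofReal_one]
    refine le_trans ?_ le_add_self
    have hne : (V ∩ largeJumpSet f V).Nonempty := by
      rwa [inter_eq_right.2 fun t ht => ht.1]
    exact_mod_cast one_le_encard_iff_nonempty.2 hne

/-- Averaged form of the previous bound, on pairs in `(a, a + h) × (b - h, b)`. -/
theorem lintegral_increment_le_truncatedVariation {f : ℝ → ℝ} {V : Set ℝ} {a b h : ℝ}
    (hf : LocallyIntegrableOn f V volume) (hab : Icc a b ⊆ V) (hh : a + h < b - h) :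
    ∫⁻ s in Ioo a (a + h), ∫⁻ t in Ioo (b - h) b, ENNReal.ofReal (min |f t - f s| 1) ≤
      ENNReal.ofReal h * (ENNReal.ofReal h * truncatedVariation f V V) := by
  obtain ⟨G, hG, H⟩ := exists_ae_increment_le_truncatedVariation hf hab
  have hvol1 : volume (Ioo a (a + h)) = ENNReal.ofReal h := by rw [Real.volume_Ioo]; congr 1; ring
  have hvol2 : volume (Ioo (b - h) b) = ENNReal.ofReal h := by rw [Real.volume_Ioo]; congr 1; ring
  rw [← hvol1]
  nth_rw 2 [hvol1]
  rw [← hvol2]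
  calc _ ≤ ∫⁻ s in Ioo a (a + h), volume (Ioo (b - h) b) * truncatedVariation f V V := by
        refine lintegral_mono_ae ?_
        filter_upwards [ae_restrict_mem measurableSet_Ioo, ae_restrict_of_ae hG] with s hs hsG
        calc _ ≤ ∫⁻ t in Ioo (b - h) b, truncatedVariation f V V := by
              refine lintegral_mono_ae ?_
              filter_upwards [ae_restrict_mem measurableSet_Ioo, ae_restrict_of_ae hG] with t ht htG
              exact H s hsG t htG hs.1 (hs.2.trans (hh.trans ht.1)) ht.2
          _ = _ := by rw [setLIntegral_const, mul_comm]
    _ = _ := by rw [setLIntegral_const, mul_comm]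

end OneDimensional

/-! ### Families of geodesics close to parallel lines -/

/-- A perturbation of the identity with Lipschitz constant `1/2` is injective and open with a
`2`-Lipschitz inverse. Its derivative is within `1/2` of the identity, hence invertible by the
Neumann series, which makes the inverse smooth at every point. The zero space is separate because
its identity has norm `0`. -/
theorem exists_smooth_lipschitz_inverse {E : Type*} [NormedAddCommGroup E] [NormedSpace ℝ E]
    [CompleteSpace E] {φ : E → E} {s : Set E} (hs : IsOpen s) (hφ : ContDiffOn ℝ ∞ φ s)
    (happ : ∀ p ∈ s, ∀ p' ∈ s, ‖φ p - φ p' - (p - p')‖ ≤ 1 / 2 * ‖p - p'‖) :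
    ∃ ψ : E → E, IsOpen (φ '' s) ∧ (∀ p ∈ s, ψ (φ p) = p) ∧ ContDiffOn ℝ ∞ ψ (φ '' s) ∧
      LipschitzOnWith 2 ψ (φ '' s) := by
  have hA : ApproximatesLinearOn φ ((ContinuousLinearEquiv.refl ℝ E : E ≃L[ℝ] E) : E →L[ℝ] E) s
      (1 / 2) := by
    intro p hp p' hp'
    simpa using happ p hp p' hp'
  have hc : Subsingleton E ∨ (1 / 2 : ℝ≥0) <
      ‖(((ContinuousLinearEquiv.refl ℝ E : E ≃L[ℝ] E)).symm : E →L[ℝ] E)‖₊⁻¹ := by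
    rcases subsingleton_or_nontrivial E with h | h
    · exact Or.inl h
    · right
      have : ‖(((ContinuousLinearEquiv.refl ℝ E : E ≃L[ℝ] E)).symm : E →L[ℝ] E)‖₊ = 1 := by
        refine NNReal.eq ?_
        change ‖ContinuousLinearMap.id ℝ E‖ = 1
        exact ContinuousLinearMap.norm_id
      rw [this, inv_one]
      exact NNReal.half_lt_self one_ne_zero
  let Φ := hA.toOpenPartialHomeomorph φ s hc hs
  have hinv : ∀ p ∈ s, Φ.symm (φ p) = p := fun p hp => Φ.left_inv hp
  refine ⟨Φ.symm, Φ.open_target, hinv, ?_, ?_⟩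
  · rintro _ ⟨p, hp, rfl⟩
    have hd : DifferentiableAt ℝ φ p := (hφ.contDiffAt (hs.mem_nhds hp)).differentiableAt (by simp)
    have hnorm : ‖(1 : E →L[ℝ] E) - fderiv ℝ φ p‖ < 1 := by
      rw [norm_sub_rev]
      have hL : LipschitzOnWith (1 / 2) (fun q => φ q - q) s := by
        refine LipschitzOnWith.of_dist_le_mul fun q hq q' hq' => ?_
        rw [dist_eq_norm, dist_eq_norm, sub_sub_sub_comm]
        simpa using happ q hq q' hq'
      refine ((hd.hasFDerivAt.sub (hasFDerivAt_id p)).le_of_lipschitzOn (hs.mem_nhds hp) hL).trans_lt ?_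
      norm_num
    let u : (E →L[ℝ] E)ˣ := Units.oneSub _ hnorm
    have hu : (ContinuousLinearEquiv.ofUnit u : E →L[ℝ] E) = fderiv ℝ φ p := by
      change (u : E →L[ℝ] E) = _
      simp [u]
    refine (Φ.contDiffAt_symm (f₀' := ContinuousLinearEquiv.ofUnit u) (mem_image_of_mem φ hp)
      ?_ ?_).contDiffWithinAt
    · rw [hinv p hp, hu]; exact hd.hasFDerivAt
    · rw [hinv p hp]; exact hφ.contDiffAt (hs.mem_nhds hp)
  · refine LipschitzOnWith.of_dist_le_mul ?_
    rintro _ ⟨p, hp, rfl⟩ _ ⟨p', hp', rfl⟩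
    rw [hinv p hp, hinv p' hp', dist_eq_norm, dist_eq_norm]
    have h1 := happ p hp p' hp'
    have h2 := norm_sub_norm_le (p - p') (φ p - φ p')
    rw [norm_sub_rev] at h1
    change _ ≤ (2 : ℝ) * _
    linarith

section Family

variable {n : ℕ} {F : Euc n → Euc n → Euc n} {x : Euc n} {R ε L r : ℝ} {e V : Euc n × Euc n → Euc n}
  {D : Euc n}

/-- A geodesic chart together with a scale `r` at which the geodesics are almost straight. -/
structure IsSmallScale (F : Euc n → Euc n → Euc n) (x : Euc n) (R ε L : ℝ)
    (e V : Euc n × Euc n → Euc n) (r : ℝ) : Prop where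
  chart : IsGeodesicChart (fun p : Euc n × Euc n => F p.1 p.2) x R ε L e V
  eps_nonneg : 0 ≤ ε
  eps_le : ε ≤ 1 / 20
  lip_nonneg : 0 ≤ L
  scale_pos : 0 < r
  scale_le : 10 * r ≤ R
  scale_lip : 30 * r * L ≤ 1

/-- The initial velocity of the geodesic from `q` to `q + D`, parametrized on `[0, |D|]`. -/
noncomputable def initVel (V : Euc n × Euc n → Euc n) (D q : Euc n) : Euc n := ‖D‖⁻¹ • V (q, q + D)

/-- The geodesic from `q` to `q + D`, parametrized on `[0, |D|]`. -/
noncomputable def chord (e V : Euc n × Euc n → Euc n) (D q : Euc n) (t : ℝ) : Euc n :=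
  e (q, t • initVel V D q)

/-- By `exp_approx`, `t ↦ e(q, t v) - t v` is `ε ‖v‖`-Lipschitz near `t`, and this bounds its
derivative. -/
theorem IsGeodesicChart.norm_deriv_sub_le {F : Euc n × Euc n → Euc n}
    (hc : IsGeodesicChart F x R ε L e V) (hε : 0 ≤ ε) {q v : Euc n} {t : ℝ} (hq : q ∈ ball x R)
    (ht : t • v ∈ ball (0 : Euc n) R) :
    ‖deriv (fun t : ℝ => e (q, t • v)) t - v‖ ≤ ε * ‖v‖ := by
  have hd := (hc.exp_deriv q hq v t ht).sub ((hasDerivAt_id t).smul_const v)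
  rw [one_smul] at hd
  have hcont : Continuous fun s : ℝ => s • v := by fun_prop
  have hev : ∀ᶠ s in 𝓝 t, s • v ∈ ball (0 : Euc n) R :=
    hcont.continuousAt.eventually_mem (isOpen_ball.mem_nhds ht)
  refine hd.le_of_lip' (mul_nonneg hε (norm_nonneg v)) ?_
  filter_upwards [hev] with s hs
  have h := hc.exp_approx q hq q hq (s • v) hs (t • v) ht
  simp only [Pi.sub_apply, id_eq, sub_self, zero_add, norm_zero] at h ⊢
  rw [sub_sub_sub_comm]
  refine h.trans ?_
  rw [← sub_smul, norm_smul]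
  apply le_of_eq; ring

namespace IsSmallScale

theorem mem_ball_add (h : IsSmallScale F x R ε L e V r) (hDr : ‖D‖ ≤ 2 * r) {q : Euc n}
    (hq : q ∈ ball x (2 * r)) : q ∈ ball x R ∧ q + D ∈ ball x R := by
  have h1 := h.scale_le
  have h2 := h.scale_pos
  rw [mem_ball_iff_norm] at hq
  refine ⟨mem_ball_iff_norm.2 (by linarith), mem_ball_iff_norm.2 ?_⟩
  have : q + D - x = (q - x) + D := by abel
  rw [this]
  linarith [norm_add_le (q - x) D]

theorem norm_initVel_sub_le (h : IsSmallScale F x R ε L e V r) (hD : D ≠ 0) (hDr : ‖D‖ ≤ 2 * r)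
    {q : Euc n} (hq : q ∈ ball x (2 * r)) : ‖initVel V D q - ‖D‖⁻¹ • D‖ ≤ ε := by
  have hD' : 0 < ‖D‖ := norm_pos_iff.2 hD
  obtain ⟨h1, h2⟩ := h.mem_ball_add hDr hq
  have h3 := h.chart.log_approx q h1 _ h2
  rw [add_sub_cancel_left] at h3
  rw [initVel, ← smul_sub, norm_smul, norm_inv, norm_norm]
  calc ‖D‖⁻¹ * ‖V (q, q + D) - D‖ ≤ ‖D‖⁻¹ * (ε * ‖D‖) := by gcongr
    _ = ε := by field_simp

theorem norm_initVel_le (h : IsSmallScale F x R ε L e V r) (hD : D ≠ 0) (hDr : ‖D‖ ≤ 2 * r)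
    {q : Euc n} (hq : q ∈ ball x (2 * r)) : ‖initVel V D q‖ ≤ 1 + ε := by
  have hD' : 0 < ‖D‖ := norm_pos_iff.2 hD
  have h1 := h.norm_initVel_sub_le hD hDr hq
  have h2 := norm_sub_norm_le (initVel V D q) (‖D‖⁻¹ • D)
  have h3 : ‖‖D‖⁻¹ • D‖ = 1 := by
    rw [norm_smul, norm_inv, norm_norm, inv_mul_cancel₀ hD'.ne']
  linarith

theorem norm_initVel_sub_initVel_le (h : IsSmallScale F x R ε L e V r) (hD : D ≠ 0)
    (hDr : ‖D‖ ≤ 2 * r) {q q' : Euc n} (hq : q ∈ ball x (2 * r)) (hq' : q' ∈ ball x (2 * r)) :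
    ‖initVel V D q - initVel V D q'‖ ≤ L * ‖q - q'‖ := by
  have hD' : 0 < ‖D‖ := norm_pos_iff.2 hD
  obtain ⟨h1, h2⟩ := h.mem_ball_add hDr hq
  obtain ⟨h1', h2'⟩ := h.mem_ball_add hDr hq'
  have h3 := h.chart.log_lipschitz q h1 q' h1' D h2 h2'
  rw [initVel, initVel, ← smul_sub, norm_smul, norm_inv, norm_norm]
  calc ‖D‖⁻¹ * ‖V (q, q + D) - V (q', q' + D)‖ ≤ ‖D‖⁻¹ * (L * ‖D‖ * ‖q - q'‖) := by gcongr
    _ = L * ‖q - q'‖ := by field_simp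

theorem smul_initVel_mem (h : IsSmallScale F x R ε L e V r) (hD : D ≠ 0) (hDr : ‖D‖ ≤ 2 * r)
    {q : Euc n} (hq : q ∈ ball x (2 * r)) {t : ℝ} (ht : |t| < 3 * r) :
    t • initVel V D q ∈ ball (0 : Euc n) R := by
  rw [mem_ball_zero_iff, norm_smul, Real.norm_eq_abs]
  have h1 := h.norm_initVel_le hD hDr hq
  have h2 := h.eps_le
  have h3 := h.scale_le
  have h4 := h.scale_pos
  calc |t| * ‖initVel V D q‖ ≤ (3 * r) * 2 := by
        gcongr
        linarith
    _ < R := by linarith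

theorem chord_zero (h : IsSmallScale F x R ε L e V r) {q : Euc n} (hq : q ∈ ball x (2 * r)) :
    chord e V D q 0 = q := by
  rw [chord, zero_smul]
  exact h.chart.exp_zero q (ball_subset_ball (by linarith [h.scale_le, h.scale_pos]) hq)

theorem chord_norm (h : IsSmallScale F x R ε L e V r) (hD : D ≠ 0) (hDr : ‖D‖ ≤ 2 * r)
    {q : Euc n} (hq : q ∈ ball x (2 * r)) : chord e V D q ‖D‖ = q + D := by
  obtain ⟨h1, h2⟩ := h.mem_ball_add hDr hq
  rw [chord, initVel, smul_smul, mul_inv_cancel₀ (norm_ne_zero_iff.2 hD), one_smul]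
  exact h.chart.exp_log q h1 _ h2

/-- There are three errors: the nonlinearity of `e` (factor `ε`), the deviation of the initial
velocity from the direction of `D` (at most `ε`), and its variation with the starting point, which
over times below `3r` costs `3 r L ≤ 1/10`. With `ε ≤ 1/20` their sum stays below `1/4`. -/
theorem norm_chord_sub_chord_le (h : IsSmallScale F x R ε L e V r) (hD : D ≠ 0)
    (hDr : ‖D‖ ≤ 2 * r) {q q' : Euc n} (hq : q ∈ ball x (2 * r)) (hq' : q' ∈ ball x (2 * r))
    {t t' : ℝ} (ht : |t| < 3 * r) (ht' : |t'| < 3 * r) :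
    ‖chord e V D q t - chord e V D q' t' - ((q - q') + (t - t') • ‖D‖⁻¹ • D)‖ ≤
      1 / 4 * (‖q - q'‖ + |t - t'|) := by
  set m := initVel V D q with hm
  set m' := initVel V D q' with hm'
  set ξ := ‖D‖⁻¹ • D with hξ
  have h1 := h.chart.exp_approx q (h.mem_ball_add hDr hq).1 q' (h.mem_ball_add hDr hq').1 _
    (h.smul_initVel_mem hD hDr hq ht) _ (h.smul_initVel_mem hD hDr hq' ht')
  rw [← hm, ← hm'] at h1
  have h2 : ‖m - ξ‖ ≤ ε := h.norm_initVel_sub_le hD hDr hq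
  have h3 : ‖m‖ ≤ 1 + ε := h.norm_initVel_le hD hDr hq
  have h4 : ‖m - m'‖ ≤ L * ‖q - q'‖ := h.norm_initVel_sub_initVel_le hD hDr hq hq'
  have hε := h.eps_le
  have hε0 := h.eps_nonneg
  have hr := h.scale_pos
  have hL := h.lip_nonneg
  have hrL := h.scale_lip
  have e1 : t • m - t' • m' = (t - t') • m + t' • (m - m') := by module
  have e2 : chord e V D q t - chord e V D q' t' - ((q - q') + (t - t') • ξ) =
      (e (q, t • m) - e (q', t' • m') - ((q - q') + (t • m - t' • m'))) +
        ((t - t') • (m - ξ) + t' • (m - m')) := by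
    rw [chord, chord, ← hm, ← hm']; module
  have h5 : ‖t' • (m - m')‖ ≤ 1 / 10 * ‖q - q'‖ := by
    rw [norm_smul, Real.norm_eq_abs]
    calc |t'| * ‖m - m'‖ ≤ (3 * r) * (L * ‖q - q'‖) := by gcongr
      _ = (3 * r * L) * ‖q - q'‖ := by ring
      _ ≤ 1 / 10 * ‖q - q'‖ := by gcongr; linarith
  have h6 : ‖(t - t') • m‖ ≤ |t - t'| * (1 + ε) := by
    rw [norm_smul, Real.norm_eq_abs]; gcongr
  have h7 : ‖(t - t') • (m - ξ)‖ ≤ |t - t'| * ε := by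
    rw [norm_smul, Real.norm_eq_abs]; gcongr
  have h8 : ‖t • m - t' • m'‖ ≤ |t - t'| * (1 + ε) + 1 / 10 * ‖q - q'‖ := by
    rw [e1]; exact (norm_add_le _ _).trans (add_le_add h6 h5)
  rw [e2]
  have h9 := norm_add_le (e (q, t • m) - e (q', t' • m') - ((q - q') + (t • m - t' • m')))
        ((t - t') • (m - ξ) + t' • (m - m'))
  have h10 := norm_add_le ((t - t') • (m - ξ)) (t' • (m - m'))
  have h11 : ε * (‖q - q'‖ + ‖t • m - t' • m'‖) ≤
      1 / 20 * (‖q - q'‖ + (|t - t'| * (1 + 1 / 20) + 1 / 10 * ‖q - q'‖)) := by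
    gcongr
    exact h8.trans (by gcongr)
  have h12 : |t - t'| * ε ≤ |t - t'| * (1 / 20) := by gcongr
  have h13 := abs_nonneg (t - t')
  have h14 := norm_nonneg (q - q')
  linarith

theorem norm_chord_sub_le (h : IsSmallScale F x R ε L e V r) (hD : D ≠ 0)
    (hDr : ‖D‖ ≤ 2 * r) {q : Euc n} (hq : q ∈ ball x (2 * r)) {t : ℝ} (ht : |t| < 3 * r) :
    ‖chord e V D q t - (q + t • ‖D‖⁻¹ • D)‖ ≤ 3 * ε * |t| := by
  set m := initVel V D q with hm
  have hqR := (h.mem_ball_add hDr hq).1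
  have h1 := h.chart.exp_approx q hqR q hqR _
    (h.smul_initVel_mem hD hDr hq ht) 0 (mem_ball_self h.chart.radius_pos)
  rw [h.chart.exp_zero q hqR, ← hm, sub_self, zero_add, norm_zero, zero_add, sub_zero,
    norm_smul, Real.norm_eq_abs] at h1
  have h2 : ‖m - ‖D‖⁻¹ • D‖ ≤ ε := h.norm_initVel_sub_le hD hDr hq
  have h3 : ‖m‖ ≤ 1 + ε := h.norm_initVel_le hD hDr hq
  have e1 : chord e V D q t - (q + t • ‖D‖⁻¹ • D) =
      (e (q, t • m) - q - t • m) + t • (m - ‖D‖⁻¹ • D) := by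
    rw [chord, ← hm]; module
  rw [e1]
  refine (norm_add_le _ _).trans ?_
  rw [norm_smul, Real.norm_eq_abs]
  have hε0 := h.eps_nonneg
  have h4 : ε * (|t| * ‖m‖) ≤ ε * (|t| * 2) := by
    gcongr
    linarith [h.eps_le]
  have h5 : |t| * ‖m - ‖D‖⁻¹ • D‖ ≤ |t| * ε := by gcongr
  nlinarith

theorem norm_deriv_chord_sub_le (h : IsSmallScale F x R ε L e V r) (hD : D ≠ 0)
    (hDr : ‖D‖ ≤ 2 * r) {q : Euc n} (hq : q ∈ ball x (2 * r)) {t : ℝ} (ht : |t| < 3 * r) :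
    ‖deriv (chord e V D q) t - ‖D‖⁻¹ • D‖ ≤ 3 * ε := by
  set m := initVel V D q with hm
  have h1 : ‖deriv (chord e V D q) t - m‖ ≤ ε * ‖m‖ :=
    h.chart.norm_deriv_sub_le h.eps_nonneg (h.mem_ball_add hDr hq).1 (h.smul_initVel_mem hD hDr hq ht)
  have h2 : ‖m - ‖D‖⁻¹ • D‖ ≤ ε := h.norm_initVel_sub_le hD hDr hq
  have h3 : ‖m‖ ≤ 1 + ε := h.norm_initVel_le hD hDr hq
  have h4 := norm_sub_le_norm_sub_add_norm_sub (deriv (chord e V D q) t) m (‖D‖⁻¹ • D)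
  have := h.eps_nonneg
  have := h.eps_le
  nlinarith

theorem norm_deriv_chord_le (h : IsSmallScale F x R ε L e V r) (hD : D ≠ 0)
    (hDr : ‖D‖ ≤ 2 * r) {q : Euc n} (hq : q ∈ ball x (2 * r)) {t : ℝ} (ht : |t| < 3 * r) :
    ‖deriv (chord e V D q) t‖ ≤ 2 := by
  have h1 := h.norm_deriv_chord_sub_le hD hDr hq ht
  have h2 := norm_sub_norm_le (deriv (chord e V D q) t) (‖D‖⁻¹ • D)
  have h3 : ‖‖D‖⁻¹ • D‖ = 1 := by
    rw [norm_smul, norm_inv, norm_norm, inv_mul_cancel₀ (norm_ne_zero_iff.2 hD)]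
  linarith [h.eps_le]

theorem contDiffOn_initVel (h : IsSmallScale F x R ε L e V r) (hDr : ‖D‖ ≤ 2 * r) :
    ContDiffOn ℝ ∞ (initVel V D) (ball x (2 * r)) := by
  refine ContDiffOn.const_smul ‖D‖⁻¹ (h.chart.log_smooth.comp
    (contDiff_id.prodMk (contDiff_id.add contDiff_const)).contDiffOn fun q hq => ?_)
  exact mem_ball_prod.2 (h.mem_ball_add hDr hq)

theorem contDiffOn_chord (h : IsSmallScale F x R ε L e V r) (hD : D ≠ 0) (hDr : ‖D‖ ≤ 2 * r) :
    ContDiffOn ℝ ∞ (fun p : Euc n × ℝ => chord e V D p.1 p.2)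
      (ball x (2 * r) ×ˢ Ioo (-(3 * r)) (3 * r)) := by
  refine h.chart.exp_smooth.comp (contDiffOn_fst.prodMk (contDiffOn_snd.smul
    ((h.contDiffOn_initVel hDr).comp contDiffOn_fst fun p hp => hp.1))) fun p hp => ?_
  exact mem_ball_prod.2 ⟨(h.mem_ball_add hDr hp.1).1, h.smul_initVel_mem hD hDr hp.1 (abs_lt.2 hp.2)⟩

end IsSmallScale

end Family

/-! ### Curvilinear projections along families of geodesics -/

section Projection

variable {n : ℕ} {F : Euc n → Euc n → Euc n} {x : Euc n} {R ε L r s : ℝ}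
  {e V : Euc n × Euc n → Euc n} {D ξ : Euc n}

theorem norm_inv_norm_smul (hD : D ≠ 0) : ‖‖D‖⁻¹ • D‖ = 1 := by
  rw [norm_smul, norm_inv, norm_norm, inv_mul_cancel₀ (norm_ne_zero_iff.2 hD)]

theorem inner_orthogonal_singleton (y : (ℝ ∙ ξ)ᗮ) : ⟪ξ, (y : Euc n)⟫ = 0 :=
  Submodule.mem_orthogonal_singleton_iff_inner_right.1 y.2

theorem inner_add_smul_unit (hξ : ‖ξ‖ = 1) (p : Euc n) (t : ℝ) : ⟪ξ, p + t • ξ⟫ = ⟪ξ, p⟫ + t := by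
  rw [inner_add_right, inner_smul_right, real_inner_self_eq_norm_sq, hξ]; ring

theorem mem_cylinder_iff (hξ : ‖ξ‖ = 1) {ρ τ : ℝ} {p : Euc n} :
    p ∈ cylinder ξ ρ τ ↔ ‖p - ⟪ξ, p⟫ • ξ‖ < ρ ∧ |⟪ξ, p⟫| < τ := by
  constructor
  · rintro ⟨y, hy, t, ht, rfl⟩
    have h1 : ⟪ξ, (y : Euc n) + t • ξ⟫ = t := by
      rw [inner_add_smul_unit hξ, inner_orthogonal_singleton, zero_add]
    rw [h1, add_sub_cancel_right]
    exact ⟨hy, ht⟩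
  · rintro ⟨h1, h2⟩
    refine ⟨⟨p - ⟪ξ, p⟫ • ξ, Submodule.mem_orthogonal_singleton_iff_inner_right.2 ?_⟩, h1, _, h2, ?_⟩
    · rw [inner_sub_right, inner_smul_right, real_inner_self_eq_norm_sq, hξ]; ring
    · simp

theorem isOpen_cylinder (hξ : ‖ξ‖ = 1) (ρ τ : ℝ) : IsOpen (cylinder ξ ρ τ) := by
  have : cylinder ξ ρ τ = {p | ‖p - ⟪ξ, p⟫ • ξ‖ < ρ ∧ |⟪ξ, p⟫| < τ} :=
    Set.ext fun p => mem_cylinder_iff hξ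
  rw [this]
  have h1 : Continuous fun p : Euc n => ‖p - ⟪ξ, p⟫ • ξ‖ := by fun_prop
  have h2 : Continuous fun p : Euc n => |⟪ξ, p⟫| := by fun_prop
  exact (isOpen_lt h1 continuous_const).inter (isOpen_lt h2 continuous_const)

/-- The point of the hyperplane at level `s` through which the curve through `p` passes. -/
noncomputable def baseOf (x : Euc n) (s : ℝ) (ξ p : Euc n) : Euc n := x + s • ξ + (p - ⟪ξ, p⟫ • ξ)

/-- The parametrization of the chords with displacement `D` starting from the hyperplane at
level `s` orthogonal to `D`. -/
noncomputable def chordParam (e V : Euc n × Euc n → Euc n) (D x : Euc n) (s : ℝ) (p : Euc n) :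
    Euc n :=
  chord e V D (baseOf x s (‖D‖⁻¹ • D) p) ⟪‖D‖⁻¹ • D, p⟫

theorem baseOf_add_smul (hξ : ‖ξ‖ = 1) (y : (ℝ ∙ ξ)ᗮ) (t : ℝ) :
    baseOf x s ξ ((y : Euc n) + t • ξ) = x + s • ξ + y := by
  rw [baseOf, inner_add_smul_unit hξ, inner_orthogonal_singleton, zero_add, add_sub_cancel_right]

theorem baseOf_translate (hξ : ‖ξ‖ = 1) (p : Euc n) (t : ℝ) :
    baseOf x s ξ (p + t • ξ) = baseOf x s ξ p := by
  rw [baseOf, baseOf, inner_add_smul_unit hξ]; module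

theorem chordParam_add_smul (hD : D ≠ 0) (y : (ℝ ∙ (‖D‖⁻¹ • D))ᗮ) (t : ℝ) :
    chordParam e V D x s ((y : Euc n) + t • ‖D‖⁻¹ • D) = chord e V D (x + s • ‖D‖⁻¹ • D + y) t := by
  rw [chordParam, baseOf_add_smul (norm_inv_norm_smul hD), inner_add_smul_unit
    (norm_inv_norm_smul hD), inner_orthogonal_singleton, zero_add]

theorem velocity_chordParam (hD : D ≠ 0) (p : Euc n) :
    velocity (chordParam e V D x s) (‖D‖⁻¹ • D) p =
      deriv (chord e V D (baseOf x s (‖D‖⁻¹ • D) p)) ⟪‖D‖⁻¹ • D, p⟫ := by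
  have hξ := norm_inv_norm_smul hD
  rw [velocity, lineDeriv]
  simp only [chordParam, baseOf_translate hξ, inner_add_smul_unit hξ]
  rw [deriv_comp_const_add, add_zero]

theorem velocity_velocity_chordParam (hD : D ≠ 0) (p : Euc n) :
    velocity (velocity (chordParam e V D x s) (‖D‖⁻¹ • D)) (‖D‖⁻¹ • D) p =
      deriv (deriv (chord e V D (baseOf x s (‖D‖⁻¹ • D) p))) ⟪‖D‖⁻¹ • D, p⟫ := by
  have hξ := norm_inv_norm_smul hD
  conv_lhs => rw [velocity, lineDeriv]
  simp only [velocity_chordParam hD, baseOf_translate hξ, inner_add_smul_unit hξ]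
  rw [deriv_comp_const_add, add_zero]

namespace IsSmallScale

theorem _root_.add_mem_ball_two_mul (hξ : ‖ξ‖ = 1) (hs : |s| < r)
    {y : Euc n} (hy : ‖y‖ < r) : x + s • ξ + y ∈ ball x (2 * r) := by
  rw [mem_ball_iff_norm, show x + s • ξ + y - x = s • ξ + y by abel]
  have h1 := norm_add_le (s • ξ) y
  rw [norm_smul, hξ, mul_one, Real.norm_eq_abs] at h1
  linarith

theorem contDiffOn_chordParam (h : IsSmallScale F x R ε L e V r) (hD : D ≠ 0)
    (hDr : ‖D‖ ≤ 2 * r) (hs : |s| < r) :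
    ContDiffOn ℝ ∞ (chordParam e V D x s) (cylinder (‖D‖⁻¹ • D) r (3 * r)) := by
  have hξ := norm_inv_norm_smul hD
  have hb : ContDiff ℝ ∞ (fun p : Euc n => (baseOf x s (‖D‖⁻¹ • D) p, ⟪‖D‖⁻¹ • D, p⟫)) := by
    unfold baseOf
    have h1 : ContDiff ℝ ∞ (fun p : Euc n => ⟪‖D‖⁻¹ • D, p⟫) := contDiff_const.inner ℝ contDiff_id
    exact (contDiff_const.add (contDiff_id.sub (h1.smul contDiff_const))).prodMk h1
  refine (h.contDiffOn_chord hD hDr).comp hb.contDiffOn fun p hp => ?_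
  obtain ⟨h1, h2⟩ := (mem_cylinder_iff hξ).1 hp
  exact ⟨add_mem_ball_two_mul hξ hs h1, abs_lt.1 h2⟩

/-- The components of `p - p'` along the direction of `D` and orthogonal to it are both at most `‖p
- p'‖`, so the constant `1/4` for chords becomes `1/2`. -/
theorem norm_chordParam_sub_le (h : IsSmallScale F x R ε L e V r) (hD : D ≠ 0)
    (hDr : ‖D‖ ≤ 2 * r) (hs : |s| < r) {p p' : Euc n}
    (hp : p ∈ cylinder (‖D‖⁻¹ • D) r (3 * r)) (hp' : p' ∈ cylinder (‖D‖⁻¹ • D) r (3 * r)) :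
    ‖chordParam e V D x s p - chordParam e V D x s p' - (p - p')‖ ≤ 1 / 2 * ‖p - p'‖ := by
  have hξ := norm_inv_norm_smul hD
  obtain ⟨h1, h2⟩ := (mem_cylinder_iff hξ).1 hp
  obtain ⟨h1', h2'⟩ := (mem_cylinder_iff hξ).1 hp'
  have key := h.norm_chord_sub_chord_le hD hDr (add_mem_ball_two_mul hξ hs h1)
    (add_mem_ball_two_mul hξ hs h1') h2 h2'
  set ξ := ‖D‖⁻¹ • D with hξdef
  have e1 : x + s • ξ + (p - ⟪ξ, p⟫ • ξ) - (x + s • ξ + (p' - ⟪ξ, p'⟫ • ξ)) =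
      (p - p') - ⟪ξ, p - p'⟫ • ξ := by
    rw [inner_sub_right]; module
  rw [e1, ← inner_sub_right, sub_add_cancel] at key
  refine key.trans ?_
  have h3 : |⟪ξ, p - p'⟫| ≤ ‖p - p'‖ := by
    simpa [hξ] using abs_real_inner_le_norm ξ (p - p')
  have h4 : ‖(p - p') - ⟪ξ, p - p'⟫ • ξ‖ ≤ ‖p - p'‖ := by
    refine abs_le_of_sq_le_sq' ?_ (norm_nonneg _) |>.2
    rw [@norm_sub_sq_real, inner_smul_right, norm_smul, hξ, mul_one, real_inner_comm ξ,
      Real.norm_eq_abs, sq_abs]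
    nlinarith [sq_nonneg ⟪ξ, p - p'⟫]
  linarith

/-- The projection is the inverse of `chordParam` followed by the orthogonal projection; the first
is `2`-Lipschitz and the second `1`-Lipschitz. The half-height `3r` leaves room around the times
`[0, ‖D‖]`, as `‖D‖ ≤ 2r`. -/
theorem exists_isCurvilinearProjection (h : IsSmallScale F x R ε L e V r) (hD : D ≠ 0)
    (hDr : ‖D‖ ≤ 2 * r) (hs : |s| < r) :
    IsOpen (chordParam e V D x s '' cylinder (‖D‖⁻¹ • D) r (3 * r)) ∧
    ∃ P : Euc n → (ℝ ∙ (‖D‖⁻¹ • D))ᗮ,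
      IsCurvilinearProjection F
        (chordParam e V D x s '' cylinder (‖D‖⁻¹ • D) r (3 * r) ∩ ball x r) (‖D‖⁻¹ • D) P r (3 * r)
        (chordParam e V D x s) ∧
      lipConst P (chordParam e V D x s '' cylinder (‖D‖⁻¹ • D) r (3 * r) ∩ ball x r) ≤ 2 := by
  have hξ := norm_inv_norm_smul hD
  obtain ⟨ψ, hψo, hψi, hψs, hψl⟩ := exists_smooth_lipschitz_inverse (isOpen_cylinder hξ r (3 * r))
    (h.contDiffOn_chordParam hD hDr hs) (fun p hp p' hp' => h.norm_chordParam_sub_le hD hDr hs hp hp')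
  refine ⟨hψo, fun z => ((ℝ ∙ (‖D‖⁻¹ • D))ᗮ).orthogonalProjectionOnto (ψ z), ?_⟩
  have hlip : LipschitzOnWith 2
      (fun z => ((ℝ ∙ (‖D‖⁻¹ • D))ᗮ).orthogonalProjectionOnto (ψ z))
      (chordParam e V D x s '' cylinder (‖D‖⁻¹ • D) r (3 * r) ∩ ball x r) := by
    have h1 : LipschitzWith 1 (((ℝ ∙ (‖D‖⁻¹ • D))ᗮ).orthogonalProjectionOnto) := by
      refine LipschitzWith.of_dist_le_mul fun a b => ?_
      rw [dist_eq_norm, dist_eq_norm, ← map_sub, NNReal.coe_one, one_mul]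
      exact Submodule.norm_orthogonalProjectionOnto_apply_le _ _
    have h2 := h1.comp_lipschitzOnWith (hψl.mono (inter_subset_left (t := ball x r)))
    rw [one_mul] at h2
    exact h2
  refine ⟨⟨h.scale_pos, by linarith [h.scale_pos], ?_, ⟨2, hlip⟩, h.contDiffOn_chordParam hD hDr hs,
    ⟨3 / 2, ?_⟩, inter_subset_left, ⟨ψ, fun p hp _ => hψi p hp, hψs.mono inter_subset_left, 2,
      hψl.mono inter_subset_left⟩, ?_, ?_⟩, ?_⟩
  · exact (ContinuousLinearMap.contDiff _).comp_contDiffOn (hψs.mono inter_subset_left)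
  · refine LipschitzOnWith.of_dist_le_mul fun p hp p' hp' => ?_
    have h1 := h.norm_chordParam_sub_le hD hDr hs hp hp'
    have h2 := norm_sub_norm_le (chordParam e V D x s p - chordParam e V D x s p') (p - p')
    rw [dist_eq_norm, dist_eq_norm]
    push_cast
    linarith
  · intro y hy t ht _
    have hmem : (y : Euc n) + t • ‖D‖⁻¹ • D ∈ cylinder (‖D‖⁻¹ • D) r (3 * r) :=
      ⟨y, hy, t, ht, rfl⟩
    simp only [hψi _ hmem]
    rw [map_add, map_smul, Submodule.orthogonalProjectionOnto_mem_subspace_eq_self]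
    have : ((ℝ ∙ (‖D‖⁻¹ • D))ᗮ).orthogonalProjectionOnto (‖D‖⁻¹ • D) = 0 :=
      Submodule.orthogonalProjectionOnto_orthogonalComplement_singleton_eq_zero _
    rw [this, smul_zero, add_zero]
  · intro p hp
    obtain ⟨h1, h2⟩ := (mem_cylinder_iff hξ).1 hp
    have hq := add_mem_ball_two_mul (x := x) hξ hs h1
    rw [velocity_velocity_chordParam hD, velocity_chordParam hD]
    exact (h.chart.exp_ode _ (h.mem_ball_add hDr hq).1 _ _ (h.smul_initVel_mem hD hDr hq h2)).deriv
  · exact csInf_le (OrderBot.bddBelow _) hlip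

/-- The estimate on the slices along the chords with displacement `D`. -/
theorem lintegral_truncatedVariation_le (h : IsSmallScale F x R ε L e V r) (hD : D ≠ 0)
    (hDr : ‖D‖ ≤ 2 * r) (hs : |s| < r) {Ω : Set (Euc n)} {u : Euc n → Euc n}
    {lam : Measure (Euc n)} (hu : IsGBDMeasure F Ω u lam) (hΩ : ball x r ⊆ Ω) :
    ∃ U : Set (Euc n), chordParam e V D x s '' cylinder (‖D‖⁻¹ • D) r (3 * r) ∩ ball x r ⊆ U ∧
      (∀ᵐ y : (ℝ ∙ (‖D‖⁻¹ • D))ᗮ, IsBVLoc (sliceFun (chordParam e V D x s) (‖D‖⁻¹ • D) u y)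
        (sliceSet (chordParam e V D x s) (‖D‖⁻¹ • D) r (3 * r) U y)) ∧
      ∫⁻ y : (ℝ ∙ (‖D‖⁻¹ • D))ᗮ, truncatedVariation
        (sliceFun (chordParam e V D x s) (‖D‖⁻¹ • D) u y)
        (sliceSet (chordParam e V D x s) (‖D‖⁻¹ • D) r (3 * r) U y)
        (sliceSet (chordParam e V D x s) (‖D‖⁻¹ • D) r (3 * r) U y) ≤
        4 * 2 ^ (n - 1) * lam (ball x r) := by
  have hξ := norm_inv_norm_smul hD
  obtain ⟨hopen, P, hP, hlip⟩ := h.exists_isCurvilinearProjection hD hDr hs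
  set U := chordParam e V D x s '' cylinder (‖D‖⁻¹ • D) r (3 * r) ∩ ball x r with hU
  have hUo : IsOpen U := hopen.inter isOpen_ball
  have hUΩ : U ⊆ Ω := inter_subset_right.trans hΩ
  refine ⟨U, subset_rfl, hu.slice_bv U hUo hUΩ _ hξ P r (3 * r) _ hP, ?_⟩
  refine (hu.slice_le U hUo hUΩ _ hξ P r (3 * r) _ hP U hUo.measurableSet subset_rfl).trans ?_
  -- Speed at most `2` gives the factor `4`; the Lipschitz constant `2` of the projection gives `2 ^
  -- (n - 1)`.
  have hvel : eLpNorm (velocity (chordParam e V D x s) (‖D‖⁻¹ • D)) ∞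
      (volume.restrict (cylinder (‖D‖⁻¹ • D) r (3 * r))) ≤ 2 := by
    rw [eLpNorm_exponent_top]
    refine (eLpNormEssSup_le_of_ae_bound (C := 2) ?_).trans (by simp)
    filter_upwards [ae_restrict_mem (isOpen_cylinder hξ r (3 * r)).measurableSet] with p hp
    obtain ⟨h1, h2⟩ := (mem_cylinder_iff hξ).1 hp
    rw [velocity_chordParam hD]
    exact h.norm_deriv_chord_le hD hDr (add_mem_ball_two_mul hξ hs h1) h2
  have h4 : max 1 (eLpNorm (velocity (chordParam e V D x s) (‖D‖⁻¹ • D)) ∞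
      (volume.restrict (cylinder (‖D‖⁻¹ • D) r (3 * r))) ^ 2) ≤ 4 := by
    refine max_le (by norm_num) ?_
    calc _ ≤ (2 : ℝ≥0∞) ^ 2 := by gcongr
      _ = 4 := by norm_num
  have hlip' : (lipConst P U : ℝ≥0∞) ≤ 2 := by exact_mod_cast hlip
  gcongr
  exact inter_subset_right

end IsSmallScale

end Projection

/-! ### Measure theoretic tools -/

section MeasureTools

variable {n : ℕ}

theorem measurePreserving_orthogonal_param {ξ : Euc n} (hξ : ‖ξ‖ = 1) (x : Euc n) :
    MeasurePreserving (fun p : ℝ × (ℝ ∙ ξ)ᗮ => x + p.1 • ξ + (p.2 : Euc n)) volume volume := by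
  have h1 := (LinearIsometryEquiv.toSpanUnitSingleton (𝕜 := ℝ) ξ hξ).measurePreserving
  have h2 := h1.prod (MeasurePreserving.id (volume : Measure (ℝ ∙ ξ)ᗮ))
  have h3 := (Submodule.measurePreserving_measurableEquivProd (ℝ ∙ ξ) x).symm
  rw [InnerProductSpace.euclideanHausdorffMeasure_eq_volume] at h3
  have h4 := h3.comp h2
  convert! h4 using 1
  funext p
  change _ = ((p.1 • ξ : Euc n) + (p.2 : Euc n)) + x
  abel

theorem lintegral_eq_lintegral_orthogonal {ξ : Euc n} (hξ : ‖ξ‖ = 1) (x : Euc n)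
    {f : Euc n → ℝ≥0∞} (hf : Measurable f) :
    ∫⁻ q, f q = ∫⁻ s : ℝ, ∫⁻ y : (ℝ ∙ ξ)ᗮ, f (x + s • ξ + y) := by
  have h := measurePreserving_orthogonal_param hξ x
  rw [← h.lintegral_comp hf, Measure.volume_eq_prod, lintegral_prod]
  exact (hf.comp h.measurable).aemeasurable

theorem ae_ae_orthogonal {ξ : Euc n} (hξ : ‖ξ‖ = 1) (x : Euc n) {p : Euc n → Prop}
    (hp : ∀ᵐ q, p q) : ∀ᵐ s : ℝ, ∀ᵐ y : (ℝ ∙ ξ)ᗮ, p (x + s • ξ + y) := by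
  have h := (measurePreserving_orthogonal_param hξ x).quasiMeasurePreserving.ae hp
  rw [Measure.volume_eq_prod] at h
  exact Measure.ae_ae_of_ae_prod h

/-- On `A` the map expands distances by a factor at least `1/2`, so preimages have controlled
Hausdorff measure, and Lebesgue measure is a multiple of the `n`-dimensional one. Neither smoothness
nor measurability is involved. -/
theorem volume_inter_preimage_le {A N : Set (Euc n)} {Φ : Euc n → Euc n}
    (hΦ : ∀ q ∈ A, ∀ q' ∈ A, ‖Φ q - Φ q' - (q - q')‖ ≤ 1 / 2 * ‖q - q'‖) :
    volume (A ∩ Φ ⁻¹' N) ≤ 2 ^ n * volume N := by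
  rw [← EuclideanSpace.euclideanHausdorffMeasure_eq_volume, Measure.euclideanHausdorffMeasure_def]
  simp only [Measure.smul_apply]
  have hanti : AntilipschitzWith 2 (fun q : A => Φ q) := by
    refine AntilipschitzWith.of_le_mul_dist fun q q' => ?_
    have h1 := hΦ q q.2 q' q'.2
    have h2 := norm_sub_norm_le ((q : Euc n) - q') (Φ q - Φ q')
    rw [norm_sub_rev] at h1
    rw [Subtype.dist_eq, dist_eq_norm, dist_eq_norm]
    change _ ≤ (2 : ℝ) * _
    linarith
  have h3 := hanti.hausdorffMeasure_preimage_le (d := n) (by positivity) N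
  have h4 := (isometry_subtype_coe (s := A)).hausdorffMeasure_image (d := n)
    (Or.inl (by positivity)) ((fun q : A => Φ q) ⁻¹' N)
  have h5 : ((↑) : A → Euc n) '' ((fun q : A => Φ q) ⁻¹' N) = A ∩ Φ ⁻¹' N := by
    ext q; simp [and_comm]
  rw [h5] at h4
  rw [← h4, ENNReal.rpow_natCast] at h3
  calc _ ≤ (volume : Measure (Euc n)).addHaarScalarFactor (μH[(n : ℝ)]) •
        (((2 : ℝ≥0) : ℝ≥0∞) ^ n * μH[(n : ℝ)] N) := by gcongr
    _ = _ := by rw [mul_smul_comm]; rfl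

/-- Cutting off the large values of `f` costs little, because the integrand is at most `1` and `ν`
is finite; the bounded remainder is approximated in `L¹`. -/
theorem exists_continuous_lintegral_min_le {ν : Measure (Euc n)} [IsFiniteMeasure ν]
    {f : Euc n → Euc n} (hf : Measurable f) {ε : ℝ≥0∞} (hε : ε ≠ 0) :
    ∃ g : Euc n → Euc n, Continuous g ∧
      ∫⁻ q, ENNReal.ofReal (min ‖f q - g q‖ 1) ∂ν ≤ ε := by
  let fk : ℕ → Euc n → Euc n := fun k => {q | ‖f q‖ ≤ k}.indicator f
  have hset : ∀ k : ℕ, MeasurableSet {q | ‖f q‖ ≤ k} := fun k =>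
    measurableSet_le hf.norm measurable_const
  have hfk : ∀ k, Measurable (fk k) := fun k => hf.indicator (hset k)
  have hlim : Tendsto (fun k => ∫⁻ q, ENNReal.ofReal (min ‖f q - fk k q‖ 1) ∂ν) atTop
      (𝓝 (∫⁻ _, 0 ∂ν)) := by
    refine tendsto_lintegral_of_dominated_convergence (fun _ => 1) (fun k => ?_) (fun k => ?_) ?_ ?_
    · have := hfk k
      fun_prop
    · refine Eventually.of_forall fun q => ?_
      exact (ENNReal.ofReal_le_ofReal (min_le_right _ _)).trans (by simp)
    · simp
    · refine Eventually.of_forall fun q => ?_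
      obtain ⟨m, hm⟩ := exists_nat_ge ‖f q‖
      refine tendsto_const_nhds.congr' ?_
      filter_upwards [eventually_ge_atTop m] with k hk
      have : q ∈ {q | ‖f q‖ ≤ k} := hm.trans (by exact_mod_cast hk)
      simp [fk, indicator_of_mem this]
  rw [lintegral_zero] at hlim
  have hε2 : ε / 2 ≠ 0 := (ENNReal.div_pos hε (by simp)).ne'
  obtain ⟨k, hk⟩ := ((ENNReal.tendsto_nhds_zero.1 hlim) (ε / 2) (pos_iff_ne_zero.2 hε2)).exists
  have hmem : MemLp (fk k) 1 ν := by
    refine MemLp.of_bound (hfk k).aestronglyMeasurable k (Eventually.of_forall fun q => ?_)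
    by_cases hq : q ∈ {q | ‖f q‖ ≤ k}
    · simpa [fk, indicator_of_mem hq] using hq
    · simp [fk, indicator_of_notMem hq]
  obtain ⟨g, hg, -⟩ := hmem.exists_boundedContinuous_eLpNorm_sub_le ENNReal.one_ne_top hε2
  refine ⟨g, g.continuous, ?_⟩
  rw [eLpNorm_one_eq_lintegral_enorm] at hg
  calc ∫⁻ q, ENNReal.ofReal (min ‖f q - g q‖ 1) ∂ν
      ≤ ∫⁻ q, (ENNReal.ofReal (min ‖f q - fk k q‖ 1) + ‖(fk k - g) q‖ₑ) ∂ν := by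
        refine lintegral_mono fun q => ?_
        rw [← ofReal_norm, ← ENNReal.ofReal_add (by positivity) (norm_nonneg _)]
        refine ENNReal.ofReal_le_ofReal ?_
        have h1 : ‖f q - g q‖ ≤ ‖f q - fk k q‖ + ‖(fk k - g) q‖ := norm_sub_le_norm_sub_add_norm_sub _ _ _
        rcases le_total ‖f q - fk k q‖ 1 with h | h
        · rw [min_eq_left h]; exact (min_le_left _ _).trans h1
        · rw [min_eq_right h]; exact (min_le_right _ _).trans (by linarith [norm_nonneg ((fk k - g) q)])
    _ ≤ ε / 2 + ε / 2 := by
        rw [lintegral_add_left]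
        · exact add_le_add hk hg
        · have := hfk k
          fun_prop
    _ = ε := ENNReal.add_halves ε

/-- Continuity in measure of the composition with maps that do not concentrate volume. -/
theorem tendsto_lintegral_min_comp {μ ν : Measure (Euc n)} [IsFiniteMeasure μ] [IsFiniteMeasure ν]
    {f : Euc n → Euc n} (hf : Measurable f) {Φ : ℕ → Euc n → Euc n} {Φ' : Euc n → Euc n}
    (hΦm : ∀ k, Measurable (Φ k)) (hΦ'm : Measurable Φ') {C : ℝ≥0}
    (hΦ : ∀ k, μ.map (Φ k) ≤ C • ν) (hΦ' : μ.map Φ' ≤ C • ν)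
    (hlim : ∀ᵐ q ∂μ, Tendsto (fun k => Φ k q) atTop (𝓝 (Φ' q))) :
    Tendsto (fun k => ∫⁻ q, ENNReal.ofReal (min ‖f (Φ k q) - f (Φ' q)‖ 1) ∂μ) atTop (𝓝 0) := by
  rw [ENNReal.tendsto_nhds_zero]
  intro ε hε
  obtain ⟨η, hη, hηε⟩ : ∃ η : ℝ≥0∞, η ≠ 0 ∧ C * η + C * η ≤ ε / 2 := by
    rcases eq_or_ne C 0 with rfl | hC
    · exact ⟨1, one_ne_zero, by simp⟩
    · refine ⟨ε / 2 / 2 / C, ?_, ?_⟩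
      · exact (ENNReal.div_pos (ENNReal.div_pos (ENNReal.div_pos hε.ne' (by simp)).ne' (by simp)).ne'
          ENNReal.coe_ne_top).ne'
      · rw [ENNReal.mul_div_cancel (by exact_mod_cast hC) ENNReal.coe_ne_top, ENNReal.add_halves]
  -- A three-term splitting through a continuous `g`: the push-forward bounds transfer the closeness
  -- of `f` and `g` to both compositions, and the compositions of `g` converge by dominated
  -- convergence.
  obtain ⟨g, hg, hfg⟩ := exists_continuous_lintegral_min_le (ν := ν) hf hη
  have hgm : Measurable g := hg.measurable
  have hfgm : Measurable fun q => ENNReal.ofReal (min ‖f q - g q‖ 1) := by fun_prop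
  have hbound : ∀ Ψ : Euc n → Euc n, Measurable Ψ → μ.map Ψ ≤ C • ν →
      ∫⁻ q, ENNReal.ofReal (min ‖f (Ψ q) - g (Ψ q)‖ 1) ∂μ ≤ C * η := by
    intro Ψ hΨm hΨ
    calc _ = ∫⁻ q, ENNReal.ofReal (min ‖f q - g q‖ 1) ∂(μ.map Ψ) := (lintegral_map hfgm hΨm).symm
      _ ≤ ∫⁻ q, ENNReal.ofReal (min ‖f q - g q‖ 1) ∂(C • ν) := lintegral_mono' hΨ le_rfl
      _ = C * ∫⁻ q, ENNReal.ofReal (min ‖f q - g q‖ 1) ∂ν := by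
          rw [lintegral_smul_measure]; rfl
      _ ≤ _ := by gcongr
  have hglim : Tendsto (fun k => ∫⁻ q, ENNReal.ofReal (min ‖g (Φ k q) - g (Φ' q)‖ 1) ∂μ) atTop
      (𝓝 (∫⁻ _, 0 ∂μ)) := by
    refine tendsto_lintegral_of_dominated_convergence (fun _ => 1) (fun k => ?_) (fun k => ?_) ?_ ?_
    · have := hΦm k
      fun_prop
    · refine Eventually.of_forall fun q => ?_
      exact (ENNReal.ofReal_le_ofReal (min_le_right _ _)).trans (by simp)
    · simp
    · filter_upwards [hlim] with q hq
      have h1 : Tendsto (fun k => ENNReal.ofReal (min ‖g (Φ k q) - g (Φ' q)‖ 1)) atTop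
          (𝓝 (ENNReal.ofReal (min ‖g (Φ' q) - g (Φ' q)‖ 1))) := by
        refine ENNReal.tendsto_ofReal ?_
        exact ((((hg.tendsto _).comp hq).sub_const _).norm).min tendsto_const_nhds
      simpa using h1
  rw [lintegral_zero] at hglim
  filter_upwards [(ENNReal.tendsto_nhds_zero.1 hglim) (ε / 2) (ENNReal.div_pos hε.ne' (by simp))]
    with k hk
  have hmk := hΦm k
  calc ∫⁻ q, ENNReal.ofReal (min ‖f (Φ k q) - f (Φ' q)‖ 1) ∂μ
      ≤ ∫⁻ q, (ENNReal.ofReal (min ‖f (Φ k q) - g (Φ k q)‖ 1) +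
          ENNReal.ofReal (min ‖f (Φ' q) - g (Φ' q)‖ 1) +
          ENNReal.ofReal (min ‖g (Φ k q) - g (Φ' q)‖ 1)) ∂μ := by
        refine lintegral_mono fun q => ?_
        rw [← ENNReal.ofReal_add (by positivity) (by positivity),
          ← ENNReal.ofReal_add (by positivity) (by positivity)]
        refine ENNReal.ofReal_le_ofReal ?_
        have h1 : f (Φ k q) - f (Φ' q) = (f (Φ k q) - g (Φ k q)) - (f (Φ' q) - g (Φ' q)) +
          (g (Φ k q) - g (Φ' q)) := by abel
        have h2 := norm_add_le ((f (Φ k q) - g (Φ k q)) - (f (Φ' q) - g (Φ' q))) (g (Φ k q) - g (Φ' q))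
        rw [← h1] at h2
        have h3 := norm_sub_le (f (Φ k q) - g (Φ k q)) (f (Φ' q) - g (Φ' q))
        have n1 := norm_nonneg (f (Φ k q) - g (Φ k q))
        have n2 := norm_nonneg (f (Φ' q) - g (Φ' q))
        have n3 := norm_nonneg (g (Φ k q) - g (Φ' q))
        rcases min_choice ‖f (Φ k q) - g (Φ k q)‖ 1 with a | a <;>
        rcases min_choice ‖f (Φ' q) - g (Φ' q)‖ 1 with b | b <;>
        rcases min_choice ‖g (Φ k q) - g (Φ' q)‖ 1 with c | c <;>
        rw [a, b, c] <;>
        first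
        | exact (min_le_left _ _).trans (by linarith)
        | exact (min_le_right _ _).trans (by linarith)
    _ ≤ C * η + C * η + ε / 2 := by
        rw [lintegral_add_left (by fun_prop), lintegral_add_left (by fun_prop)]
        exact add_le_add (add_le_add (hbound _ hmk (hΦ k)) (hbound _ hΦ'm hΦ')) hk
    _ ≤ ε / 2 + ε / 2 := by gcongr
    _ = ε := ENNReal.add_halves ε

theorem min_abs_le_add {a b c : ℝ} (hb : 0 ≤ b) (hc : 0 ≤ c) (h : |a| ≤ b + c) :
    min |a| 1 ≤ min b 1 + min c 1 := by
  rcases le_total b 1 with hb1 | hb1 <;> rcases le_total c 1 with hc1 | hc1 <;>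
    simp only [min_eq_left, min_eq_right, hb1, hc1] <;>
    first
    | exact (min_le_left _ _).trans (by linarith)
    | exact (min_le_right _ _).trans (by linarith)

theorem min_two_mul_le (a : ℝ) : min (2 * a) 1 ≤ 2 * min a 1 := by
  rcases le_total a 1 with h | h
  · rw [min_eq_left h]; exact min_le_left _ _
  · rw [min_eq_right h]; exact (min_le_right _ _).trans (by norm_num)

/-- Continuity in measure for the components of a composition along converging directions. -/
theorem tendsto_lintegral_min_inner_comp {μ ν : Measure (Euc n)} [IsFiniteMeasure μ]
    [IsFiniteMeasure ν] {f : Euc n → Euc n} (hf : Measurable f) {Φ W : ℕ → Euc n → Euc n}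
    {Φ' W' : Euc n → Euc n} (hΦm : ∀ k, Measurable (Φ k)) (hΦ'm : Measurable Φ')
    (hWm : ∀ k, Measurable (W k)) (hW'm : Measurable W') {C : ℝ≥0}
    (hΦ : ∀ k, μ.map (Φ k) ≤ C • ν) (hΦ' : μ.map Φ' ≤ C • ν)
    (hlim : ∀ᵐ q ∂μ, Tendsto (fun k => Φ k q) atTop (𝓝 (Φ' q)))
    (hWlim : ∀ᵐ q ∂μ, Tendsto (fun k => W k q) atTop (𝓝 (W' q)))
    (hW : ∀ k, ∀ᵐ q ∂μ, ‖W k q‖ ≤ 2) :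
    Tendsto (fun k => ∫⁻ q, ENNReal.ofReal (min |⟪f (Φ k q), W k q⟫ - ⟪f (Φ' q), W' q⟫| 1) ∂μ)
      atTop (𝓝 0) := by
  have h1 := tendsto_lintegral_min_comp hf hΦm hΦ'm hΦ hΦ' hlim
  have h2 : Tendsto (fun k => ∫⁻ q, ENNReal.ofReal (min (‖f (Φ' q)‖ * ‖W k q - W' q‖) 1) ∂μ) atTop
      (𝓝 (∫⁻ _, 0 ∂μ)) := by
    refine tendsto_lintegral_of_dominated_convergence (fun _ => 1) (fun k => ?_) (fun k => ?_) ?_ ?_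
    · have := hWm k
      fun_prop
    · refine Eventually.of_forall fun q => ?_
      exact (ENNReal.ofReal_le_ofReal (min_le_right _ _)).trans (by simp)
    · simp
    · filter_upwards [hWlim] with q hq
      have h1 : Tendsto (fun k => ENNReal.ofReal (min (‖f (Φ' q)‖ * ‖W k q - W' q‖) 1)) atTop
          (𝓝 (ENNReal.ofReal (min (‖f (Φ' q)‖ * ‖W' q - W' q‖) 1))) := by
        refine ENNReal.tendsto_ofReal ?_
        exact (((hq.sub_const _).norm).const_mul _).min tendsto_const_nhds
      simpa using h1
  rw [lintegral_zero] at h2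
  have h3 := (ENNReal.Tendsto.const_mul (a := ENNReal.ofReal 2) h1 (Or.inr ENNReal.ofReal_ne_top)).add h2
  rw [mul_zero, add_zero] at h3
  refine tendsto_of_tendsto_of_tendsto_of_le_of_le tendsto_const_nhds h3 (fun _ => zero_le) fun k => ?_
  have hmk := hΦm k
  have hwk := hWm k
  simp only
  rw [← lintegral_const_mul _ (by fun_prop), ← lintegral_add_left (by fun_prop)]
  refine lintegral_mono_ae ?_
  filter_upwards [hW k] with q hq
  rw [← ENNReal.ofReal_mul (by norm_num),
    ← ENNReal.ofReal_add (by positivity) (by positivity)]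
  refine ENNReal.ofReal_le_ofReal ?_
  -- The change of point is separated from the change of direction: the first is multiplied by `‖W k
  -- q‖ ≤ 2`, the second by the fixed function `f ∘ Φ'`.
  have e1 : ⟪f (Φ k q), W k q⟫ - ⟪f (Φ' q), W' q⟫ =
      ⟪f (Φ k q) - f (Φ' q), W k q⟫ + ⟪f (Φ' q), W k q - W' q⟫ := by
    rw [inner_sub_left, inner_sub_right]; ring
  have h4 : |⟪f (Φ k q), W k q⟫ - ⟪f (Φ' q), W' q⟫| ≤
      2 * ‖f (Φ k q) - f (Φ' q)‖ + ‖f (Φ' q)‖ * ‖W k q - W' q‖ := by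
    rw [e1]
    refine (abs_add_le _ _).trans (add_le_add ((abs_real_inner_le_norm _ _).trans ?_)
      (abs_real_inner_le_norm _ _))
    rw [mul_comm]; gcongr
  exact (min_abs_le_add (by positivity) (by positivity) h4).trans
    (add_le_add_left (min_two_mul_le _) _)

end MeasureTools

/-! ### The increments along chords -/

section Chords

variable {n : ℕ} {F : Euc n → Euc n → Euc n} {x : Euc n} {R ε L r : ℝ}
  {e V : Euc n × Euc n → Euc n} {D : Euc n} {Ω : Set (Euc n)} {u v : Euc n → Euc n}
  {lam : Measure (Euc n)} {ρ₀ : ℝ}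

open scoped Classical in
/-- A measurable extension of the chords. -/
noncomputable def chordExt (e V : Euc n × Euc n → Euc n) (D x : Euc n) (r : ℝ) :
    Euc n × ℝ → Euc n :=
  (ball x (2 * r) ×ˢ Ioo (-(3 * r)) (3 * r)).piecewise (fun p => chord e V D p.1 p.2) 0

open scoped Classical in
/-- A measurable extension of the velocities of the chords. -/
noncomputable def chordVelExt (e V : Euc n × Euc n → Euc n) (D x : Euc n) (r : ℝ) :
    Euc n × ℝ → Euc n :=
  (ball x (2 * r) ×ˢ Ioo (-(3 * r)) (3 * r)).piecewise (fun p => deriv (chord e V D p.1) p.2) 0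

theorem chordExt_of_mem {q : Euc n} {t : ℝ} (hq : q ∈ ball x (2 * r)) (ht : |t| < 3 * r) :
    chordExt e V D x r (q, t) = chord e V D q t := by
  classical
  exact piecewise_eq_of_mem _ _ _ ⟨hq, abs_lt.1 ht⟩

theorem chordVelExt_of_mem {q : Euc n} {t : ℝ} (hq : q ∈ ball x (2 * r)) (ht : |t| < 3 * r) :
    chordVelExt e V D x r (q, t) = deriv (chord e V D q) t := by
  classical
  exact piecewise_eq_of_mem _ _ _ ⟨hq, abs_lt.1 ht⟩

/-- The set of the starting points of the chords with both ends in a ball. -/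
def chordStart (x D : Euc n) (ρ₀ : ℝ) : Set (Euc n) := {q | q ∈ ball x ρ₀ ∧ q + D ∈ ball x ρ₀}

theorem measurableSet_chordStart (x D : Euc n) (ρ₀ : ℝ) : MeasurableSet (chordStart x D ρ₀) := by
  have h1 : MeasurableSet ((fun q => q + D) ⁻¹' ball x ρ₀) :=
    (measurable_id.add_const D) measurableSet_ball
  have h2 : chordStart x D ρ₀ = ball x ρ₀ ∩ (fun q => q + D) ⁻¹' ball x ρ₀ := by
    ext q; rfl
  rw [h2]
  exact measurableSet_ball.inter h1

/-- The component of `v` along the chord starting at `q`, at the time `t`. -/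
noncomputable def chordComp (e V : Euc n × Euc n → Euc n) (D x : Euc n) (r : ℝ) (v : Euc n → Euc n)
    (p : Euc n × ℝ) : ℝ :=
  ⟪v (chordExt e V D x r p), chordVelExt e V D x r p⟫

namespace IsSmallScale

theorem continuousOn_deriv_chord (h : IsSmallScale F x R ε L e V r) (hD : D ≠ 0)
    (hDr : ‖D‖ ≤ 2 * r) : ContinuousOn (fun p : Euc n × ℝ => deriv (chord e V D p.1) p.2)
      (ball x (2 * r) ×ˢ Ioo (-(3 * r)) (3 * r)) := by
  have hopen : IsOpen (ball x (2 * r) ×ˢ Ioo (-(3 * r)) (3 * r)) := isOpen_ball.prod isOpen_Ioo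
  have hs := h.contDiffOn_chord hD hDr
  have hc := (hs.continuousOn_fderiv_of_isOpen hopen (by simp)).clm_apply
    (continuousOn_const (c := ((0 : Euc n), (1 : ℝ))))
  refine hc.congr fun p hp => ?_
  have h1 : HasFDerivAt (fun p : Euc n × ℝ => chord e V D p.1 p.2) _ p :=
    ((hs.contDiffAt (hopen.mem_nhds hp)).differentiableAt (by simp)).hasFDerivAt
  have h2 : HasDerivAt (fun t : ℝ => (p.1, t)) ((0 : Euc n), (1 : ℝ)) p.2 :=
    (hasDerivAt_const _ _).prodMk (hasDerivAt_id _)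
  exact (h1.comp_hasDerivAt p.2 h2).deriv

theorem continuousOn_chordExt (h : IsSmallScale F x R ε L e V r) (hD : D ≠ 0)
    (hDr : ‖D‖ ≤ 2 * r) :
    ContinuousOn (chordExt e V D x r) (ball x (2 * r) ×ˢ Ioo (-(3 * r)) (3 * r)) := by
  classical
  exact (h.contDiffOn_chord hD hDr).continuousOn.congr (piecewise_eqOn _ _ _)

theorem continuousOn_chordVelExt (h : IsSmallScale F x R ε L e V r) (hD : D ≠ 0)
    (hDr : ‖D‖ ≤ 2 * r) :
    ContinuousOn (chordVelExt e V D x r) (ball x (2 * r) ×ˢ Ioo (-(3 * r)) (3 * r)) := by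
  classical
  exact (h.continuousOn_deriv_chord hD hDr).congr (piecewise_eqOn _ _ _)

theorem measurable_chordExt (h : IsSmallScale F x R ε L e V r) (hD : D ≠ 0)
    (hDr : ‖D‖ ≤ 2 * r) : Measurable (chordExt e V D x r) := by
  classical
  exact (h.contDiffOn_chord hD hDr).continuousOn.measurable_piecewise continuousOn_const
    (isOpen_ball.prod isOpen_Ioo).measurableSet

theorem measurable_chordVelExt (h : IsSmallScale F x R ε L e V r) (hD : D ≠ 0)
    (hDr : ‖D‖ ≤ 2 * r) : Measurable (chordVelExt e V D x r) := by
  classical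
  exact (h.continuousOn_deriv_chord hD hDr).measurable_piecewise continuousOn_const
    (isOpen_ball.prod isOpen_Ioo).measurableSet

theorem measurable_chordComp (h : IsSmallScale F x R ε L e V r) (hD : D ≠ 0)
    (hDr : ‖D‖ ≤ 2 * r) (hv : Measurable v) : Measurable (chordComp e V D x r v) :=
  (hv.comp (h.measurable_chordExt hD hDr)).inner (h.measurable_chordVelExt hD hDr)

theorem chordStart_subset (h : IsSmallScale F x R ε L e V r) (hρ₀ : ρ₀ + 6 * ε * r ≤ r) :
    chordStart x D ρ₀ ⊆ ball x r := fun q hq =>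
  ball_subset_ball (by nlinarith [mul_nonneg h.eps_nonneg h.scale_pos.le]) hq.1

/-- The straight segment stays in the convex ball of radius `ρ₀`, and the chord departs from it by
at most `3 ε t ≤ 6 ε r`, which is the margin left between `ρ₀` and `r`. -/
theorem chord_mem_ball (h : IsSmallScale F x R ε L e V r) (hD : D ≠ 0) (hDr : ‖D‖ ≤ 2 * r)
    (hρ₀ : ρ₀ + 6 * ε * r ≤ r) {q : Euc n} (hq : q ∈ chordStart x D ρ₀) {t : ℝ}
    (ht : t ∈ Icc 0 ‖D‖) : chord e V D q t ∈ ball x r := by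
  have hr := h.scale_pos
  have hD' : 0 < ‖D‖ := norm_pos_iff.2 hD
  have h1 : q + t • ‖D‖⁻¹ • D ∈ ball x ρ₀ := by
    have h2 : t * ‖D‖⁻¹ ∈ Icc (0 : ℝ) 1 := by
      rw [← div_eq_mul_inv]
      exact ⟨div_nonneg ht.1 hD'.le, (div_le_one hD').2 ht.2⟩
    have := (convex_ball x ρ₀).add_smul_sub_mem hq.1 hq.2 h2
    rwa [add_sub_cancel_left, mul_smul] at this
  have hq2 : q ∈ ball x (2 * r) :=
    ball_subset_ball (by linarith) (h.chordStart_subset hρ₀ hq)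
  have ht3 : |t| < 3 * r := by rw [abs_of_nonneg ht.1]; linarith [ht.2]
  have h3 := h.norm_chord_sub_le hD hDr hq2 ht3
  rw [abs_of_nonneg ht.1] at h3
  rw [mem_ball_iff_norm] at h1 ⊢
  have h4 := norm_sub_le_norm_sub_add_norm_sub (chord e V D q t) (q + t • ‖D‖⁻¹ • D) x
  have h5 : 3 * ε * t ≤ 3 * ε * (2 * r) := by
    have := h.eps_nonneg
    gcongr
    exact ht.2.trans hDr
  linarith

theorem norm_chord_sub_chord_le_half (h : IsSmallScale F x R ε L e V r) (hD : D ≠ 0)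
    (hDr : ‖D‖ ≤ 2 * r) {t : ℝ} (ht : |t| < 3 * r) {q q' : Euc n} (hq : q ∈ ball x (2 * r))
    (hq' : q' ∈ ball x (2 * r)) :
    ‖chordExt e V D x r (q, t) - chordExt e V D x r (q', t) - (q - q')‖ ≤ 1 / 2 * ‖q - q'‖ := by
  have h1 := h.norm_chord_sub_chord_le hD hDr hq hq' ht ht
  rw [chordExt_of_mem hq ht, chordExt_of_mem hq' ht]
  simp only [sub_self, zero_smul, add_zero, abs_zero] at h1
  linarith [norm_nonneg (q - q')]

/-- At a fixed time, following the chords pulls null sets back to null sets; Fubini then shows that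
almost every chord meets a given null set only at negligible times. This permits replacing `u` by a
measurable representative inside the slices. -/
theorem ae_ae_chord_eq (h : IsSmallScale F x R ε L e V r) (hD : D ≠ 0) (hDr : ‖D‖ ≤ 2 * r)
    (huv : ∀ᵐ z ∂(volume.restrict (ball x r)), u z = v z) :
    ∀ᵐ q : Euc n, ∀ᵐ t : ℝ, q ∈ ball x (2 * r) → |t| < 3 * r → chord e V D q t ∈ ball x r →
      u (chord e V D q t) = v (chord e V D q t) := by
  rw [ae_restrict_iff' measurableSet_ball] at huv
  set N := toMeasurable volume {z | ¬ (z ∈ ball x r → u z = v z)} with hN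
  have hN0 : volume N = 0 := by rw [hN, measure_toMeasurable]; exact huv
  have hNm : MeasurableSet N := measurableSet_toMeasurable _ _
  set Z := (ball x (2 * r) ×ˢ Ioo (-(3 * r)) (3 * r)) ∩ chordExt e V D x r ⁻¹' N with hZ
  have hZm : MeasurableSet Z :=
    (isOpen_ball.prod isOpen_Ioo).measurableSet.inter (h.measurable_chordExt hD hDr hNm)
  have hZ0 : (volume.prod volume : Measure (Euc n × ℝ)) Z = 0 := by
    rw [Measure.prod_apply_symm hZm, lintegral_eq_zero_iff']
    · refine Eventually.of_forall fun t => ?_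
      by_cases ht : |t| < 3 * r
      · have h1 := volume_inter_preimage_le (A := ball x (2 * r)) (N := N)
          (Φ := fun q => chordExt e V D x r (q, t))
          (fun q hq q' hq' => h.norm_chord_sub_chord_le_half hD hDr ht hq hq')
        rw [hN0, mul_zero] at h1
        refine le_antisymm ((measure_mono ?_).trans h1) zero_le
        intro q hq
        exact ⟨hq.1.1, hq.2⟩
      · refine (congrArg volume ?_).trans measure_empty
        ext q
        simp only [mem_preimage, mem_empty_iff_false, iff_false]
        intro hq
        exact ht (abs_lt.2 hq.1.2)
    · exact (measurable_measure_prodMk_right hZm).aemeasurable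
  have h2 : ∀ᵐ p : Euc n × ℝ ∂(volume.prod volume), p ∉ Z := measure_eq_zero_iff_ae_notMem.1 hZ0
  filter_upwards [Measure.ae_ae_of_ae_prod h2] with q hq
  filter_upwards [hq] with t ht hq2 ht3 hb
  by_contra hne
  refine ht ⟨⟨hq2, abs_lt.1 ht3⟩, ?_⟩
  rw [mem_preimage, chordExt_of_mem hq2 ht3]
  refine subset_toMeasurable _ _ ?_
  simp only [mem_ofPred_eq, Classical.not_imp]
  exact ⟨hb, hne⟩

/-- The averages of the increments along the chords are bounded. -/
theorem lintegral_average_increment_le (h : IsSmallScale F x R ε L e V r) (hD : D ≠ 0)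
    (hDr : ‖D‖ ≤ 2 * r) (hu : IsGBDMeasure F Ω u lam) (hΩ : ball x r ⊆ Ω) (hv : Measurable v)
    (huv : ∀ᵐ z ∂(volume.restrict (ball x r)), u z = v z) (hρ₀ : ρ₀ + 6 * ε * r ≤ r) {τ : ℝ}
    (hτD : 0 + τ < ‖D‖ - τ) :
    ∫⁻ q in chordStart x D ρ₀, ∫⁻ s in Ioo 0 (0 + τ), ∫⁻ t in Ioo (‖D‖ - τ) ‖D‖,
      ENNReal.ofReal (min |chordComp e V D x r v (q, t) - chordComp e V D x r v (q, s)| 1) ≤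
      ENNReal.ofReal (2 * r) * (ENNReal.ofReal τ * (ENNReal.ofReal τ *
        (4 * 2 ^ (n - 1) * lam (ball x r)))) := by
  have hr := h.scale_pos
  have hξ := norm_inv_norm_smul hD
  have hcm := h.measurable_chordComp hD hDr hv
  set ξ := ‖D‖⁻¹ • D with hξdef
  let J : Euc n → ℝ≥0∞ := fun q => ∫⁻ s in Ioo 0 (0 + τ), ∫⁻ t in Ioo (‖D‖ - τ) ‖D‖,
      ENNReal.ofReal (min |chordComp e V D x r v (q, t) - chordComp e V D x r v (q, s)| 1)
  have hJ : Measurable J := by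
    refine Measurable.lintegral_prod_right' (f := fun p : Euc n × ℝ => ∫⁻ t in Ioo (‖D‖ - τ) ‖D‖,
      ENNReal.ofReal (min |chordComp e V D x r v (p.1, t) - chordComp e V D x r v p| 1)) ?_
    refine Measurable.lintegral_prod_right' (f := fun p : (Euc n × ℝ) × ℝ =>
      ENNReal.ofReal (min |chordComp e V D x r v (p.1.1, p.2) - chordComp e V D x r v p.1| 1)) ?_
    fun_prop
  have hA := measurableSet_chordStart x D ρ₀
  change ∫⁻ q in chordStart x D ρ₀, J q ≤ _
  -- The starting points are sliced by hyperplanes orthogonal to `D`. At each level `s` the chords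
  -- are the curves of a single curvilinear projection; only levels in `(-r, r)` matter, whence the
  -- factor `2r`.
  rw [← lintegral_indicator hA, lintegral_eq_lintegral_orthogonal hξ x (hJ.indicator hA)]
  have hnorm : ∀ (s : ℝ) (y : (ℝ ∙ ξ)ᗮ), ‖s • ξ + (y : Euc n)‖ ^ 2 = s ^ 2 + ‖y‖ ^ 2 := by
    intro s y
    rw [@norm_add_sq_real, inner_smul_left, inner_orthogonal_singleton, norm_smul, hξ]
    simp
  have hsmall : ∀ (s : ℝ) (y : (ℝ ∙ ξ)ᗮ), x + s • ξ + y ∈ chordStart x D ρ₀ →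
      |s| < r ∧ ‖y‖ < r := by
    intro s y hq
    have h1 := h.chordStart_subset hρ₀ hq
    rw [mem_ball_iff_norm, show x + s • ξ + (y : Euc n) - x = s • ξ + y by abel] at h1
    have h2 := hnorm s y
    constructor
    · refine (abs_le_of_sq_le_sq ?_ (norm_nonneg _)).trans_lt h1
      rw [h2]; nlinarith [norm_nonneg y]
    · refine (abs_le_of_sq_le_sq ?_ (norm_nonneg _) |>.trans' (le_abs_self _)).trans_lt h1
      rw [h2]; nlinarith [sq_nonneg s]
  have hslice : ∀ᵐ s : ℝ, ∫⁻ y : (ℝ ∙ ξ)ᗮ, (chordStart x D ρ₀).indicator J (x + s • ξ + y) ≤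
      (Ioo (-r) r).indicator (fun _ => ENNReal.ofReal τ * (ENNReal.ofReal τ *
        (4 * 2 ^ (n - 1) * lam (ball x r)))) s := by
    filter_upwards [ae_ae_orthogonal hξ x (h.ae_ae_chord_eq hD hDr huv)] with s hs
    by_cases hsr : |s| < r
    · rw [indicator_of_mem (show s ∈ Ioo (-r) r from abs_lt.1 hsr)]
      obtain ⟨U, hU, hbv, hle⟩ := h.lintegral_truncatedVariation_le hD hDr hsr hu hΩ
      rw [← hξdef] at hbv hle hU
      refine le_trans ?_ (mul_le_mul_right (mul_le_mul_right hle _) _)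
      rw [← lintegral_const_mul' _ _ ENNReal.ofReal_ne_top,
        ← lintegral_const_mul' _ _ ENNReal.ofReal_ne_top]
      refine lintegral_mono_ae ?_
      filter_upwards [hs, hbv] with y hy hybv
      by_cases hq : x + s • ξ + (y : Euc n) ∈ chordStart x D ρ₀
      · rw [indicator_of_mem hq]
        have hyr := (hsmall s y hq).2
        have hq2 : x + s • ξ + (y : Euc n) ∈ ball x (2 * r) := add_mem_ball_two_mul hξ hsr hyr
        have ht3 : ∀ t ∈ Icc 0 ‖D‖, |t| < 3 * r := fun t ht => by
          rw [abs_of_nonneg ht.1]; linarith [ht.2]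
        have hsub : Icc 0 ‖D‖ ⊆ sliceSet (chordParam e V D x s) ξ r (3 * r) U y := by
          intro t ht
          refine ⟨hyr, ht3 t ht, hU ⟨⟨_, ⟨y, hyr, t, ht3 t ht, rfl⟩, rfl⟩, ?_⟩⟩
          change chordParam e V D x s ((y : Euc n) + t • (‖D‖⁻¹ • D)) ∈ ball x r
          rw [chordParam_add_smul hD]
          exact h.chord_mem_ball hD hDr hρ₀ hq ht
        refine le_trans (le_of_eq ?_) (lintegral_increment_le_truncatedVariation
          hybv.locallyIntegrable hsub hτD)
        have heq : ∀ᵐ t : ℝ, t ∈ Icc 0 ‖D‖ →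
            chordComp e V D x r v (x + s • ξ + (y : Euc n), t) =
              sliceFun (chordParam e V D x s) ξ u y t := by
          filter_upwards [hy] with t ht htD
          have h3 := ht3 t htD
          rw [chordComp, chordExt_of_mem hq2 h3, chordVelExt_of_mem hq2 h3, sliceFun,
            ← ht hq2 h3 (h.chord_mem_ball hD hDr hρ₀ hq htD)]
          simp only [hξdef]
          rw [chordParam_add_smul hD, velocity_chordParam hD, baseOf_add_smul
            (norm_inv_norm_smul hD), inner_add_smul_unit (norm_inv_norm_smul hD),
            inner_orthogonal_singleton, zero_add]
        change ∫⁻ s' in Ioo 0 (0 + τ), _ = _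
        refine lintegral_congr_ae ?_
        filter_upwards [ae_restrict_mem measurableSet_Ioo, ae_restrict_of_ae heq] with a ha haeq
        refine lintegral_congr_ae ?_
        filter_upwards [ae_restrict_mem measurableSet_Ioo, ae_restrict_of_ae heq] with b hb hbeq
        have hτ : 0 < τ := by linarith [ha.1.trans ha.2]
        rw [haeq ⟨ha.1.le, by linarith [ha.2]⟩, hbeq ⟨by linarith [hb.1], hb.2.le⟩]
      · rw [indicator_of_notMem hq]; exact zero_le
    · have h0 : ∀ y : (ℝ ∙ ξ)ᗮ, (chordStart x D ρ₀).indicator J (x + s • ξ + y) = 0 := fun y =>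
        indicator_of_notMem (fun hq => hsr (hsmall s y hq).1) _
      simp [h0]
  refine (lintegral_mono_ae hslice).trans ?_
  rw [lintegral_indicator measurableSet_Ioo, setLIntegral_const, Real.volume_Ioo, mul_comm]
  apply le_of_eq
  congr 2
  ring

/-- After exchanging integrals, some pair of times does no worse than the average. The same pair
serves all starting points, and the factors `τ` cancel, so the bound does not degenerate as `τ → 0`.
-/
theorem exists_increment_le (h : IsSmallScale F x R ε L e V r) (hD : D ≠ 0)
    (hDr : ‖D‖ ≤ 2 * r) (hu : IsGBDMeasure F Ω u lam) (hΩ : ball x r ⊆ Ω) (hv : Measurable v)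
    (huv : ∀ᵐ z ∂(volume.restrict (ball x r)), u z = v z) (hρ₀ : ρ₀ + 6 * ε * r ≤ r) {τ : ℝ}
    (hτ : 0 < τ) (hτD : 0 + τ < ‖D‖ - τ) :
    ∃ s ∈ Ioo 0 (0 + τ), ∃ t ∈ Ioo (‖D‖ - τ) ‖D‖, ∫⁻ q in chordStart x D ρ₀,
      ENNReal.ofReal (min |chordComp e V D x r v (q, t) - chordComp e V D x r v (q, s)| 1) ≤
      ENNReal.ofReal (2 * r) * (4 * 2 ^ (n - 1) * lam (ball x r)) := by
  have hcm := h.measurable_chordComp hD hDr hv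
  have key := h.lintegral_average_increment_le hD hDr hu hΩ hv huv hρ₀ hτD
  set B : Set (ℝ × ℝ) := Ioo 0 (0 + τ) ×ˢ Ioo (‖D‖ - τ) ‖D‖ with hB
  let g : Euc n → ℝ × ℝ → ℝ≥0∞ := fun q p =>
    ENNReal.ofReal (min |chordComp e V D x r v (q, p.2) - chordComp e V D x r v (q, p.1)| 1)
  have hg : Measurable (Function.uncurry g) := by
    change Measurable fun p : Euc n × ℝ × ℝ => ENNReal.ofReal
      (min |chordComp e V D x r v (p.1, p.2.2) - chordComp e V D x r v (p.1, p.2.1)| 1)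
    fun_prop
  have h1 : ∫⁻ q in chordStart x D ρ₀, ∫⁻ p in B, g q p ≤
      ENNReal.ofReal (2 * r) * (ENNReal.ofReal τ * (ENNReal.ofReal τ *
        (4 * 2 ^ (n - 1) * lam (ball x r)))) := by
    refine le_trans (le_of_eq ?_) key
    refine lintegral_congr fun q => ?_
    rw [hB, Measure.volume_eq_prod, setLIntegral_prod]
    exact (hg.comp measurable_prodMk_left).aemeasurable
  rw [lintegral_lintegral_swap hg.aemeasurable] at h1
  have hvol : volume B = ENNReal.ofReal τ * ENNReal.ofReal τ := by
    rw [hB, Measure.volume_eq_prod, Measure.prod_prod, Real.volume_Ioo, Real.volume_Ioo]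
    congr 2 <;> ring
  have hτ0 : ENNReal.ofReal τ ≠ 0 := (ENNReal.ofReal_pos.2 hτ).ne'
  obtain ⟨p, hp, hle⟩ := exists_le_setLAverage (μ := volume) (s := B)
    (f := fun p => ∫⁻ q in chordStart x D ρ₀, g q p)
    (by rw [hvol]; exact mul_ne_zero hτ0 hτ0)
    (by rw [hvol]; exact ENNReal.mul_ne_top ENNReal.ofReal_ne_top ENNReal.ofReal_ne_top)
    (Measurable.lintegral_prod_left' hg).aemeasurable
  refine ⟨p.1, hp.1, p.2, hp.2, hle.trans ?_⟩
  rw [setLAverage_eq, hvol]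
  refine ENNReal.div_le_of_le_mul (h1.trans (le_of_eq ?_))
  ring

/-- For fixed `t` the map from starting point to position on the chord enlarges volumes of preimages
by at most `2 ^ n`, so continuity in measure applies although `v` is merely measurable. -/
theorem tendsto_lintegral_chordComp (h : IsSmallScale F x R ε L e V r) (hD : D ≠ 0)
    (hDr : ‖D‖ ≤ 2 * r) (hv : Measurable v) (hρ₀ : ρ₀ + 6 * ε * r ≤ r) {t : ℕ → ℝ} {t' : ℝ}
    (ht : ∀ k, t k ∈ Icc 0 ‖D‖) (ht' : t' ∈ Icc 0 ‖D‖) (hlim : Tendsto t atTop (𝓝 t')) :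
    Tendsto (fun k => ∫⁻ q in chordStart x D ρ₀, ENNReal.ofReal
      (min |chordComp e V D x r v (q, t k) - chordComp e V D x r v (q, t')| 1)) atTop (𝓝 0) := by
  have hr := h.scale_pos
  have hA := measurableSet_chordStart x D ρ₀
  have hsub := h.chordStart_subset (D := D) hρ₀
  have hsub2 : chordStart x D ρ₀ ⊆ ball x (2 * r) := hsub.trans (ball_subset_ball (by linarith))
  have ht3 : ∀ s ∈ Icc 0 ‖D‖, |s| < 3 * r := fun s hs => by
    rw [abs_of_nonneg hs.1]; linarith [hs.2]
  have : IsFiniteMeasure (volume.restrict (chordStart x D ρ₀)) :=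
    ⟨by rw [Measure.restrict_apply_univ]; exact (measure_mono hsub).trans_lt measure_ball_lt_top⟩
  have : IsFiniteMeasure (volume.restrict (ball x r)) :=
    ⟨by rw [Measure.restrict_apply_univ]; exact measure_ball_lt_top⟩
  have hm : ∀ s : ℝ, Measurable fun q => chordExt e V D x r (q, s) := fun s =>
    (h.measurable_chordExt hD hDr).comp measurable_prodMk_right
  have hmv : ∀ s : ℝ, Measurable fun q => chordVelExt e V D x r (q, s) := fun s =>
    (h.measurable_chordVelExt hD hDr).comp measurable_prodMk_right
  have hmap : ∀ s ∈ Icc 0 ‖D‖,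
      (volume.restrict (chordStart x D ρ₀)).map (fun q => chordExt e V D x r (q, s)) ≤
        ((2 : ℝ≥0) ^ n) • volume.restrict (ball x r) := by
    intro s hs
    refine Measure.le_iff.2 fun N hN => ?_
    rw [Measure.map_apply (hm s) hN, Measure.restrict_apply (hm s hN), Measure.smul_apply,
      Measure.restrict_apply hN]
    have h1 := volume_inter_preimage_le (A := chordStart x D ρ₀) (N := N ∩ ball x r)
      (Φ := fun q => chordExt e V D x r (q, s)) (fun q hq q' hq' =>
        h.norm_chord_sub_chord_le_half hD hDr (ht3 s hs) (hsub2 hq) (hsub2 hq'))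
    refine (measure_mono ?_).trans (h1.trans (le_of_eq ?_))
    · intro q hq
      refine ⟨hq.2, hq.1, ?_⟩
      change chordExt e V D x r (q, s) ∈ ball x r
      rw [chordExt_of_mem (hsub2 hq.2) (ht3 s hs)]
      exact h.chord_mem_ball hD hDr hρ₀ hq.2 hs
    · rw [ENNReal.smul_def, smul_eq_mul, ENNReal.coe_pow]; rfl
  have hcont : ∀ (f : Euc n × ℝ → Euc n),
      ContinuousOn f (ball x (2 * r) ×ˢ Ioo (-(3 * r)) (3 * r)) →
      ∀ᵐ q ∂(volume.restrict (chordStart x D ρ₀)),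
        Tendsto (fun k => f (q, t k)) atTop (𝓝 (f (q, t'))) := by
    intro f hf
    filter_upwards [ae_restrict_mem hA] with q hq
    have h1 := hf (q, t') ⟨hsub2 hq, abs_lt.1 (ht3 t' ht')⟩
    refine h1.tendsto.comp (tendsto_nhdsWithin_iff.2 ⟨?_, ?_⟩)
    · exact (tendsto_const_nhds (x := q)).prodMk_nhds hlim
    · exact Eventually.of_forall fun k => ⟨hsub2 hq, abs_lt.1 (ht3 _ (ht k))⟩
  refine tendsto_lintegral_min_inner_comp (Φ := fun k q => chordExt e V D x r (q, t k))
    (Φ' := fun q => chordExt e V D x r (q, t')) (W := fun k q => chordVelExt e V D x r (q, t k))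
    (W' := fun q => chordVelExt e V D x r (q, t')) (ν := volume.restrict (ball x r)) hv
    (fun k => hm _) (hm _) (fun k => hmv _) (hmv _) (fun k => hmap _ (ht k)) (hmap _ ht')
    (hcont _ (h.continuousOn_chordExt hD hDr)) (hcont _ (h.continuousOn_chordVelExt hD hDr))
    (fun k => ?_)
  filter_upwards [ae_restrict_mem hA] with q hq
  rw [chordVelExt_of_mem (hsub2 hq) (ht3 _ (ht k))]
  exact h.norm_deriv_chord_le hD hDr (hsub2 hq) (ht3 _ (ht k))

/-- The increments between the ends of the chords with displacement `D` are bounded. -/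
theorem lintegral_increment_le (h : IsSmallScale F x R ε L e V r) (hD : D ≠ 0)
    (hDr : ‖D‖ ≤ 2 * r) (hu : IsGBDMeasure F Ω u lam) (hΩ : ball x r ⊆ Ω) (hv : Measurable v)
    (huv : ∀ᵐ z ∂(volume.restrict (ball x r)), u z = v z) (hρ₀ : ρ₀ + 6 * ε * r ≤ r) :
    ∫⁻ q in chordStart x D ρ₀, ENNReal.ofReal (min |⟪v (q + D), deriv (chord e V D q) ‖D‖⟫ -
      ⟪v q, deriv (chord e V D q) 0⟫| 1) ≤
      ENNReal.ofReal (2 * r) * (4 * 2 ^ (n - 1) * lam (ball x r)) := by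
  have hr := h.scale_pos
  have hD' : 0 < ‖D‖ := norm_pos_iff.2 hD
  have hcm := h.measurable_chordComp hD hDr hv
  have hA := measurableSet_chordStart x D ρ₀
  have hsub2 : chordStart x D ρ₀ ⊆ ball x (2 * r) :=
    (h.chordStart_subset hρ₀).trans (ball_subset_ball (by linarith))
  -- At most a third of `‖D‖`, so the time windows at the two ends stay disjoint.
  let τ : ℕ → ℝ := fun k => ‖D‖ * (1 / ((k : ℝ) + 3))
  have hτ0 : ∀ k, 0 < τ k := fun k => by positivity
  have hτ1 : ∀ k, 0 + τ k < ‖D‖ - τ k := by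
    intro k
    have h1 : (1 : ℝ) / (k + 3) ≤ 1 / 3 := by
      apply one_div_le_one_div_of_le <;> linarith [k.cast_nonneg (α := ℝ)]
    have : τ k ≤ ‖D‖ * (1 / 3) := by simp only [τ]; gcongr
    linarith
  have hτlim : Tendsto τ atTop (𝓝 0) := by
    have h1 : Tendsto (fun k : ℕ => (1 : ℝ) / ((k : ℝ) + 3)) atTop (𝓝 0) := by
      have := (tendsto_one_div_add_atTop_nhds_zero_nat (𝕜 := ℝ)).comp (tendsto_add_atTop_nat 2)
      refine this.congr fun k => ?_
      simp only [Function.comp_apply]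
      push_cast
      congr 1; ring
    have h2 := h1.const_mul ‖D‖; rw [mul_zero] at h2; exact h2
  -- Times converging to `0` and `‖D‖` at which the bound holds with a right-hand side independent
  -- of `k`.
  choose s hs t ht hst using fun k =>
    h.exists_increment_le hD hDr hu hΩ hv huv hρ₀ (hτ0 k) (hτ1 k)
  have hslim : Tendsto s atTop (𝓝 0) :=
    tendsto_of_tendsto_of_tendsto_of_le_of_le tendsto_const_nhds hτlim (fun k => (hs k).1.le)
      fun k => by have := (hs k).2; simp only [zero_add] at this; exact this.le
  have htlim : Tendsto t atTop (𝓝 ‖D‖) := by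
    refine tendsto_of_tendsto_of_tendsto_of_le_of_le (g := fun k => ‖D‖ - τ k) ?_
      tendsto_const_nhds (fun k => (ht k).1.le) fun k => (ht k).2.le
    simpa using (tendsto_const_nhds (x := ‖D‖)).sub hτlim
  have hl1 := h.tendsto_lintegral_chordComp hD hDr hv hρ₀ (t := s)
    (fun k => ⟨(hs k).1.le, by linarith [(hs k).2, hτ1 k, hτ0 k]⟩)
    (t' := 0) ⟨le_rfl, hD'.le⟩ hslim
  have hl2 := h.tendsto_lintegral_chordComp hD hDr hv hρ₀ (t := t)
    (fun k => ⟨by linarith [(ht k).1, hτ1 k, hτ0 k], (ht k).2.le⟩)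
    (t' := ‖D‖) ⟨hD'.le, le_rfl⟩ htlim
  set M := ENNReal.ofReal (2 * r) * (4 * 2 ^ (n - 1) * lam (ball x r)) with hM
  have hlim := (tendsto_const_nhds (x := M)).add (hl1.add hl2)
  rw [add_zero, add_zero] at hlim
  have hm : ∀ a : ℝ, Measurable fun q => chordComp e V D x r v (q, a) := fun a =>
    hcm.comp measurable_prodMk_right
  refine ge_of_tendsto' hlim fun k => ?_
  calc _ = ∫⁻ q in chordStart x D ρ₀, ENNReal.ofReal
        (min |chordComp e V D x r v (q, ‖D‖) - chordComp e V D x r v (q, 0)| 1) := by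
        refine setLIntegral_congr_fun hA fun q hq => ?_
        have hq2 := hsub2 hq
        have a1 : |(0 : ℝ)| < 3 * r := by rw [abs_zero]; positivity
        have a2 : |‖D‖| < 3 * r := by rw [abs_norm]; linarith
        simp only [chordComp]
        rw [chordExt_of_mem hq2 a1, chordExt_of_mem hq2 a2, chordVelExt_of_mem hq2 a1,
          chordVelExt_of_mem hq2 a2, h.chord_zero hq2, h.chord_norm hD hDr hq2]
    _ ≤ ∫⁻ q in chordStart x D ρ₀, (ENNReal.ofReal
          (min |chordComp e V D x r v (q, t k) - chordComp e V D x r v (q, s k)| 1) +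
          (ENNReal.ofReal (min |chordComp e V D x r v (q, s k) - chordComp e V D x r v (q, 0)| 1) +
          ENNReal.ofReal
            (min |chordComp e V D x r v (q, t k) - chordComp e V D x r v (q, ‖D‖)| 1))) := by
        refine lintegral_mono fun q => ?_
        rw [← ENNReal.ofReal_add (by positivity) (by positivity),
          ← ENNReal.ofReal_add (by positivity) (by positivity)]
        refine ENNReal.ofReal_le_ofReal ?_
        set a := chordComp e V D x r v (q, ‖D‖)
        set b := chordComp e V D x r v (q, 0)
        set c := chordComp e V D x r v (q, t k)
        set d := chordComp e V D x r v (q, s k)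
        have h1 : |a - b| ≤ |c - d| + |(d - b) - (c - a)| := by
          have : a - b = (c - d) + ((d - b) - (c - a)) := by ring
          rw [this]; exact abs_add_le _ _
        have h2 : |(d - b) - (c - a)| ≤ |d - b| + |c - a| := abs_sub _ _
        exact (min_abs_le_add (abs_nonneg _) (abs_nonneg _) h1).trans (add_le_add_right
          (min_abs_le_add (abs_nonneg _) (abs_nonneg _) h2) _)
    _ ≤ _ := by
        have m1 := hm (t k)
        have m2 := hm (s k)
        have m3 := hm 0
        rw [lintegral_add_left (by fun_prop), lintegral_add_left (by fun_prop)]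
        gcongr
        exact hst k

end IsSmallScale

end Chords

/-! ### Rescaled families of curves -/

section CurveFamily

variable {n : ℕ}

/-- A family of solutions of `γ'' = G(γ, γ')` on `[0, 1]` connecting the points of the unit ball,
with velocities close to those of the segments. -/
structure IsCurveFamily (G : Euc n → Euc n → Euc n) (κ : ℝ) (c c' : Euc n → Euc n → ℝ → Euc n) :
    Prop where
  source : ∀ p ∈ ball (0 : Euc n) 1, ∀ q ∈ ball (0 : Euc n) 1, c p q 0 = p
  target : ∀ p ∈ ball (0 : Euc n) 1, ∀ q ∈ ball (0 : Euc n) 1, c p q 1 = q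
  deriv : ∀ p ∈ ball (0 : Euc n) 1, ∀ q ∈ ball (0 : Euc n) 1, ∀ t ∈ Icc (0 : ℝ) 1,
    HasDerivAt (c p q) (c' p q t) t
  ode : ∀ p ∈ ball (0 : Euc n) 1, ∀ q ∈ ball (0 : Euc n) 1, ∀ t ∈ Icc (0 : ℝ) 1,
    HasDerivAt (c' p q) (G (c p q t) (c' p q t)) t
  approx : ∀ p ∈ ball (0 : Euc n) 1, ∀ q ∈ ball (0 : Euc n) 1, ∀ t ∈ Icc (0 : ℝ) 1,
    ‖c' p q t - (q - p)‖ ≤ κ * ‖q - p‖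
  continuousOn_velocity : ∀ t ∈ Icc (0 : ℝ) 1,
    ContinuousOn (fun p : Euc n × Euc n => c' p.1 p.2 t) (ball 0 1 ×ˢ ball 0 1)

/-- The increment of the component of `w` along the curve from `p` to `q`. -/
noncomputable def increment (w : Euc n → Euc n) (c' : Euc n → Euc n → ℝ → Euc n) (p q : Euc n) :
    ℝ := ⟪w q, c' p q 1⟫ - ⟪w p, c' p q 0⟫

theorem ofReal_min_mul_le {s a : ℝ} (hs2 : s ≤ 2) (ha : 0 ≤ a) :
    ENNReal.ofReal (min (s * a) 1) ≤ 2 * ENNReal.ofReal (min a 1) := by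
  have h1 : min (s * a) 1 ≤ 2 * min a 1 := by
    rcases le_total a 1 with h1 | h1
    · rw [min_eq_left h1]
      exact (min_le_left _ _).trans (by gcongr)
    · rw [min_eq_right h1]
      exact (min_le_right _ _).trans (by norm_num)
  refine (ENNReal.ofReal_le_ofReal h1).trans ?_
  rw [ENNReal.ofReal_mul zero_le_two, ENNReal.ofReal_ofNat]

theorem lintegral_comp_add_smul {r : ℝ} (hr : 0 < r) (x : Euc n) (f : Euc n → ℝ≥0∞) :
    ∫⁻ p, f (x + r • p) = ENNReal.ofReal ((r ^ n)⁻¹) * ∫⁻ q, f q := by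
  have h1 : ∫⁻ p, f (x + r • p) = ∫⁻ q, f (x + q) ∂(Measure.map (fun p : Euc n => r • p) volume) :=
    (lintegral_map_equiv (fun q => f (x + q))
      (Homeomorph.smulOfNeZero r hr.ne' : Euc n ≃ₜ Euc n).toMeasurableEquiv).symm
  rw [h1, Measure.map_addHaar_smul _ hr.ne', lintegral_smul_measure, lintegral_add_left_eq_self,
    finrank_euclideanSpace_fin, abs_of_pos (by positivity), smul_eq_mul]

/-- The curves of a geodesic chart at the scale `r`. -/
noncomputable def rescaledCurve (e V : Euc n × Euc n → Euc n) (x : Euc n) (r : ℝ)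
    (p q : Euc n) (t : ℝ) : Euc n :=
  r⁻¹ • (e (x + r • p, t • V (x + r • p, x + r • q)) - x)

/-- The velocities of the curves of a geodesic chart at the scale `r`. -/
noncomputable def rescaledVelocity (e V : Euc n × Euc n → Euc n) (x : Euc n) (r : ℝ)
    (p q : Euc n) (t : ℝ) : Euc n :=
  r⁻¹ • _root_.deriv (fun s : ℝ => e (x + r • p, s • V (x + r • p, x + r • q))) t

theorem add_smul_mem_ball {x p : Euc n} {r s : ℝ} (hr : 0 < r) :
    x + r • p ∈ ball x (r * s) ↔ p ∈ ball 0 s := by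
  rw [mem_ball_iff_norm, add_sub_cancel_left, norm_smul, Real.norm_eq_abs, abs_of_pos hr,
    mem_ball_zero_iff, mul_lt_mul_iff_right₀ hr]

variable {F : Euc n → Euc n → Euc n} {x : Euc n} {R ε L r : ℝ}
  {e V : Euc n × Euc n → Euc n} {Ω : Set (Euc n)} {u v : Euc n → Euc n} {lam : Measure (Euc n)}

namespace IsSmallScale

theorem rescaled_mem_ball (h : IsSmallScale F x R ε L e V r) {p : Euc n}
    (hp : p ∈ ball (0 : Euc n) 1) : x + r • p ∈ ball x r := by
  have := (add_smul_mem_ball (x := x) (s := 1) h.scale_pos).2 hp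
  rwa [mul_one] at this

theorem rescaled_mem_ball_radius (h : IsSmallScale F x R ε L e V r) {p : Euc n}
    (hp : p ∈ ball (0 : Euc n) 1) : x + r • p ∈ ball x R :=
  ball_subset_ball (by linarith [h.scale_le, h.scale_pos]) (h.rescaled_mem_ball hp)

theorem norm_log_le (h : IsSmallScale F x R ε L e V r) {p q : Euc n}
    (hp : p ∈ ball (0 : Euc n) 1) (hq : q ∈ ball (0 : Euc n) 1) :
    ‖V (x + r • p, x + r • q) - r • (q - p)‖ ≤ ε * (r * ‖q - p‖) ∧
      ‖V (x + r • p, x + r • q)‖ ≤ (1 + ε) * (r * ‖q - p‖) := by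
  have hr := h.scale_pos
  have h1 := h.chart.log_approx _ (h.rescaled_mem_ball_radius hp) _ (h.rescaled_mem_ball_radius hq)
  rw [add_sub_add_left_eq_sub, ← smul_sub, norm_smul, Real.norm_eq_abs, abs_of_pos hr] at h1
  refine ⟨h1, ?_⟩
  have h2 := norm_sub_norm_le (V (x + r • p, x + r • q)) (r • (q - p))
  rw [norm_smul, Real.norm_eq_abs, abs_of_pos hr] at h2
  linarith

theorem smul_log_mem (h : IsSmallScale F x R ε L e V r) {p q : Euc n}
    (hp : p ∈ ball (0 : Euc n) 1) (hq : q ∈ ball (0 : Euc n) 1) {t : ℝ} (ht : t ∈ Icc (0 : ℝ) 1) :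
    t • V (x + r • p, x + r • q) ∈ ball (0 : Euc n) R := by
  have hr := h.scale_pos
  rw [mem_ball_zero_iff, norm_smul, Real.norm_eq_abs, abs_of_nonneg ht.1]
  have h1 := (h.norm_log_le hp hq).2
  have h2 : ‖q - p‖ ≤ 2 := by
    have := norm_sub_le q p
    rw [mem_ball_zero_iff] at hp hq
    linarith
  have h3 := h.eps_le
  have h4 := h.scale_le
  have h5 : (1 + ε) * (r * ‖q - p‖) ≤ 2 * (r * 2) := by
    have := h.eps_nonneg
    gcongr
    linarith
  calc t * ‖V (x + r • p, x + r • q)‖ ≤ 1 * (2 * (r * 2)) := by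
        gcongr
        · exact ht.2
        · exact h1.trans h5
    _ < R := by linarith

theorem continuousOn_rescaledVelocity (h : IsSmallScale F x R ε L e V r) {t : ℝ}
    (ht : t ∈ Icc (0 : ℝ) 1) :
    ContinuousOn (fun p : Euc n × Euc n => rescaledVelocity e V x r p.1 p.2 t)
      (ball 0 1 ×ˢ ball 0 1) := by
  have hopen : IsOpen (ball ((x, 0) : Euc n × Euc n) R) := isOpen_ball
  have hV : ContinuousOn (fun p : Euc n × Euc n => V (x + r • p.1, x + r • p.2))
      (ball 0 1 ×ˢ ball 0 1) := by
    refine h.chart.log_smooth.continuousOn.comp (by fun_prop) fun p hp => ?_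
    exact mem_ball_prod.2 ⟨h.rescaled_mem_ball_radius hp.1, h.rescaled_mem_ball_radius hp.2⟩
  have hmem : ∀ p ∈ ball (0 : Euc n) 1 ×ˢ ball (0 : Euc n) 1,
      (x + r • p.1, t • V (x + r • p.1, x + r • p.2)) ∈ ball ((x, 0) : Euc n × Euc n) R :=
    fun p hp => mem_ball_prod.2 ⟨h.rescaled_mem_ball_radius hp.1, h.smul_log_mem hp.1 hp.2 ht⟩
  have hd := ((h.chart.exp_smooth.continuousOn_fderiv_of_isOpen hopen (by simp)).comp
    (f := fun p : Euc n × Euc n => (x + r • p.1, t • V (x + r • p.1, x + r • p.2)))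
    (ContinuousOn.prodMk (by fun_prop) (hV.const_smul t)) hmem).clm_apply
    ((continuousOn_const (c := (0 : Euc n))).prodMk hV)
  refine (hd.const_smul r⁻¹).congr fun p hp => ?_
  refine congrArg (fun y : Euc n => r⁻¹ • y) ?_
  have h1 := ((h.chart.exp_smooth.contDiffAt (hopen.mem_nhds (hmem p hp))).differentiableAt
    (by simp)).hasFDerivAt
  have h2 : HasDerivAt (fun s : ℝ => (x + r • p.1, s • V (x + r • p.1, x + r • p.2)))
      ((0 : Euc n), V (x + r • p.1, x + r • p.2)) t := by
    have h3 := (hasDerivAt_id t).smul_const (V (x + r • p.1, x + r • p.2))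
    rw [one_smul] at h3
    exact (hasDerivAt_const _ _).prodMk h3
  exact (h1.comp_hasDerivAt t h2).deriv

theorem isCurveFamily (h : IsSmallScale F x R ε L e V r)
    (hF : ContDiff ℝ ∞ fun p : Euc n × Euc n => F p.1 p.2) (hq : IsQuadraticField F) :
    IsCurveFamily (rescaledField F r x) (3 * ε) (rescaledCurve e V x r)
      (rescaledVelocity e V x r) where
  source p hp q hq := by
    have hr := h.scale_pos
    rw [rescaledCurve, zero_smul, h.chart.exp_zero _ (h.rescaled_mem_ball_radius hp),
      add_sub_cancel_left, smul_smul, inv_mul_cancel₀ hr.ne', one_smul]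
  target p hp q hq := by
    have hr := h.scale_pos
    rw [rescaledCurve, one_smul, h.chart.exp_log _ (h.rescaled_mem_ball_radius hp) _
      (h.rescaled_mem_ball_radius hq), add_sub_cancel_left, smul_smul, inv_mul_cancel₀ hr.ne',
      one_smul]
  deriv p hp q hq t ht :=
    ((h.chart.exp_deriv _ (h.rescaled_mem_ball_radius hp) _ t
      (h.smul_log_mem hp hq ht)).sub_const x).const_smul r⁻¹
  ode p hp q hq' t ht := by
    have hr := h.scale_pos
    have h1 := (h.chart.exp_ode _ (h.rescaled_mem_ball_radius hp) _ t
      (h.smul_log_mem hp hq' ht)).const_smul r⁻¹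
    refine h1.congr_deriv ?_
    -- Homogeneity of degree two turns `r F(·, r⁻¹ A)` into `r⁻¹ F(·, A)`, which is the acceleration
    -- of the rescaled curve.
    have hc : ∀ y, Continuous (F y) := fun y => hF.continuous.comp (Continuous.prodMk_right y)
    rw [rescaledField, rescaledVelocity, map_smul_of_parallelogram (hc _) (hq _), rescaledCurve,
      smul_smul r r⁻¹, mul_inv_cancel₀ hr.ne', one_smul, add_sub_cancel, smul_smul]
    congr 1
    field_simp
  approx p hp q hq t ht := by
    have hr := h.scale_pos
    have h1 := h.chart.norm_deriv_sub_le h.eps_nonneg (h.rescaled_mem_ball_radius hp)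
      (h.smul_log_mem hp hq ht)
    obtain ⟨h2, h3⟩ := h.norm_log_le hp hq
    set A := _root_.deriv (fun s : ℝ => e (x + r • p, s • V (x + r • p, x + r • q))) t with hA
    set W := V (x + r • p, x + r • q)
    have h4 : ‖A - r • (q - p)‖ ≤ 3 * ε * (r * ‖q - p‖) := by
      have h5 := norm_sub_le_norm_sub_add_norm_sub A W (r • (q - p))
      have h6 : ε * ‖W‖ ≤ ε * (2 * (r * ‖q - p‖)) := by
        have := h.eps_nonneg
        refine mul_le_mul_of_nonneg_left (h3.trans ?_) this
        gcongr
        linarith [h.eps_le]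
      linarith
    have h7 : rescaledVelocity e V x r p q t - (q - p) = r⁻¹ • (A - r • (q - p)) := by
      rw [smul_sub, smul_smul, inv_mul_cancel₀ hr.ne', one_smul, rescaledVelocity]
    rw [h7, norm_smul, norm_inv, Real.norm_eq_abs, abs_of_pos hr]
    calc r⁻¹ * ‖A - r • (q - p)‖ ≤ r⁻¹ * (3 * ε * (r * ‖q - p‖)) := by gcongr
      _ = 3 * ε * ‖q - p‖ := by field_simp
  continuousOn_velocity t ht := h.continuousOn_rescaledVelocity ht

/-- The same curve is run over `[0, 1]` and divided by `r` on the left, and run over `[0, r ‖d‖]` on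
the right; velocities therefore differ by the factor `‖d‖`. -/
theorem increment_eq (h : IsSmallScale F x R ε L e V r) {d : Euc n} (hd : d ≠ 0) (p : Euc n) :
    increment (fun z => v (x + r • z)) (rescaledVelocity e V x r) p (p + d) =
      ‖d‖ * (⟪v (x + r • p + r • d), deriv (chord e V (r • d) (x + r • p)) ‖r • d‖⟫ -
        ⟪v (x + r • p), deriv (chord e V (r • d) (x + r • p)) 0⟫) := by
  have hr := h.scale_pos
  have hd' := norm_pos_iff.2 hd
  have hD : ‖r • d‖ = r * ‖d‖ := by rw [norm_smul, Real.norm_eq_abs, abs_of_pos hr]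
  have h1 : ∀ t, deriv (chord e V (r • d) (x + r • p)) t = ‖r • d‖⁻¹ •
      deriv (fun s : ℝ => e (x + r • p, s • V (x + r • p, x + r • p + r • d)))
        (‖r • d‖⁻¹ * t) := by
    intro t
    rw [← deriv_comp_mul_left]
    congr 1
    funext s
    rw [chord, initVel, smul_smul, mul_comm s]
  have h2 : x + r • (p + d) = x + r • p + r • d := by rw [smul_add, add_assoc]
  have hne : ‖r • d‖ ≠ 0 := by rw [hD]; positivity
  rw [increment, rescaledVelocity, rescaledVelocity, h1, h1, mul_zero, inv_mul_cancel₀ hne, h2]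
  simp only [inner_smul_right]
  rw [hD]
  field_simp

/-- The rescaling contributes `r ^ (-n)` and the estimate on chords contributes `2r · 4 · 2 ^ (n -
1)`. The factor `‖d‖ ≤ 2` leaves the truncation at the price of another `2`, and the product is at
most `2 ^ (n + 4) r ^ (1 - n)`. -/
theorem lintegral_rescaled_increment_le (h : IsSmallScale F x R ε L e V r)
    (hF : ContDiff ℝ ∞ fun p : Euc n × Euc n => F p.1 p.2) (hq : IsQuadraticField F)
    (hu : IsGBDMeasure F Ω u lam) (hΩ : ball x r ⊆ Ω) (hv : Measurable v)
    (huv : ∀ᵐ z ∂(volume.restrict (ball x r)), u z = v z) {δ : ℝ} (hδ : 6 * ε ≤ δ) (hδ0 : 0 < δ)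
    {d : Euc n} (hd : ‖d‖ ≤ 2) :
    ∫⁻ p in chordStart 0 d (1 - δ), ENNReal.ofReal
      (min |increment (fun z => v (x + r • z)) (rescaledVelocity e V x r) p (p + d)| 1) ≤
      2 ^ (n + 4) * (ENNReal.ofReal (r ^ (1 - (n : ℤ))) * lam (ball x r)) := by
  have hr := h.scale_pos
  have hA := measurableSet_chordStart 0 d (1 - δ)
  -- Chords need a direction; for `d = 0` the velocity estimate makes the curve constant and the
  -- increment zero.
  by_cases hd0 : d = 0
  · rw [setLIntegral_congr_fun (g := fun _ => 0) hA, lintegral_zero]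
    · exact zero_le
    · intro p hp
      have hp1 : p ∈ ball (0 : Euc n) 1 := ball_subset_ball (by linarith) hp.1
      have h1 : ∀ t ∈ Icc (0 : ℝ) 1, rescaledVelocity e V x r p p t = 0 := fun t ht => by
        simpa using (h.isCurveFamily hF hq).approx p hp1 p hp1 t ht
      simp [increment, hd0, h1]
  have hD : r • d ≠ 0 := smul_ne_zero hr.ne' hd0
  have hDr : ‖r • d‖ ≤ 2 * r := by
    rw [norm_smul, Real.norm_eq_abs, abs_of_pos hr, mul_comm]; gcongr
  have key := h.lintegral_increment_le hD hDr hu hΩ hv huv (ρ₀ := r * (1 - δ)) (by nlinarith)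
  let f : Euc n → ℝ≥0∞ := fun q => ENNReal.ofReal
    (min |⟪v (q + r • d), deriv (chord e V (r • d) q) ‖r • d‖⟫ -
      ⟪v q, deriv (chord e V (r • d) q) 0⟫| 1)
  change ∫⁻ q in chordStart x (r • d) (r * (1 - δ)), f q ≤ _ at key
  have hmem : ∀ p, x + r • p ∈ chordStart x (r • d) (r * (1 - δ)) ↔
      p ∈ chordStart 0 d (1 - δ) := by
    intro p
    refine and_congr (add_smul_mem_ball hr) ?_
    rw [show x + r • p + r • d = x + r • (p + d) by rw [smul_add, add_assoc]]
    exact add_smul_mem_ball hr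
  calc _ ≤ ∫⁻ p in chordStart 0 d (1 - δ), 2 * f (x + r • p) := by
        refine lintegral_mono fun p => ?_
        rw [h.increment_eq hd0, abs_mul, abs_norm]
        exact ofReal_min_mul_le hd (abs_nonneg _)
    _ = 2 * ∫⁻ p in chordStart 0 d (1 - δ), f (x + r • p) :=
        lintegral_const_mul' _ _ (by simp)
    _ = 2 * (ENNReal.ofReal ((r ^ n)⁻¹) *
          ∫⁻ q in chordStart x (r • d) (r * (1 - δ)), f q) := by
        rw [← lintegral_indicator hA, ← lintegral_indicator (measurableSet_chordStart _ _ _),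
          ← lintegral_comp_add_smul hr x]
        congr 2
        funext p
        by_cases hp : p ∈ chordStart 0 d (1 - δ)
        · rw [indicator_of_mem hp, indicator_of_mem ((hmem p).2 hp)]
        · rw [indicator_of_notMem hp, indicator_of_notMem (fun h' => hp ((hmem p).1 h'))]
    _ ≤ 2 * (ENNReal.ofReal ((r ^ n)⁻¹) *
          (ENNReal.ofReal (2 * r) * (4 * 2 ^ (n - 1) * lam (ball x r)))) := by gcongr
    _ ≤ 2 * (ENNReal.ofReal ((r ^ n)⁻¹) *
          (ENNReal.ofReal (2 * r) * (4 * 2 ^ n * lam (ball x r)))) := by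
        gcongr
        · norm_num
        · omega
    _ = _ := by
        rw [zpow_sub₀ hr.ne', zpow_one, zpow_natCast, div_eq_mul_inv, ENNReal.ofReal_mul hr.le,
          ENNReal.ofReal_mul zero_le_two, ENNReal.ofReal_ofNat]
        ring

end IsSmallScale

end CurveFamily

/-! ### The curvilinear symmetric gradient along the curves -/

section SymGrad

variable {n : ℕ} {G : Euc n → Euc n → Euc n} {a w : Euc n → Euc n} {κ : ℝ}
  {c c' : Euc n → Euc n → ℝ → Euc n}

theorem sum_smul_stdVec (v : Euc n) : ∑ i, v i • (stdVec i : Euc n) = v := by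
  have h := (EuclideanSpace.basisFun (Fin n) ℝ).sum_repr v
  simpa [stdVec] using h

theorem inner_eq_sum_mul (v w : Euc n) : ⟪v, w⟫ = ∑ i, v i * w i := by
  rw [PiLp.inner_apply]
  exact Finset.sum_congr rfl fun i _ => by simp [mul_comm]

theorem sum_symGrad (a : Euc n → Euc n) (h v : Euc n) :
    ∑ i, ∑ j, symGrad a h i j * (v i * v j) = ⟪fderiv ℝ a h v, v⟫ := by
  have h1 : ∑ i, ∑ j, fderiv ℝ a h (stdVec i) j * (v i * v j) = ⟪fderiv ℝ a h v, v⟫ := by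
    conv_rhs => rw [← sum_smul_stdVec v, map_sum, sum_smul_stdVec, sum_inner]
    refine Finset.sum_congr rfl fun i _ => ?_
    rw [map_smul, inner_smul_left, inner_eq_sum_mul, Finset.mul_sum]
    refine Finset.sum_congr rfl fun j _ => ?_
    simp only [conj_trivial]
    ring
  have h2 : ∑ i, ∑ j, fderiv ℝ a h (stdVec j) i * (v i * v j) = ⟪fderiv ℝ a h v, v⟫ := by
    rw [← h1, Finset.sum_comm]
    exact Finset.sum_congr rfl fun i _ => Finset.sum_congr rfl fun j _ => by ring
  calc _ = (∑ i, ∑ j, fderiv ℝ a h (stdVec i) j * (v i * v j) +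
        ∑ i, ∑ j, fderiv ℝ a h (stdVec j) i * (v i * v j)) / 2 := by
        rw [← Finset.sum_add_distrib, Finset.sum_div]
        refine Finset.sum_congr rfl fun i _ => ?_
        rw [← Finset.sum_add_distrib, Finset.sum_div]
        refine Finset.sum_congr rfl fun j _ => ?_
        simp only [symGrad, Matrix.of_apply]
        ring
    _ = _ := by rw [h1, h2]; ring

/-- The polar form of `G h` is bilinear, so it expands in the standard basis; on the diagonal it is
`2 G h v`, which absorbs the `1/2` in `quadPolar`. -/
theorem sum_fieldTerm (hc : ∀ y, Continuous (G y)) (hG : IsQuadraticField G) (a : Euc n → Euc n)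
    (h v : Euc n) : ∑ i, ∑ j, fieldTerm G a h i j * (v i * v j) = ⟪a h, G h v⟫ := by
  let B : Euc n → Euc n → Euc n := fun v w => G h (v + w) - G h v - G h w
  have hcomm : ∀ v w, B v w = B w v := fun v w => by simp only [B]; rw [add_comm w v]; abel
  have hadd : ∀ x y z, B x (y + z) = B x y + B x z :=
    fun x y z => polar_add_of_parallelogram (hG h) x y z
  have hsmul : ∀ (s : ℝ) x y, B x (s • y) = s • B x y :=
    fun s x y => polar_smul_of_parallelogram (hc h) (hG h) s x y
  let T : Euc n →ₗ[ℝ] Euc n →ₗ[ℝ] Euc n := LinearMap.mk₂ ℝ B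
    (fun x y z => by rw [hcomm, hadd, hcomm z, hcomm z])
    (fun s x y => by rw [hcomm, hsmul, hcomm y]) hadd hsmul
  have hT : T v v = (2 : ℝ) • G h v := by
    change G h (v + v) - G h v - G h v = _
    rw [map_add_self_of_parallelogram (hG h)]
    module
  have h2 : T v v = ∑ i, ∑ j, (v i * v j) • B (stdVec i) (stdVec j) := by
    have h4 : ∀ w, T w v = ∑ j, v j • T w (stdVec j) := fun w => by
      conv_lhs => rw [← sum_smul_stdVec v]
      rw [map_sum]
      simp only [map_smul]
    have h5 : T v = ∑ i, v i • T (stdVec i) := by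
      conv_lhs => rw [← sum_smul_stdVec v]
      rw [map_sum]
      simp only [map_smul]
    rw [h5, LinearMap.sum_apply]
    refine Finset.sum_congr rfl fun i _ => ?_
    rw [LinearMap.smul_apply, h4, Finset.smul_sum]
    refine Finset.sum_congr rfl fun j _ => ?_
    rw [smul_smul]
    rfl
  have h3 : ⟪a h, G h v⟫ = 1 / 2 * ⟪a h, T v v⟫ := by
    rw [hT, inner_smul_right]; ring
  rw [h3, h2, inner_sum, Finset.mul_sum]
  refine Finset.sum_congr rfl fun i _ => ?_
  rw [inner_sum, Finset.mul_sum]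
  refine Finset.sum_congr rfl fun j _ => ?_
  rw [inner_smul_right, fieldTerm, Matrix.of_apply, quadPolar, inner_smul_left]
  simp only [conj_trivial, B]
  ring

/-- The right-hand side is the derivative of `a(γ) · γ'` along a solution of `γ'' = G(γ, γ')`
passing through `h` with velocity `v`. -/
theorem sum_curvSymGrad (hc : ∀ y, Continuous (G y)) (hG : IsQuadraticField G)
    (a : Euc n → Euc n) (h v : Euc n) :
    ∑ i, ∑ j, curvSymGrad G a h i j * (v i * v j) = ⟪fderiv ℝ a h v, v⟫ + ⟪a h, G h v⟫ := by
  rw [← sum_symGrad, ← sum_fieldTerm hc hG, ← Finset.sum_add_distrib]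
  refine Finset.sum_congr rfl fun i _ => ?_
  rw [← Finset.sum_add_distrib]
  refine Finset.sum_congr rfl fun j _ => ?_
  rw [curvSymGrad, Matrix.add_apply, add_mul]

theorem abs_quadraticForm_le (M : Matrix (Fin n) (Fin n) ℝ) (v : Euc n) :
    |∑ i, ∑ j, M i j * (v i * v j)| ≤ frobNorm M * ‖v‖ ^ 2 := by
  have h1 : ∑ i, ∑ j, (v i * v j) ^ 2 = (‖v‖ ^ 2) ^ 2 := by
    rw [EuclideanSpace.real_norm_sq_eq, sq (∑ i, v i ^ 2), Finset.sum_mul_sum]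
    exact Finset.sum_congr rfl fun i _ => Finset.sum_congr rfl fun j _ => by ring
  have h2 := Finset.sum_mul_sq_le_sq_mul_sq (Finset.univ : Finset (Fin n × Fin n))
    (fun p => M p.1 p.2) (fun p => v p.1 * v p.2)
  simp only [Fintype.sum_prod_type] at h2
  rw [h1] at h2
  refine abs_le_of_sq_le_sq ?_ (by unfold frobNorm; positivity)
  rw [mul_pow, frobNorm, Real.sq_sqrt (by positivity)]
  exact h2

theorem continuousOn_frobNorm_curvSymGrad {s : Set (Euc n)} (hs : IsOpen s)
    (hG : Continuous fun p : Euc n × Euc n => G p.1 p.2) (ha : ContDiffOn ℝ ∞ a s) :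
    ContinuousOn (fun h => frobNorm (curvSymGrad G a h)) s := by
  have h1 : ContinuousOn a s := ha.continuousOn
  have h2 : ContinuousOn (fderiv ℝ a) s := ha.continuousOn_fderiv_of_isOpen hs (by simp)
  have hGv : ∀ v, Continuous fun h => G h v := fun v => hG.comp (Continuous.prodMk_left v)
  have h3 : ∀ i j : Fin n, ContinuousOn (fun h => fderiv ℝ a h (stdVec i) j) s := fun i j =>
    (EuclideanSpace.proj (𝕜 := ℝ) j : Euc n →L[ℝ] ℝ).continuous.comp_continuousOn
      (h2.clm_apply continuousOn_const)
  refine Real.continuous_sqrt.comp_continuousOn ?_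
  refine continuousOn_finsetSum _ fun i _ => continuousOn_finsetSum _ fun j _ => ContinuousOn.pow ?_ 2
  change ContinuousOn (fun h => (fderiv ℝ a h (stdVec i) j + fderiv ℝ a h (stdVec j) i) / 2 +
    ⟪(1 / 2 : ℝ) • a h, G h (stdVec i + stdVec j) - G h (stdVec i) - G h (stdVec j)⟫) s
  refine (((h3 i j).add (h3 j i)).div_const 2).add (ContinuousOn.inner (𝕜 := ℝ) (h1.fun_const_smul _) ?_)
  exact (((hGv _).sub (hGv _)).sub (hGv _)).continuousOn

/-- The set where a continuous function exceeds its essential bound is open and null, hence empty. A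
pointwise bound is needed because it is used along single curves. -/
theorem le_of_eLpNorm_top_le {f : Euc n → ℝ} {s S : Set (Euc n)} {K : ℝ} (hs : IsOpen s)
    (hsS : s ⊆ S) (hf : ContinuousOn f s) (hK : 0 ≤ K)
    (h : eLpNorm f ∞ (volume.restrict S) ≤ ENNReal.ofReal K) {p : Euc n} (hp : p ∈ s) :
    f p ≤ K := by
  by_contra! hlt
  have hopen : IsOpen (s ∩ f ⁻¹' Ioi K) := hf.isOpen_inter_preimage hs isOpen_Ioi
  have hae : ∀ᵐ q ∂(volume.restrict s), ‖f q‖ₑ ≤ ENNReal.ofReal K := by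
    rw [eLpNorm_exponent_top] at h
    filter_upwards [ae_restrict_of_ae_restrict_of_subset hsS
      (enorm_ae_le_eLpNormEssSup f (volume.restrict S))] with q hq
    exact hq.trans h
  rw [ae_restrict_iff' hs.measurableSet] at hae
  have h0 : volume (s ∩ f ⁻¹' Ioi K) = 0 := by
    refine measure_mono_null (fun q hq => ?_) hae
    intro hq'
    have h2 := hq' hq.1
    rw [Real.enorm_eq_ofReal_abs, ENNReal.ofReal_le_ofReal_iff hK] at h2
    exact absurd hq.2 (not_lt.2 ((le_abs_self _).trans h2))
  rw [hopen.measure_eq_zero_iff (volume : Measure (Euc n))] at h0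
  exact (h0 ▸ (⟨hp, hlt⟩ : p ∈ s ∩ f ⁻¹' Ioi K) : p ∈ (∅ : Set (Euc n)))

namespace IsCurveFamily

theorem norm_curve_sub_le (h : IsCurveFamily G κ c c') {p q : Euc n}
    (hp : p ∈ ball (0 : Euc n) 1) (hq : q ∈ ball (0 : Euc n) 1) {t : ℝ} (ht : t ∈ Icc (0 : ℝ) 1) :
    ‖c p q t - (p + t • (q - p))‖ ≤ κ * ‖q - p‖ * t := by
  have h1 : ∀ s ∈ Icc (0 : ℝ) 1, HasDerivWithinAt (fun s => c p q s - s • (q - p))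
      (c' p q s - (q - p)) (Icc 0 1) s := by
    intro s hs
    have h2 := (hasDerivAt_id s).smul_const (q - p)
    rw [one_smul] at h2
    exact ((h.deriv p hp q hq s hs).sub h2).hasDerivWithinAt
  have h3 := (convex_Icc (0 : ℝ) 1).norm_image_sub_le_of_norm_hasDerivWithin_le h1
    (fun s hs => h.approx p hp q hq s hs) (left_mem_Icc.2 zero_le_one) ht
  simp only [zero_smul, sub_zero, Real.norm_eq_abs, abs_of_nonneg ht.1, h.source p hp q hq] at h3
  rwa [sub_right_comm, sub_sub] at h3

theorem norm_velocity_le (h : IsCurveFamily G κ c c') (hκ : κ ≤ 1) {p q : Euc n}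
    (hp : p ∈ ball (0 : Euc n) 1) (hq : q ∈ ball (0 : Euc n) 1) {t : ℝ} (ht : t ∈ Icc (0 : ℝ) 1) :
    ‖c' p q t‖ ≤ 4 := by
  have h1 := h.approx p hp q hq t ht
  have h2 := norm_sub_norm_le (c' p q t) (q - p)
  have h3 := norm_sub_le q p
  rw [mem_ball_zero_iff] at hp hq
  nlinarith [norm_nonneg (q - p)]

/-- The deviation from the segment is at most `(ρ / 4) t`, so the point at time `t` is a convex
combination, with weight `t`, of `p` and a point within `ρ / 4` of `q`, which lies in `ball 0 ρ`.
The linear decay in `t` is what saves the argument near a vertex `p`. -/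
theorem curve_mem_interior (h : IsCurveFamily G κ c c') {ρ : ℝ} (hκ : κ ≤ ρ / 8) {S : Set (Euc n)}
    (hS : Convex ℝ S) (hS1 : S ⊆ ball 0 1) (hρS : ball 0 ρ ⊆ interior S) {p q : Euc n}
    (hp : p ∈ S) (hq : q ∈ ball (0 : Euc n) (ρ / 2)) {t : ℝ} (ht : t ∈ Ioc (0 : ℝ) 1) :
    c p q t ∈ interior S := by
  have hρ : 0 < ρ / 2 := pos_of_mem_ball hq
  have hq1 : q ∈ ball (0 : Euc n) 1 :=
    hS1 (interior_subset (hρS (ball_subset_ball (by linarith) hq)))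
  have h1 := h.norm_curve_sub_le (hS1 hp) hq1 ⟨ht.1.le, ht.2⟩
  have h2 : ‖q - p‖ ≤ 2 := by
    have := norm_sub_le q p
    have h3 := hS1 hp
    rw [mem_ball_zero_iff] at h3 hq1
    linarith
  set d := c p q t - (p + t • (q - p)) with hd
  have h4 : ‖t⁻¹ • d‖ ≤ ρ / 4 := by
    rw [norm_smul, norm_inv, Real.norm_eq_abs, abs_of_pos ht.1, inv_mul_le_iff₀ ht.1, mul_comm]
    refine h1.trans (mul_le_mul_of_nonneg_right ?_ ht.1.le)
    nlinarith [norm_nonneg (q - p)]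
  have h5 : q + t⁻¹ • d ∈ ball (0 : Euc n) ρ := by
    rw [mem_ball_zero_iff] at hq ⊢
    linarith [norm_add_le q (t⁻¹ • d)]
  have h6 := hS.combo_self_interior_mem_interior hp (hρS h5) (sub_nonneg.2 ht.2) ht.1
    (sub_add_cancel 1 t)
  have h7 : (1 - t) • p + t • (q + t⁻¹ • d) = c p q t := by
    rw [smul_add, smul_smul, mul_inv_cancel₀ ht.1.ne', hd]
    module
  rwa [h7] at h6

/-- Along the curves, the increments of a smooth field are controlled by its curvilinear
symmetric gradient. -/
theorem abs_increment_le (h : IsCurveFamily G κ c c') (hc : ∀ y, Continuous (G y))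
    (hG : IsQuadraticField G) {ρ : ℝ} (hκ1 : κ ≤ 1) (hκ : κ ≤ ρ / 8) {S : Set (Euc n)}
    (hS : Convex ℝ S) (hS1 : S ⊆ ball 0 1) (hρS : ball 0 ρ ⊆ interior S)
    (ha : ContDiffOn ℝ ∞ a (ball 0 1)) {K : ℝ}
    (hK : ∀ z ∈ interior S, frobNorm (curvSymGrad G a z) ≤ K) {p q : Euc n}
    (hp : p ∈ S) (hq : q ∈ ball (0 : Euc n) (ρ / 2)) : |increment a c' p q| ≤ 16 * K := by
  have hρ : 0 < ρ / 2 := pos_of_mem_ball hq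
  have hq1 : q ∈ ball (0 : Euc n) 1 :=
    hS1 (interior_subset (hρS (ball_subset_ball (by linarith) hq)))
  have hp1 := hS1 hp
  have hmem : ∀ t ∈ Icc (0 : ℝ) 1, c p q t ∈ ball (0 : Euc n) 1 := by
    intro t ht
    rcases ht.1.eq_or_lt with h0 | h0
    · rw [← h0, h.source p hp1 q hq1]; exact hp1
    · exact hS1 (interior_subset (h.curve_mem_interior hκ hS hS1 hρS hp hq ⟨h0, ht.2⟩))
  have hder : ∀ t ∈ Icc (0 : ℝ) 1, HasDerivAt (fun t => ⟪a (c p q t), c' p q t⟫)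
      (⟪a (c p q t), G (c p q t) (c' p q t)⟫ +
        ⟪fderiv ℝ a (c p q t) (c' p q t), c' p q t⟫) t := by
    intro t ht
    have h1 := ((ha.contDiffAt (isOpen_ball.mem_nhds (hmem t ht))).differentiableAt
      (by simp)).hasFDerivAt.comp_hasDerivAt t (h.deriv p hp1 q hq1 t ht)
    exact h1.inner ℝ (h.ode p hp1 q hq1 t ht)
  -- By the mean value theorem the increment is the quadratic form of the curvilinear symmetric
  -- gradient at one velocity, whose norm is at most `4`; this gives the constant `16`.
  obtain ⟨t, ht, heq⟩ := exists_hasDerivAt_eq_slope (fun t => ⟪a (c p q t), c' p q t⟫) _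
    zero_lt_one (fun t ht => (hder t ht).continuousAt.continuousWithinAt)
    (fun t ht => hder t ⟨ht.1.le, ht.2.le⟩)
  rw [sub_zero, div_one, h.source p hp1 q hq1, h.target p hp1 q hq1, add_comm,
    ← sum_curvSymGrad hc hG] at heq
  rw [increment, ← heq]
  have h2 := h.norm_velocity_le hκ1 hp1 hq1 ⟨ht.1.le, ht.2.le⟩
  have h3 := hK _ (h.curve_mem_interior hκ hS hS1 hρS hp hq ⟨ht.1, ht.2.le⟩)
  refine (abs_quadraticForm_le _ _).trans ?_
  rw [mul_comm]
  have h0 : 0 ≤ frobNorm (curvSymGrad G a (c p q t)) := Real.sqrt_nonneg _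
  exact mul_le_mul (by nlinarith [norm_nonneg (c' p q t)]) h3 h0 (by norm_num)

/-- The components along the final velocities of the curves that start at the vertices of a
simplex control a vector. -/
theorem norm_le_sum_inner (h : IsCurveFamily G κ c c') {ρ : ℝ} (hρ : 0 < ρ) (hκ : κ ≤ ρ / 16)
    {ι : Type*} [Fintype ι] {p : ι → Euc n} (hS1 : convexHull ℝ (range p) ⊆ ball 0 1)
    (hρS : ball 0 ρ ⊆ convexHull ℝ (range p)) {q : Euc n} (hq : q ∈ ball (0 : Euc n) (ρ / 2))
    (y : Euc n) : ‖y‖ ≤ 8 / ρ * ∑ i, |⟪y, c' (p i) q 1⟫| := by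
  by_cases hy : y = 0
  · rw [hy, norm_zero]; positivity
  have hy' := norm_pos_iff.2 hy
  have hq1 : q ∈ ball (0 : Euc n) 1 := hS1 (hρS (ball_subset_ball (by linarith) hq))
  -- Moving `q` by `ρ / 4` against `y` does not leave the hull, so some vertex lies at least that
  -- far on this side of `q`.
  have hk : q - (ρ / 4) • ‖y‖⁻¹ • y ∈ convexHull ℝ (range p) := by
    refine hρS ?_
    rw [mem_ball_zero_iff] at hq ⊢
    have h1 := norm_sub_le q ((ρ / 4) • ‖y‖⁻¹ • y)
    rw [norm_smul, norm_smul, norm_inv, norm_norm, inv_mul_cancel₀ hy'.ne', Real.norm_eq_abs,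
      abs_of_pos (by positivity)] at h1
    linarith
  obtain ⟨i, hi⟩ : ∃ i, ρ / 4 * ‖y‖ ≤ ⟪y, q - p i⟫ := by
    by_contra! hcon
    have hsub : convexHull ℝ (range p) ⊆ {z | ⟪y, q⟫ - ρ / 4 * ‖y‖ < ⟪y, z⟫} := by
      refine convexHull_min ?_ (convex_halfSpace_gt (innerSL ℝ y).toLinearMap.isLinear _)
      rintro _ ⟨i, rfl⟩
      have := hcon i
      rw [inner_sub_right] at this
      change ⟪y, q⟫ - ρ / 4 * ‖y‖ < ⟪y, p i⟫
      linarith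
    have h1 : ⟪y, q⟫ - ρ / 4 * ‖y‖ < ⟪y, q - (ρ / 4) • ‖y‖⁻¹ • y⟫ := hsub hk
    rw [inner_sub_right, inner_smul_right, inner_smul_right, real_inner_self_eq_norm_sq] at h1
    have h2 : ρ / 4 * (‖y‖⁻¹ * ‖y‖ ^ 2) = ρ / 4 * ‖y‖ := by field_simp
    linarith
  have hp1 : p i ∈ ball (0 : Euc n) 1 := hS1 (subset_convexHull ℝ _ (mem_range_self i))
  have h3 := h.approx (p i) hp1 q hq1 1 (right_mem_Icc.2 zero_le_one)
  have h4 : ‖q - p i‖ ≤ 2 := by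
    have := norm_sub_le q (p i)
    rw [mem_ball_zero_iff] at hp1 hq1
    linarith
  -- Replacing `q - p i` by the arriving velocity loses at most `2κ ≤ ρ / 8`, half of the gain.
  have h5 : |⟪y, c' (p i) q 1 - (q - p i)⟫| ≤ ρ / 8 * ‖y‖ := by
    refine (abs_real_inner_le_norm _ _).trans ?_
    rw [mul_comm]
    gcongr
    nlinarith [norm_nonneg (q - p i)]
  rw [inner_sub_right] at h5
  have h6 : ρ / 8 * ‖y‖ ≤ |⟪y, c' (p i) q 1⟫| := by
    have := (abs_le.1 h5).1
    linarith [le_abs_self ⟪y, c' (p i) q 1⟫]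
  have h7 : |⟪y, c' (p i) q 1⟫| ≤ ∑ i, |⟪y, c' (p i) q 1⟫| :=
    Finset.single_le_sum (f := fun i => |⟪y, c' (p i) q 1⟫|) (fun _ _ => abs_nonneg _)
      (Finset.mem_univ i)
  calc ‖y‖ = 8 / ρ * (ρ / 8 * ‖y‖) := by field_simp
    _ ≤ _ := by gcongr; exact h6.trans h7

end IsCurveFamily

end SymGrad

/-! ### The choice of a base point -/

section Selection

variable {n : ℕ} {G : Euc n → Euc n → Euc n} {w : Euc n → Euc n} {κ δ ρ : ℝ}
  {c c' : Euc n → Euc n → ℝ → Euc n} {M : ℝ≥0∞}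

/-- The truncated increments between points of the unit ball. -/
noncomputable def cutIncrement (w : Euc n → Euc n) (c' : Euc n → Euc n → ℝ → Euc n) :
    Euc n × Euc n → ℝ≥0∞ :=
  (ball 0 1 ×ˢ ball 0 1).indicator fun p => ENNReal.ofReal (min |increment w c' p.1 p.2| 1)

theorem cutIncrement_of_mem {p q : Euc n} (hp : p ∈ ball (0 : Euc n) 1)
    (hq : q ∈ ball (0 : Euc n) 1) :
    cutIncrement w c' (p, q) = ENNReal.ofReal (min |increment w c' p q| 1) :=
  indicator_of_mem (mk_mem_prod hp hq) _

theorem IsCurveFamily.measurable_cutIncrement (h : IsCurveFamily G κ c c') (hw : Measurable w) :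
    Measurable (cutIncrement w c') := by
  classical
  have hB : MeasurableSet (ball (0 : Euc n) 1 ×ˢ ball (0 : Euc n) 1) :=
    measurableSet_ball.prod measurableSet_ball
  have hm : ∀ t ∈ Icc (0 : ℝ) 1, Measurable ((ball (0 : Euc n) 1 ×ˢ ball (0 : Euc n) 1).piecewise
      (fun p : Euc n × Euc n => c' p.1 p.2 t) 0) := fun t ht =>
    (h.continuousOn_velocity t ht).measurable_piecewise continuousOn_const hB
  have h0 := hm 0 (left_mem_Icc.2 zero_le_one)
  have h1 := hm 1 (right_mem_Icc.2 zero_le_one)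
  set v0 := (ball (0 : Euc n) 1 ×ˢ ball (0 : Euc n) 1).piecewise
      (fun p : Euc n × Euc n => c' p.1 p.2 0) 0 with hv0
  set v1 := (ball (0 : Euc n) 1 ×ˢ ball (0 : Euc n) 1).piecewise
      (fun p : Euc n × Euc n => c' p.1 p.2 1) 0 with hv1
  have heq : cutIncrement w c' = (ball 0 1 ×ˢ ball 0 1).indicator fun p : Euc n × Euc n =>
      ENNReal.ofReal (min |⟪w p.2, v1 p⟫ - ⟪w p.1, v0 p⟫| 1) := by
    refine indicator_congr fun p hp => ?_
    rw [hv0, hv1, piecewise_eq_of_mem _ _ _ hp, piecewise_eq_of_mem _ _ _ hp, increment]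
  rw [heq]
  have hin1 : Measurable fun p : Euc n × Euc n => ⟪w p.2, v1 p⟫ :=
    (hw.comp measurable_snd).inner h1
  have hin0 : Measurable fun p : Euc n × Euc n => ⟪w p.1, v0 p⟫ :=
    (hw.comp measurable_fst).inner h0
  refine Measurable.indicator ?_ hB
  fun_prop

/-- The increments with given displacements are bounded on average by `M`. -/
def HasIncrementBound (w : Euc n → Euc n) (c' : Euc n → Euc n → ℝ → Euc n) (δ : ℝ) (M : ℝ≥0∞) :
    Prop :=
  ∀ d : Euc n, ‖d‖ ≤ 2 →
    ∫⁻ p in chordStart 0 d (1 - δ), ENNReal.ofReal (min |increment w c' p (p + d)| 1) ≤ M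

theorem HasIncrementBound.lintegral_cutIncrement_le (h : HasIncrementBound w c' δ M) (hδ : 0 < δ)
    {d : Euc n} (hd : ‖d‖ ≤ 2) :
    ∫⁻ p in chordStart 0 d (1 - δ), cutIncrement w c' (p, p + d) ≤ M := by
  refine le_trans (le_of_eq ?_) (h d hd)
  refine setLIntegral_congr_fun (measurableSet_chordStart _ _ _) fun p hp => ?_
  have hsub : ball (0 : Euc n) (1 - δ) ⊆ ball 0 1 := ball_subset_ball (by linarith)
  exact cutIncrement_of_mem (hsub hp.1) (hsub hp.2)

/-- After translation by `a`, the pair starts at a free point with the fixed displacement `b - a`.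
-/
theorem HasIncrementBound.lintegral_pair_le (h : HasIncrementBound w c' δ M) (hδ : 0 < δ)
    {R : Set (Euc n)} (hR : MeasurableSet R) {a b : Euc n} (ha : ‖a‖ ≤ 1) (hb : ‖b‖ ≤ 1)
    (hRa : ∀ z ∈ R, z + a ∈ ball (0 : Euc n) (1 - δ))
    (hRb : ∀ z ∈ R, z + b ∈ ball (0 : Euc n) (1 - δ)) :
    ∫⁻ z in R, cutIncrement w c' (z + a, z + b) ≤ M := by
  have hd : ‖b - a‖ ≤ 2 := (norm_sub_le _ _).trans (by linarith)
  refine le_trans ?_ (h.lintegral_cutIncrement_le hδ hd)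
  rw [← lintegral_indicator hR, ← lintegral_indicator (measurableSet_chordStart _ _ _)]
  refine le_trans ?_ (lintegral_add_right_eq_self _ a).le
  refine lintegral_mono fun z => ?_
  by_cases hz : z ∈ R
  · have h1 : z + a + (b - a) = z + b := by abel
    have h2 : z + a ∈ chordStart 0 (b - a) (1 - δ) := ⟨hRa z hz, by rw [h1]; exact hRb z hz⟩
    rw [indicator_of_mem hz, indicator_of_mem h2, h1]
  · rw [indicator_of_notMem hz]; exact zero_le

/-- With `q = p + d` and the order of integration exchanged, the bound `M` holds for each
displacement, and displacements between points of the ball fill at most `ball 0 2`. -/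
theorem HasIncrementBound.lintegral_lintegral_le (h : HasIncrementBound w c' δ M) (hδ : 0 < δ)
    (hm : Measurable (cutIncrement w c')) {R S : Set (Euc n)} (hR : MeasurableSet R) {a : Euc n}
    (hRa : ∀ z ∈ R, z + a ∈ ball (0 : Euc n) (1 - δ)) (hS : S ⊆ ball 0 (1 - δ)) :
    ∫⁻ z in R, ∫⁻ q in S, cutIncrement w c' (z + a, q) ≤ M * volume (ball (0 : Euc n) 2) := by
  set B := ball (0 : Euc n) (1 - δ) with hB
  have hBm : MeasurableSet B := measurableSet_ball
  let f : Euc n → Euc n → ℝ≥0∞ := fun d p =>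
    (chordStart 0 d (1 - δ)).indicator (fun p => cutIncrement w c' (p, p + d)) p
  have hf : Measurable (Function.uncurry f) := by
    have h1 : Function.uncurry f = ({p : Euc n × Euc n | p.2 ∈ B ∧ p.2 + p.1 ∈ B}).indicator
        (fun p => cutIncrement w c' (p.2, p.2 + p.1)) := by
      funext p
      rfl
    rw [h1]
    refine Measurable.indicator (hm.comp (by fun_prop)) ?_
    exact (measurable_snd hBm).inter ((measurable_snd.add measurable_fst) hBm)
  calc ∫⁻ z in R, ∫⁻ q in S, cutIncrement w c' (z + a, q)
      ≤ ∫⁻ p, B.indicator (fun p => ∫⁻ q in B, cutIncrement w c' (p, q)) p := by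
        rw [← lintegral_indicator hR]
        refine le_trans ?_ (lintegral_add_right_eq_self _ a).le
        refine lintegral_mono fun z => ?_
        by_cases hz : z ∈ R
        · rw [indicator_of_mem hz, indicator_of_mem (hRa z hz)]
          exact lintegral_mono_set hS
        · rw [indicator_of_notMem hz]; exact zero_le
    _ = ∫⁻ p, ∫⁻ d, f d p := by
        refine lintegral_congr fun p => ?_
        by_cases hp : p ∈ B
        · rw [indicator_of_mem hp, ← lintegral_indicator hBm, ← lintegral_add_left_eq_self _ p]
          refine lintegral_congr fun d => ?_
          by_cases hd : p + d ∈ B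
          · rw [indicator_of_mem hd]
            exact (indicator_of_mem (show p ∈ chordStart 0 d (1 - δ) from ⟨hp, hd⟩)
              fun p => cutIncrement w c' (p, p + d)).symm
          · rw [indicator_of_notMem hd]
            exact (indicator_of_notMem (fun h' : p ∈ chordStart 0 d (1 - δ) => hd h'.2) _).symm
        · rw [indicator_of_notMem hp]
          symm
          rw [lintegral_congr (g := fun _ => 0), lintegral_zero]
          intro d
          exact indicator_of_notMem (fun h' : p ∈ chordStart 0 d (1 - δ) => hp h'.1) _
    _ = ∫⁻ d, ∫⁻ p, f d p := (lintegral_lintegral_swap hf.aemeasurable).symm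
    _ ≤ ∫⁻ d, (ball (0 : Euc n) 2).indicator (fun _ => M) d := by
        refine lintegral_mono fun d => ?_
        by_cases hd : d ∈ ball (0 : Euc n) 2
        · rw [indicator_of_mem hd]
          change ∫⁻ p, (chordStart 0 d (1 - δ)).indicator _ p ≤ M
          rw [lintegral_indicator (measurableSet_chordStart _ _ _)]
          exact h.lintegral_cutIncrement_le hδ (mem_ball_zero_iff.1 hd).le
        · rw [indicator_of_notMem hd, nonpos_iff_eq_zero, lintegral_congr (g := fun _ => 0),
            lintegral_zero]
          intro p
          refine indicator_of_notMem (fun h' : p ∈ chordStart 0 d (1 - δ) => hd ?_) _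
          have h1 := mem_ball_zero_iff.1 h'.1
          have h2 := mem_ball_zero_iff.1 h'.2
          have h3 := norm_sub_le (p + d) p
          rw [add_sub_cancel_left] at h3
          rw [mem_ball_zero_iff]
          linarith
    _ = M * volume (ball (0 : Euc n) 2) := by
        rw [lintegral_indicator measurableSet_ball, setLIntegral_const]

theorem simplexVertex_eq (z : Euc n) (i : Fin (n + 1)) :
    simplexVertex z i = z + simplexVertex 0 i := by
  simp only [simplexVertex, zero_add]

theorem norm_simplexVertex_zero_le (i : Fin (n + 1)) : ‖simplexVertex (0 : Euc n) i‖ ≤ 1 := by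
  rw [simplexVertex, zero_add]
  refine Fin.cases ?_ (fun j => ?_) i
  · simp
  · simp [stdVec]

theorem one_le_norm_simplexVertex_sub (z : Euc n) {i j : Fin (n + 1)} (hij : i < j) :
    1 ≤ ‖simplexVertex z j - simplexVertex z i‖ := by
  obtain ⟨k, rfl⟩ := Fin.exists_succ_eq.2 (Fin.ne_zero_of_lt hij)
  have h1 : (simplexVertex z k.succ - simplexVertex z i) k = 1 := by
    rw [simplexVertex, simplexVertex, add_sub_add_left_eq_sub]
    induction i using Fin.cases with
    | zero => simp [stdVec]
    | succ l =>
      have hlk : l ≠ k := fun h => by simp [h] at hij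
      simp [stdVec, hlk.symm]
  have h2 := PiLp.norm_apply_le (simplexVertex z k.succ - simplexVertex z i) k
  rw [h1] at h2
  simpa using h2

/-- The base points whose simplex has its vertices away from the unit sphere. -/
def innerBase (n : ℕ) (ρ δ : ℝ) : Set (Euc n) :=
  {z | z ∈ goodBase n ρ ∧ ∀ i, simplexVertex z i ∈ ball (0 : Euc n) (1 - δ)}

/-- The finitely many vertices of an admissible simplex lie in the open unit ball, so the sets with
margins `1 / (k + 2)` exhaust `goodBase n ρ`. A margin is needed because increments are controlled
only in `ball 0 (1 - δ)`. -/
theorem exists_innerBase_pos (h : 0 < volume (goodBase n ρ)) :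
    ∃ δ : ℝ, 0 < δ ∧ δ ≤ 1 / 2 ∧ 0 < volume (innerBase n ρ δ) := by
  by_contra! hcon
  refine h.ne' ?_
  have h1 : goodBase n ρ ⊆ ⋃ k : ℕ, innerBase n ρ (1 / ((k : ℝ) + 2)) := by
    intro z hz
    have h2 : ∀ i, ‖simplexVertex z i‖ < 1 := fun i =>
      mem_ball_zero_iff.1 (hz.2.2 (subset_convexHull ℝ _ (mem_range_self i)))
    obtain ⟨s, hs, hs1⟩ : ∃ s < (1 : ℝ), ∀ i, ‖simplexVertex z i‖ ≤ s := by
      obtain ⟨i₀, -, hi₀⟩ := Finset.exists_max_image (Finset.univ : Finset (Fin (n + 1)))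
        (fun i => ‖simplexVertex z i‖) Finset.univ_nonempty
      exact ⟨_, h2 i₀, fun i => hi₀ i (Finset.mem_univ i)⟩
    obtain ⟨k, hk⟩ := exists_nat_one_div_lt (sub_pos.2 hs)
    refine mem_iUnion.2 ⟨k, hz, fun i => ?_⟩
    rw [mem_ball_zero_iff]
    have h3 : (1 : ℝ) / ((k : ℝ) + 2) ≤ 1 / ((k : ℝ) + 1) := by
      apply one_div_le_one_div_of_le <;> [positivity; linarith]
    linarith [hs1 i]
  refine measure_mono_null h1 (measure_iUnion_null fun k => ?_)
  refine nonpos_iff_eq_zero.1 (hcon _ (by positivity) ?_)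
  apply one_div_le_one_div_of_le <;> [norm_num; linarith [(Nat.cast_nonneg k : (0 : ℝ) ≤ k)]]

/-- The sum of the increments along the edges of the simplex and of the averages of the increments
between the vertices and the points of a ball. -/
noncomputable def baseCost (w : Euc n → Euc n) (c' : Euc n → Euc n → ℝ → Euc n) (ρ : ℝ)
    (z : Euc n) : ℝ≥0∞ :=
  (∑ i, ∑ j, cutIncrement w c' (simplexVertex z i, simplexVertex z j)) +
    ∑ i, ∫⁻ q in ball (0 : Euc n) (ρ / 2), cutIncrement w c' (simplexVertex z i, q)

theorem exists_baseCost_le (h : IsCurveFamily G κ c c') (hw : Measurable w)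
    (hM : HasIncrementBound w c' δ M) (hδ : 0 < δ) (hδ2 : δ ≤ 1 / 2) (hρ : ρ ≤ 1)
    (hpos : 0 < volume (innerBase n ρ δ)) :
    ∃ z ∈ innerBase n ρ δ, baseCost w c' ρ z ≤ ((n + 1) * (n + 1) * M +
      (n + 1) * (M * volume (ball (0 : Euc n) 2))) / volume (innerBase n ρ δ) := by
  have hm := h.measurable_cutIncrement hw
  have hmv : ∀ i, Measurable fun z : Euc n => simplexVertex z i := fun i => by
    have h1 : (fun z : Euc n => simplexVertex z i) = fun z => z + simplexVertex 0 i :=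
      funext fun z => simplexVertex_eq z i
    rw [h1]
    exact measurable_id.add_const _
  have hm1 : ∀ i j, Measurable fun z : Euc n =>
      cutIncrement w c' (simplexVertex z i, simplexVertex z j) := fun i j =>
    hm.comp ((hmv i).prodMk (hmv j))
  have hm2 : ∀ i, Measurable fun z : Euc n => ∫⁻ q in ball (0 : Euc n) (ρ / 2),
      cutIncrement w c' (simplexVertex z i, q) := fun i =>
    Measurable.lintegral_prod_right' (f := fun p : Euc n × Euc n =>
      cutIncrement w c' (simplexVertex p.1 i, p.2))
      (hm.comp (((hmv i).comp measurable_fst).prodMk measurable_snd))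
  have hsum1 : Measurable fun z : Euc n =>
      ∑ i, ∑ j, cutIncrement w c' (simplexVertex z i, simplexVertex z j) :=
    Finset.measurable_sum _ fun i _ => Finset.measurable_sum _ fun j _ => hm1 i j
  have hcost : Measurable (baseCost w c' ρ) :=
    hsum1.add (Finset.measurable_sum _ fun i _ => hm2 i)
  -- Only the condition on the vertices is kept: this superset is measurable, and the integral
  -- estimates need nothing more.
  set R : Set (Euc n) := {z | ∀ i, simplexVertex z i ∈ ball (0 : Euc n) (1 - δ)} with hR
  have hRm : MeasurableSet R := by
    have h1 : R = ⋂ i, (fun z => simplexVertex z i) ⁻¹' ball (0 : Euc n) (1 - δ) := by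
      ext z; simp [hR]
    rw [h1]
    exact MeasurableSet.iInter fun i => hmv i measurableSet_ball
  have hsub : innerBase n ρ δ ⊆ R := fun z hz => hz.2
  have htop : volume (innerBase n ρ δ) ≠ ⊤ :=
    ((measure_mono fun z (hz : z ∈ innerBase n ρ δ) => hz.1.1).trans_lt (measure_ball_lt_top (x := (0 : Euc n)))).ne
  obtain ⟨z, hz, hle⟩ := exists_le_setLAverage hpos.ne' htop hcost.aemeasurable
  refine ⟨z, hz, hle.trans ?_⟩
  rw [setLAverage_eq]
  refine ENNReal.div_le_div_right ((lintegral_mono_set hsub).trans ?_) _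
  have hRv : ∀ i, ∀ z ∈ R, z + simplexVertex 0 i ∈ ball (0 : Euc n) (1 - δ) := fun i z hz => by
    rw [← simplexVertex_eq]; exact hz i
  unfold baseCost
  rw [lintegral_add_left hsum1, lintegral_finsetSum _ fun i _ => hm2 i,
    lintegral_finsetSum _ fun i _ => Finset.measurable_sum _ fun j _ => hm1 i j]
  gcongr
  · calc _ ≤ ∑ i : Fin (n + 1), ∑ j : Fin (n + 1), M := by
          refine Finset.sum_le_sum fun i _ => ?_
          rw [lintegral_finsetSum _ fun j _ => hm1 i j]
          refine Finset.sum_le_sum fun j _ => ?_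
          refine le_trans (le_of_eq (lintegral_congr fun z => ?_)) (hM.lintegral_pair_le hδ hRm
            (norm_simplexVertex_zero_le i) (norm_simplexVertex_zero_le j) (hRv i) (hRv j))
          rw [← simplexVertex_eq, ← simplexVertex_eq]
      _ = _ := by simp [mul_assoc]
  · calc _ ≤ ∑ i : Fin (n + 1), M * volume (ball (0 : Euc n) 2) := by
          refine Finset.sum_le_sum fun i _ => ?_
          refine le_trans (le_of_eq (lintegral_congr fun z => ?_))
            (hM.lintegral_lintegral_le hδ hm hRm (hRv i)
              (S := ball 0 (ρ / 2)) (ball_subset_ball (by linarith)))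
          rw [← simplexVertex_eq]
      _ = _ := by simp

end Selection

/-! ### The approximating field -/

section Field

variable {n : ℕ} {G : Euc n → Euc n → Euc n} {w : Euc n → Euc n} {κ ρ C : ℝ}
  {c c' : Euc n → Euc n → ℝ → Euc n}

/-- Either no `b i` is truncated, or one of them exceeds `1` and the right-hand side is already at
least `k ≥ 1`. -/
theorem min_one_le_of_le_sum {ι : Type*} [Fintype ι] {y k K : ℝ} {b : ι → ℝ} (hk : 1 ≤ k)
    (hK : 0 ≤ K) (hb : ∀ i, 0 ≤ b i) (h : y ≤ k * ∑ i, (b i + K)) :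
    min y 1 ≤ k * ∑ i, (min (b i) 1 + K) := by
  have hk0 : 0 ≤ k := zero_le_one.trans hk
  by_cases hall : ∀ i, b i ≤ 1
  · refine (min_le_left _ _).trans (h.trans (le_of_eq ?_))
    exact congrArg _ (Finset.sum_congr rfl fun i _ => by rw [min_eq_left (hall i)])
  · push Not at hall
    obtain ⟨i, hi⟩ := hall
    have h0 : ∀ j ∈ Finset.univ, 0 ≤ min (b j) 1 + K := fun j _ =>
      add_nonneg (le_min (hb j) zero_le_one) hK
    have h1 := Finset.single_le_sum h0 (Finset.mem_univ i)
    rw [min_eq_right hi.le] at h1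
    refine (min_le_right _ _).trans ?_
    nlinarith

/-- The unit-speed reparametrization of a curve of the family is a connection. -/
theorem IsCurveFamily.isConnection (h : IsCurveFamily G κ c c') (hc : ∀ y, Continuous (G y))
    (hG : IsQuadraticField G) (hκ : κ ≤ 1 / 2) {p q : Euc n} (hp : p ∈ ball (0 : Euc n) 1)
    (hq : q ∈ ball (0 : Euc n) 1) (hpq : p ≠ q) :
    IsConnection G p q (‖c' p q 0‖⁻¹ • c' p q 0) (‖c' p q 0‖⁻¹ • c' p q 1) := by
  have hd : 0 < ‖q - p‖ := norm_pos_iff.2 (sub_ne_zero.2 hpq.symm)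
  have h1 := h.approx p hp q hq 0 (left_mem_Icc.2 zero_le_one)
  have h2 := norm_sub_norm_le (q - p) (c' p q 0)
  have h3 := norm_sub_norm_le (c' p q 0) (q - p)
  rw [norm_sub_rev (q - p) (c' p q 0)] at h2
  have h4 : ‖q - p‖ < 2 := by
    have := norm_sub_le q p
    rw [mem_ball_zero_iff] at hp hq
    linarith
  set T := ‖c' p q 0‖ with hT
  have hT0 : 0 < T := by nlinarith
  have hmem : ∀ t ∈ Icc 0 T, T⁻¹ * t ∈ Icc (0 : ℝ) 1 := fun t ht =>
    ⟨mul_nonneg (inv_nonneg.2 hT0.le) ht.1, by rw [inv_mul_le_iff₀ hT0, mul_one]; exact ht.2⟩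
  have hlin : ∀ t, HasDerivAt (fun t => T⁻¹ * t) T⁻¹ t := fun t => by
    simpa using (hasDerivAt_id t).const_mul T⁻¹
  refine ⟨T, fun t => c p q (T⁻¹ * t), fun t => T⁻¹ • c' p q (T⁻¹ * t), hT0, by nlinarith,
    fun t ht => ?_, fun t ht => ?_, ?_, ?_, ?_, ?_, ?_⟩
  · exact ((h.deriv p hp q hq _ (hmem t ht)).scomp t (hlin t)).hasDerivWithinAt
  · have h5 := (((h.ode p hp q hq _ (hmem t ht)).scomp t (hlin t)).const_smul T⁻¹)
    refine (h5.congr_deriv ?_).hasDerivWithinAt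
    rw [map_smul_of_parallelogram (hc _) (hG _), smul_smul, sq]
  · simp only [mul_zero]; exact h.source p hp q hq
  · simp only [inv_mul_cancel₀ hT0.ne']; exact h.target p hp q hq
  · simp only [mul_zero]
  · simp only [inv_mul_cancel₀ hT0.ne']
  · rw [norm_smul, norm_inv, Real.norm_eq_abs, abs_of_pos hT0]
    exact inv_mul_cancel₀ hT0.ne'

/-- The unit initial and final velocities of the curves along the edges of a simplex. -/
noncomputable def edgeVelocity (c' : Euc n → Euc n → ℝ → Euc n) (p : Fin (n + 1) → Euc n)
    (i j : Fin (n + 1)) : Euc n :=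
  if i < j then ‖c' (p i) (p j) 0‖⁻¹ • c' (p i) (p j) 0
  else ‖c' (p j) (p i) 0‖⁻¹ • c' (p j) (p i) 1

/-- Both end velocities are divided by the same initial speed, so each term is an increment over
that speed. The speed is at least `1/2`, since edges have length at least `1` and `κ ≤ 1/2`. -/
theorem IsCurveFamily.edgeSeminorm_le (h : IsCurveFamily G κ c c') (hκ : κ ≤ 1 / 2) {z : Euc n}
    (hz : ∀ i, simplexVertex z i ∈ ball (0 : Euc n) 1) :
    edgeSeminorm (edgeVelocity c' (simplexVertex z)) (fun i => w (simplexVertex z i)) ≤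
      2 * ∑ i, ∑ j, |increment w c' (simplexVertex z i) (simplexVertex z j)| := by
  rw [edgeSeminorm, Finset.mul_sum]
  refine Finset.sum_le_sum fun i _ => ?_
  rw [Finset.mul_sum]
  refine Finset.sum_le_sum fun j _ => ?_
  split_ifs with hij
  · rw [edgeVelocity, edgeVelocity, if_pos hij, if_neg hij.not_gt, inner_smul_right,
      inner_smul_right, ← mul_sub]
    change |_ * increment w c' (simplexVertex z i) (simplexVertex z j)| ≤ _
    rw [abs_mul, abs_inv, abs_norm]
    refine mul_le_mul_of_nonneg_right ?_ (abs_nonneg _)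
    have h1 := h.approx _ (hz i) _ (hz j) 0 (left_mem_Icc.2 zero_le_one)
    have h2 := norm_sub_norm_le (simplexVertex z j - simplexVertex z i)
      (c' (simplexVertex z i) (simplexVertex z j) 0)
    rw [norm_sub_rev (simplexVertex z j - simplexVertex z i) (c' _ _ 0)] at h2
    have h3 := one_le_norm_simplexVertex_sub z hij
    rw [show (2 : ℝ) = (1 / 2)⁻¹ by norm_num]
    apply inv_anti₀ (by norm_num)
    nlinarith
  · positivity

/-- (RI) is fed with the values of `w` at the vertices. A cost below `1` is indispensable: (RI) sees
the true edge increments, while only truncated ones are controlled. -/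
theorem exists_field_of_baseCost_lt_one (h : IsCurveFamily G κ c c')
    (hGc : Continuous fun p : Euc n × Euc n => G p.1 p.2) (hG : IsQuadraticField G)
    (hw : Measurable w) (hρ : 0 < ρ) (hρ1 : ρ ≤ 1) (hκ : κ ≤ ρ / 16) (hC : 0 < C) {z : Euc n}
    (hz : z ∈ goodBase n ρ)
    (hRI : ∀ ξ : Fin (n + 1) → Fin (n + 1) → Euc n,
      (∀ i j, i < j → IsConnection G (simplexVertex z i) (simplexVertex z j) (ξ i j) (ξ j i)) →
      ∃ a : Euc n → Euc n, ContDiffOn ℝ ∞ a (ball 0 1) ∧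
        (∀ i, a (simplexVertex z i) = w (simplexVertex z i)) ∧
        eLpNorm (fun h => frobNorm (curvSymGrad G a h)) ∞ (volume.restrict (simplexHull z)) ≤
          ENNReal.ofReal (C * edgeSeminorm ξ fun i => w (simplexVertex z i)))
    (hcost : baseCost w c' ρ z < 1) :
    ∃ a : Euc n → Euc n, ContDiffOn ℝ ∞ a (ball 0 1) ∧
      eLpNorm (fun h => frobNorm (curvSymGrad G a h)) ∞ (volume.restrict (ball 0 (ρ / 2))) ≤
        ENNReal.ofReal (2 * C) * baseCost w c' ρ z ∧
      ∫⁻ q in ball (0 : Euc n) (ρ / 2), ENNReal.ofReal (min ‖w q - a q‖ 1) ≤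
        ENNReal.ofReal (8 / ρ) * (1 + (n + 1) * (ENNReal.ofReal (32 * C) *
          volume (ball (0 : Euc n) 1))) * baseCost w c' ρ z := by
  have hc : ∀ y, Continuous (G y) := fun y => hGc.comp (Continuous.prodMk_right y)
  have hm := h.measurable_cutIncrement hw
  obtain ⟨-, hρS, hS1⟩ := hz
  have hS : Convex ℝ (simplexHull z) := convex_convexHull ℝ _
  have hpS : ∀ i, simplexVertex z i ∈ simplexHull z := fun i =>
    subset_convexHull ℝ _ (mem_range_self i)
  have hp1 : ∀ i, simplexVertex z i ∈ ball (0 : Euc n) 1 := fun i => hS1 (hpS i)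
  set p := simplexVertex z with hp
  obtain ⟨a, ha, hap, hbd⟩ := hRI (edgeVelocity c' p) (by
    intro i j hij
    have h1 := one_le_norm_simplexVertex_sub z hij
    have hne : p i ≠ p j := by
      intro heq
      rw [← hp, heq, sub_self, norm_zero] at h1
      linarith
    have h2 := h.isConnection hc hG (by linarith) (hp1 i) (hp1 j) hne
    rw [edgeVelocity, edgeVelocity, if_pos hij, if_neg hij.not_gt]
    exact h2)
  set E := edgeSeminorm (edgeVelocity c' p) (fun i => w (p i)) with hE
  have hE0 : 0 ≤ E := by
    rw [hE, edgeSeminorm]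
    refine Finset.sum_nonneg fun i _ => Finset.sum_nonneg fun j _ => ?_
    split_ifs <;> positivity
  -- Each edge term is at most the total cost, hence smaller than `1`, so its truncation is
  -- inactive.
  have hcut : ∀ i j, ENNReal.ofReal |increment w c' (p i) (p j)| = cutIncrement w c' (p i, p j) := by
    intro i j
    have h1 : cutIncrement w c' (p i, p j) < 1 := by
      refine lt_of_le_of_lt ?_ hcost
      refine le_trans ?_ le_self_add
      refine (Finset.single_le_sum (f := fun j => cutIncrement w c' (p i, p j))
        (fun _ _ => zero_le) (Finset.mem_univ j)).trans ?_
      exact Finset.single_le_sum (f := fun i => ∑ j, cutIncrement w c' (p i, p j))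
        (fun _ _ => zero_le) (Finset.mem_univ i)
    rw [cutIncrement_of_mem (hp1 i) (hp1 j)] at h1 ⊢
    rw [ENNReal.ofReal_lt_one, min_lt_iff] at h1
    rw [min_eq_left (h1.resolve_right (lt_irrefl _)).le]
  have hCE : ∀ s : ℝ, 0 ≤ s → ENNReal.ofReal (s * E) ≤
      ENNReal.ofReal (2 * s) * baseCost w c' ρ z := by
    intro s hs
    have h1 : E ≤ 2 * ∑ i, ∑ j, |increment w c' (p i) (p j)| := h.edgeSeminorm_le (by linarith) hp1
    calc ENNReal.ofReal (s * E)
        ≤ ENNReal.ofReal ((2 * s) * ∑ i, ∑ j, |increment w c' (p i) (p j)|) := by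
          refine ENNReal.ofReal_le_ofReal ?_
          nlinarith
      _ = ENNReal.ofReal (2 * s) * ∑ i, ∑ j, cutIncrement w c' (p i, p j) := by
          rw [ENNReal.ofReal_mul (by positivity), ENNReal.ofReal_sum_of_nonneg
            fun i _ => Finset.sum_nonneg fun j _ => abs_nonneg _]
          congr 1
          refine Finset.sum_congr rfl fun i _ => ?_
          rw [ENNReal.ofReal_sum_of_nonneg fun j _ => abs_nonneg _]
          exact Finset.sum_congr rfl fun j _ => hcut i j
      _ ≤ _ := by
          gcongr
          exact le_self_add
  have hballS : ball (0 : Euc n) (ρ / 2) ⊆ simplexHull z :=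
    (ball_subset_ball (by linarith)).trans (hρS.trans interior_subset)
  have hball1 : ball (0 : Euc n) (ρ / 2) ⊆ ball 0 1 := ball_subset_ball (by linarith)
  refine ⟨a, ha, ?_, ?_⟩
  · refine (eLpNorm_mono_measure _ (Measure.restrict_mono hballS le_rfl)).trans (hbd.trans ?_)
    exact hCE C hC.le
  · have hK : ∀ y ∈ interior (simplexHull z), frobNorm (curvSymGrad G a y) ≤ C * E := fun y hy =>
      le_of_eLpNorm_top_le isOpen_interior interior_subset
        ((continuousOn_frobNorm_curvSymGrad isOpen_ball hGc ha).mono (interior_subset.trans hS1))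
        (by positivity) hbd hy
    have hpt : ∀ q ∈ ball (0 : Euc n) (ρ / 2), ENNReal.ofReal (min ‖w q - a q‖ 1) ≤
        ENNReal.ofReal (8 / ρ) * ∑ i, (cutIncrement w c' (p i, q) +
          ENNReal.ofReal (16 * C * E)) := by
      intro q hq
      have h1 := h.norm_le_sum_inner hρ hκ hS1 (hρS.trans interior_subset) hq (w q - a q)
      have h2 : ∀ i, |⟪w q - a q, c' (p i) q 1⟫| ≤
          |increment w c' (p i) q| + 16 * C * E := by
        intro i
        have h3 := h.abs_increment_le hc hG (by linarith) (by linarith) hS hS1 hρS ha hK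
          (hpS i) hq
        -- The contributions of the vertex cancel because `a` and `w` agree there.
        have h4 : ⟪w q - a q, c' (p i) q 1⟫ =
            increment w c' (p i) q - increment a c' (p i) q := by
          rw [increment, increment, hap, inner_sub_left]
          ring
        rw [h4]
        have h5 := abs_sub (increment w c' (p i) q) (increment a c' (p i) q)
        linarith
      have h6 : ‖w q - a q‖ ≤ 8 / ρ * ∑ i, (|increment w c' (p i) q| + 16 * C * E) := by
        refine h1.trans ?_
        gcongr with i
        exact h2 i
      have hρ8 : 1 ≤ 8 / ρ := by rw [le_div_iff₀ hρ]; linarith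
      have h7 := min_one_le_of_le_sum hρ8 (by positivity) (fun i => abs_nonneg _) h6
      refine (ENNReal.ofReal_le_ofReal h7).trans (le_of_eq ?_)
      rw [ENNReal.ofReal_mul (by positivity), ENNReal.ofReal_sum_of_nonneg fun i _ => by positivity]
      congr 1
      refine Finset.sum_congr rfl fun i _ => ?_
      rw [ENNReal.ofReal_add (by positivity) (by positivity),
        cutIncrement_of_mem (hp1 i) (hball1 hq)]
    have hmi : ∀ i, Measurable fun q => cutIncrement w c' (p i, q) := fun i =>
      hm.comp measurable_prodMk_left
    set N := baseCost w c' ρ z with hN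
    calc ∫⁻ q in ball (0 : Euc n) (ρ / 2), ENNReal.ofReal (min ‖w q - a q‖ 1)
        ≤ ∫⁻ q in ball (0 : Euc n) (ρ / 2), ENNReal.ofReal (8 / ρ) *
            ∑ i, (cutIncrement w c' (p i, q) + ENNReal.ofReal (16 * C * E)) :=
          setLIntegral_mono' measurableSet_ball hpt
      _ = ENNReal.ofReal (8 / ρ) * ((∑ i, ∫⁻ q in ball (0 : Euc n) (ρ / 2),
            cutIncrement w c' (p i, q)) + (n + 1) * (ENNReal.ofReal (16 * C * E) *
              volume (ball (0 : Euc n) (ρ / 2)))) := by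
          rw [lintegral_const_mul' _ _ ENNReal.ofReal_ne_top, lintegral_finsetSum _ fun i _ =>
            (hmi i).add_const _]
          congr 1
          simp only [lintegral_add_left (hmi _), Finset.sum_add_distrib, setLIntegral_const]
          congr 1
          simp
      _ ≤ ENNReal.ofReal (8 / ρ) * (N + (n + 1) * (ENNReal.ofReal (32 * C) * N *
              volume (ball (0 : Euc n) 1))) := by
          have h8 := hCE (16 * C) (by positivity)
          rw [show 2 * (16 * C) = 32 * C by ring] at h8
          gcongr
          exact le_add_self
      _ = _ := by ring

end Field

/-! ### Choice of the scale -/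

section Scale

variable {n : ℕ} {x : Euc n} {lam : Measure (Euc n)}

theorem rescaledMeasure_ball {r : ℝ} (hr : 0 < r) (lam : Measure (Euc n)) (x : Euc n) :
    rescaledMeasure lam r x (ball 0 1) = lam (ball x r) := by
  have hm : Measurable fun y : Euc n => r⁻¹ • (y - x) := by fun_prop
  have h1 : (fun y : Euc n => r⁻¹ • (y - x)) ⁻¹' ball 0 1 = ball x r := by
    ext y
    rw [mem_preimage, mem_ball_zero_iff, mem_ball_iff_norm, norm_smul, norm_inv, Real.norm_eq_abs,
      abs_of_pos hr, inv_mul_lt_iff₀ hr, mul_one]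
  rw [rescaledMeasure, Measure.map_apply hm measurableSet_ball, h1,
    Measure.restrict_apply measurableSet_ball, inter_self]

/-- The vanishing limsup eventually falls below `1 / ((K + 1) m)`, where `m` is the volume of the
unit ball of dimension `n - 1`, and `m` cancels. The condition `1 ≤ n` matches the integer exponent
`1 - n` with the truncated natural subtraction. -/
theorem exists_radius_of_upperDensity_eq_zero (hn : 1 ≤ n) (h : upperDensity lam x = 0)
    {K : ℝ≥0∞} (hK : K ≠ ⊤) :
    ∃ r₀ : ℝ, 0 < r₀ ∧ ∀ r, 0 < r → r < r₀ →
      K * (ENNReal.ofReal (r ^ (1 - (n : ℤ))) * lam (ball x r)) < 1 := by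
  set m := volume (ball (0 : Euc (n - 1)) 1) with hm
  have hm₀ : m ≠ 0 := (measure_ball_pos _ _ one_pos).ne'
  have hmt : m ≠ ⊤ := measure_ball_lt_top.ne
  have hA : (K + 1) * m ≠ ⊤ := ENNReal.mul_ne_top (ENNReal.add_ne_top.2 ⟨hK, ENNReal.one_ne_top⟩) hmt
  have hη : limsup (fun r : ℝ => lam (ball x r) / (m * ENNReal.ofReal (r ^ (n - 1)))) (𝓝[>] 0) <
      1 / ((K + 1) * m) := by
    have h0 : limsup (fun r : ℝ => lam (ball x r) / (m * ENNReal.ofReal (r ^ (n - 1)))) (𝓝[>] 0) =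
      0 := h
    rw [h0]
    exact ENNReal.div_pos one_ne_zero hA
  have hev := eventually_lt_of_limsup_lt hη
  obtain ⟨r₀, hr₀, hsub⟩ := mem_nhdsGT_iff_exists_Ioo_subset.1 hev
  refine ⟨r₀, hr₀, fun r hr hr' => ?_⟩
  have h1 : lam (ball x r) / (m * ENNReal.ofReal (r ^ (n - 1))) < 1 / ((K + 1) * m) :=
    hsub ⟨hr, hr'⟩
  have h2 := ENNReal.mul_lt_of_lt_div h1
  refine lt_of_le_of_lt ?_ h2
  have h3 : r ^ (1 - (n : ℤ)) = (r ^ (n - 1))⁻¹ := by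
    rw [← zpow_natCast, ← zpow_neg]
    congr 1
    push_cast [hn]
    ring
  have hs : ENNReal.ofReal (r ^ (n - 1)) ≠ 0 := (ENNReal.ofReal_pos.2 (by positivity)).ne'
  rw [h3, ENNReal.ofReal_inv_of_pos (by positivity), div_eq_mul_inv,
    ENNReal.mul_inv (Or.inl hm₀) (Or.inl hmt)]
  calc K * ((ENNReal.ofReal (r ^ (n - 1)))⁻¹ * lam (ball x r))
      ≤ (K + 1) * ((ENNReal.ofReal (r ^ (n - 1)))⁻¹ * lam (ball x r)) := by
        gcongr
        exact le_self_add
    _ = (K + 1) * ((ENNReal.ofReal (r ^ (n - 1)))⁻¹ * lam (ball x r)) * (m⁻¹ * m) := by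
        rw [ENNReal.inv_mul_cancel hm₀ hmt, mul_one]
    _ = _ := by ring

theorem ae_comp_add_smul {r : ℝ} (hr : 0 < r) {P : Euc n → Prop} (h : ∀ᵐ y : Euc n, P y) :
    ∀ᵐ z : Euc n, P (x + r • z) := by
  set N := toMeasurable volume {y | ¬ P y} with hN
  have hNm : MeasurableSet N := measurableSet_toMeasurable _ _
  have h0 : volume N = 0 := by rw [hN, measure_toMeasurable]; exact h
  have hm : Measurable fun z : Euc n => x + r • z := by fun_prop
  have h1 := lintegral_comp_add_smul hr x (N.indicator 1)
  rw [lintegral_indicator_one hNm, h0, mul_zero,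
    show (fun p => N.indicator (1 : Euc n → ℝ≥0∞) (x + r • p)) =
      ((fun z => x + r • z) ⁻¹' N).indicator 1 from rfl, lintegral_indicator_one (hm hNm)] at h1
  have hsub : {z : Euc n | ¬ P (x + r • z)} ⊆ (fun z => x + r • z) ⁻¹' N := fun z hz =>
    subset_toMeasurable volume {y | ¬ P y} hz
  exact measure_mono_null hsub h1

end Scale

/-! ### The constants, the admissible scales and the conclusion -/

theorem theoremt (n : ℕ) (hn : 1 ≤ n) (ρ : ℝ) (hρ_pos : 0 < ρ) (hρ_le : ρ ≤ 1)
    (hQ : 0 < volume (goodBase n ρ)) (C : ℝ) (hC : 0 < C) :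
    ∃ c : ℝ, 0 < c ∧
      ∀ F : Euc n → Euc n → Euc n,
        ContDiff ℝ ∞ (fun p : Euc n × Euc n => F p.1 p.2) →
        IsQuadraticField F → RigidInterpolation ρ C F →
      ∀ Ω : Set (Euc n), IsOpen Ω →
      ∀ (u : Euc n → Euc n) (lam : Measure (Euc n)), IsFiniteMeasure lam →
        IsGBDMeasure F Ω u lam →
      ∀ x ∈ Ω, upperDensity lam x = 0 →
      ∃ rx : ℝ, 0 < rx ∧ ball x rx ⊆ Ω ∧ ∀ r : ℝ, 0 < r → r ≤ rx →
        ∃ a : Euc n → Euc n, ContDiffOn ℝ ∞ a (ball 0 1) ∧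
          eLpNorm (fun h => frobNorm (curvSymGrad (rescaledField F r x) a h)) ∞
              (volume.restrict (ball 0 (ρ / 2))) ≤
            ENNReal.ofReal (c * r ^ (1 - (n : ℤ))) * rescaledMeasure lam r x (ball 0 1) ∧
          ∫⁻ z in ball (0 : Euc n) (ρ / 2), ENNReal.ofReal (min ‖u (x + r • z) - a z‖ 1) ≤
            ENNReal.ofReal (c * r ^ (1 - (n : ℤ))) * rescaledMeasure lam r x (ball 0 1) := by
  obtain ⟨δ, hδ0, hδ2, hQδ⟩ := exists_innerBase_pos hQ
  set Q := volume (innerBase n ρ δ) with hQdef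
  have hball : ∀ s : ℝ, volume (ball (0 : Euc n) s) ≠ ⊤ := fun s => measure_ball_lt_top.ne
  -- `K₁` bounds the cost of the selected base point in units of `r ^ (1 - n) λ(B_r(x))`, and `K₂`
  -- sums the constants of both conclusions so that one `c` serves them; all are fixed before `F`.
  set K₁ : ℝ≥0∞ := ((n + 1) * (n + 1) + (n + 1) * volume (ball (0 : Euc n) 2)) * 2 ^ (n + 4) / Q
    with hK₁
  set K₂ : ℝ≥0∞ := ENNReal.ofReal (2 * C) + ENNReal.ofReal (8 / ρ) *
    (1 + (n + 1) * (ENNReal.ofReal (32 * C) * volume (ball (0 : Euc n) 1))) with hK₂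
  have hK₁t : K₁ ≠ ⊤ := by
    refine ENNReal.div_ne_top ?_ hQδ.ne'
    have := hball 2
    finiteness
  have hK₂t : K₂ ≠ ⊤ := by
    have := hball 1
    finiteness
  have hc0 : 0 < (K₂ * K₁).toReal + 1 := by positivity
  refine ⟨(K₂ * K₁).toReal + 1, hc0, ?_⟩
  intro F hF hquad hRI Ω hΩ u lam _ hu x hx hdens
  -- `1 / 20` makes the chords a perturbation of segments, `δ / 6` keeps curves from the inner ball
  -- inside the unit ball, and `ρ / 48` makes the velocity error `κ = 3 ε` at most `ρ / 16`.
  set ε : ℝ := min (1 / 20) (min (δ / 6) (ρ / 48)) with hε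
  have hε0 : 0 < ε := by positivity
  have hε1 : ε ≤ 1 / 20 := min_le_left _ _
  have hε2 : ε ≤ δ / 6 := (min_le_right _ _).trans (min_le_left _ _)
  have hε3 : ε ≤ ρ / 48 := (min_le_right _ _).trans (min_le_right _ _)
  obtain ⟨R, L, e, V, hL, hchart⟩ := exists_isGeodesicChart hF (fun y v w => hquad y v w) x hε0
  have hR := hchart.radius_pos
  obtain ⟨r₁, hr₁, hRIx⟩ := hRI x
  obtain ⟨r₂, hr₂, hr₂Ω⟩ := Metric.isOpen_iff.1 hΩ x hx
  obtain ⟨r₃, hr₃, hr₃K⟩ := exists_radius_of_upperDensity_eq_zero hn hdens hK₁t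
  have hL' : 0 < 30 * (L + 1) := by positivity
  -- The half of `r₃` is taken because the density estimate holds only for `r < r₃`; `L + 1` allows
  -- `L = 0`.
  refine ⟨min (min r₁ r₂) (min (r₃ / 2) (min (R / 10) (1 / (30 * (L + 1))))), by positivity,
    (ball_subset_ball ((min_le_left _ _).trans (min_le_right _ _))).trans hr₂Ω, fun r hr hrle => ?_⟩
  simp only [le_min_iff] at hrle
  obtain ⟨⟨hr1, hr2⟩, hr3, hr4, hr5⟩ := hrle
  have hs : IsSmallScale F x R ε L e V r :=
    { chart := hchart
      eps_nonneg := hε0.le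
      eps_le := hε1
      lip_nonneg := hL
      scale_pos := hr
      scale_le := by linarith
      scale_lip := by
        rw [le_div_iff₀ hL'] at hr5
        nlinarith }
  have hrΩ : ball x r ⊆ Ω := (ball_subset_ball hr2).trans hr₂Ω
  -- Vertex values are pointwise, so a measurable representative is fixed once; the integral
  -- conclusion is insensitive to this choice.
  set v := hu.measurable.mk u with hv
  have hvm : Measurable v := hu.measurable.measurable_mk
  have huv : ∀ᵐ z ∂(volume.restrict (ball x r)), u z = v z :=
    ae_restrict_of_ae_restrict_of_subset hrΩ hu.measurable.ae_eq_mk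
  have hfam := hs.isCurveFamily hF hquad
  set μ := ENNReal.ofReal (r ^ (1 - (n : ℤ))) * lam (ball x r) with hμ
  have hw : Measurable fun z => v (x + r • z) := hvm.comp (by fun_prop)
  have hbound : HasIncrementBound (fun z => v (x + r • z)) (rescaledVelocity e V x r) δ
      (2 ^ (n + 4) * μ) := fun d hd =>
    hs.lintegral_rescaled_increment_le hF hquad hu hrΩ hvm huv (by linarith) hδ0 hd
  obtain ⟨z, hz, hzle⟩ := exists_baseCost_le hfam hw hbound hδ0 hδ2 hρ_le hQδ
  have hcost : baseCost (fun z => v (x + r • z)) (rescaledVelocity e V x r) ρ z ≤ K₁ * μ := by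
    refine hzle.trans (le_of_eq ?_)
    rw [hK₁, ← hQdef, div_eq_mul_inv, div_eq_mul_inv]
    ring
  have hGc : Continuous fun p : Euc n × Euc n => rescaledField F r x p.1 p.2 :=
    (hF.continuous.comp (f := fun p : Euc n × Euc n => (x + r • p.1, p.2)) (by fun_prop)).const_smul r
  have hGq : IsQuadraticField (rescaledField F r x) := fun y v₁ v₂ => by
    simp only [rescaledField]
    rw [← smul_add, hquad, smul_add, smul_comm r, smul_comm r]
  obtain ⟨a, ha, ha1, ha2⟩ := exists_field_of_baseCost_lt_one hfam hGc hGq hw hρ_pos hρ_le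
    (by linarith) hC hz.1 (fun ξ hξ => hRIx z hz.1 _ r hr hr1 ξ hξ)
    (hcost.trans_lt (hr₃K r hr (by linarith)))
  have hfinal : ∀ A ≤ K₂, A * baseCost (fun z => v (x + r • z)) (rescaledVelocity e V x r) ρ z ≤
      ENNReal.ofReal (((K₂ * K₁).toReal + 1) * r ^ (1 - (n : ℤ))) *
        rescaledMeasure lam r x (ball 0 1) := by
    intro A hA
    rw [rescaledMeasure_ball hr, ENNReal.ofReal_mul hc0.le, mul_assoc]
    calc _ ≤ K₂ * (K₁ * μ) := mul_le_mul' hA hcost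
      _ = K₂ * K₁ * μ := (mul_assoc _ _ _).symm
      _ ≤ _ := by
        gcongr
        rw [← ENNReal.ofReal_toReal (ENNReal.mul_ne_top hK₂t hK₁t)]
        refine ENNReal.ofReal_le_ofReal ?_
        rw [ENNReal.ofReal_toReal (ENNReal.mul_ne_top hK₂t hK₁t)]
        linarith
  refine ⟨a, ha, ha1.trans (hfinal _ le_self_add), le_trans (le_of_eq ?_)
    (ha2.trans (hfinal _ le_add_self))⟩
  rw [ae_restrict_iff' measurableSet_ball] at huv
  refine lintegral_congr_ae ?_
  filter_upwards [ae_restrict_mem measurableSet_ball,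
    ae_restrict_of_ae (ae_comp_add_smul (x := x) hr huv)] with y hy hyuv
  rw [hyuv (hs.rescaled_mem_ball (ball_subset_ball (by linarith) hy))]
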